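/- Let $T>0$, let $p\ge 2$ be an even integer, and let $q>p$ be real with $\lfloor q\rfloor=p$. Let $S\in C([0,T],\mathbb R^d)$. **Lebesgue partitions.** The $n$-th dyadic Lebesgue partition $\pi_n$ of $[0,T]$ generated by $S$ consists of $0$, $T$ and all times $\tau^{n,i}_k\in[0,T]$, $1\le i\le d$, where $\tau^{n,i}_0=0$ and $\tau^{n,i}_{k+1}=\inf\{t\ge\tau^{n,i}_k: S_i(t)\in 2^{-n}\mathbb Z\setminus\{S_i(\tau^{n,i}_k)\}\}\wedge T$. Assume $S\in V_p(\pi)$: the oscillation of $S$ along $\pi_n$ tends to $0$, and there is an atomless measure $\mu$ on $[0,T]$ with values in the symmetric $p$-tensors such that, for every continuous $\varphi$ on $[0,T]$ with values in the $p$-tensors, $$\lim_{n\to\infty}\sum_{[t_j,t_{j+1}]\in\pi_n}\langle\varphi(t_j),(S(t_{j+1})-S(t_j))^{\otimes p}\rangle=\int_0^T\langle\varphi,\mathrm d\mu\rangle .$$ Put $[S]^p(t)=\mu([0,t])$. **Reduced rough paths.** For $0\le s\le t\le T$ put $\mathbb X^k_{s,t}=\frac1{k!}(S(t)-S(s))^{\otimes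 k}$ for $0\le k<p$ and $\mathbb X^p_{s,t}=\frac1{p!}(S(t)-S(s))^{\otimes p}-\frac1{p!}([S]^p(t)-[S]^p(s))$. A control function is a continuous $c\ge0$ on $\{0\le s\le t\le T\}$ with $c(t,t)=0$ and $c(s,u)+c(u,t)\le c(s,t)$ for $s\le u\le t$. A symmetric-tensor-valued family $\mathbb X=(\mathbb X^0=1,\mathbb X^1,\dots,\mathbb X^{\lfloor q\rfloor})$ is a reduced rough path of finite $q$-variation if $\sum_{k=1}^{\lfloor q\rfloor}|\mathbb X^k_{s,t}|^{q/k}\le c(s,t)$ for some control function $c$, and $\mathbb X^k_{s,t}=\sum_{l+m=k}\mathrm{Sym}(\mathbb X^l_{s,u}\otimes\mathbb X^m_{u,t})$ for $k\le\lfloor q\rfloor$ and $s\le u\le t$. A continuous path $Y=(Y^0,\dots,Y^{\lfloor q\rfloor})$ of symmetric tensors is controlled by $\mathbb X$ if for some control function $c$ $$\sum_{l=1}^{\lfloor q\rfloor}\Big|Y^l(t)-\sum_{k=l}^{\lfloor q\rfloor}\langle Y^k(s),\mathbb X^{k-l}_{s,t}\rangle\Big|^{q/(\lfloor q\rfloor-l+1)}\le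 c(s,t),\qquad 0\le s\le t\le T .$$ **Statement.** Let $f\in C^{\lfloor q\rfloor}(\mathbb R^d,\mathbb R)$, and put $Y^0=1$, $Y^k=\nabla^kf(S)$ for $1\le k\le\lfloor q\rfloor$. Then: 1. $\mathbb X$ is a reduced rough path of finite $q$-variation. 2. If $\nabla^{\lfloor q\rfloor}f$ is locally Lipschitz continuous (for example if $f\in C^{\lfloor q\rfloor+1}$), then $Y$ is controlled by $\mathbb X$. 3. Whenever $Y$ is controlled by $\mathbb X$, for every $t\in[0,T]$ the rough path integral $$\int_0^t\langle\nabla f(S(s)),\mathrm d\mathbb X(s)\rangle=\lim_{|\pi|\to0}\sum_{[t_j,t_{j+1}]\in\pi}\sum_{k=1}^{\lfloor q\rfloor}\langle Y^k(t_j),\mathbb X^k_{t_j,t_{j+1}}\rangle,$$ the limit being over all finite partitions $\pi$ of $[0,t]$ with mesh $|\pi|\to0$, and the pathwise integral $$\int_0^t\langle\nabla f(S(s)),\mathrm dS(s)\rangle=\lim_{n\to\infty}\sum_{[t_j,t_{j+1}]\in\pi_n}\sum_{k=1}^{p-1}\frac1{k!}\langle\nabla^kf(S(t_j)),(S(t_{j+1}\wedge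 t)-S(t_j\wedge t))^{\otimes k}\rangle$$ both exist, and they are equal. -/

import Mathlib

open Set Filter Topology MeasureTheory

namespace PathwiseRough

/-! ### Partitions -/

/-- A finite partition of `[a, b]`, given by its set of points. -/
structure IntervalPartition (a b : ℝ) where
  points : Finset ℝ
  left_mem : a ∈ points
  right_mem : b ∈ points
  subset_Icc : ∀ x ∈ points, x ∈ Icc a b

/-- The pairs `(t_j, t_{j+1})` of immediate successors in a partition. -/
noncomputable def IntervalPartition.intervals {a b : ℝ} (P : IntervalPartition a b) :
    Finset (ℝ × ℝ) :=
  (P.points ×ˢ P.points).filter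
    (fun e => e.1 < e.2 ∧ ∀ r ∈ P.points, ¬ (e.1 < r ∧ r < e.2))

/-! ### The dyadic Lebesgue partition -/

/-- The successive times at which the real path `x` hits a point of the grid `2⁻ⁿ ℤ` different from
its value at the previous time, the value being `T` when there is no such time left in `[0, T]`. -/
noncomputable def lebesgueTime (T : ℝ) (x : ℝ → ℝ) (n : ℕ) : ℕ → ℝ
  | 0 => 0
  | k + 1 => sInf ({t : ℝ | lebesgueTime T x n k ≤ t ∧ t ≤ T ∧
      (∃ m : ℤ, x t = m * (2⁻¹ : ℝ) ^ n) ∧ x t ≠ x (lebesgueTime T x n k)} ∪ {T})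

theorem lebesgueTime_mem {T : ℝ} (hT : 0 ≤ T) (x : ℝ → ℝ) (n k : ℕ) :
    lebesgueTime T x n k ∈ Icc 0 T := by
  induction k with
  | zero => exact ⟨le_refl 0, hT⟩
  | succ k ih =>
    rw [lebesgueTime]
    constructor
    · refine le_csInf ⟨T, Or.inr rfl⟩ ?_
      rintro t (ht | ht)
      · exact ih.1.trans ht.1
      · rw [mem_singleton_iff.1 ht]; exact hT
    · refine csInf_le ⟨0, ?_⟩ (Or.inr rfl)
      rintro t (ht | ht)
      · exact ih.1.trans ht.1
      · rw [mem_singleton_iff.1 ht]; exact hT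

theorem lebesgueTime_le_succ {T : ℝ} (hT : 0 ≤ T) (x : ℝ → ℝ) (n k : ℕ) :
    lebesgueTime T x n k ≤ lebesgueTime T x n (k + 1) := by
  rw [lebesgueTime]
  refine le_csInf ⟨T, Or.inr rfl⟩ ?_
  rintro t (ht | ht)
  · exact ht.1
  · rw [mem_singleton_iff.1 ht]; exact (lebesgueTime_mem hT x n k).2

theorem lebesgueTime_eq_of_eq {T : ℝ} (hT : 0 ≤ T) (x : ℝ → ℝ) (n : ℕ) {k : ℕ}
    (hk : lebesgueTime T x n k = T) {j : ℕ} (hj : k ≤ j) : lebesgueTime T x n j = T := by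
  induction j, hj using Nat.le_induction with
  | base => exact hk
  | succ j _ ih =>
    exact le_antisymm (lebesgueTime_mem hT x n _).2
      (ih.symm.le.trans (lebesgueTime_le_succ hT x n j))

theorem finite_range_lebesgueTime {T : ℝ} (hT : 0 ≤ T) {x : ℝ → ℝ}
    (hx : ContinuousOn x (Icc 0 T)) (n : ℕ) : (range (lebesgueTime T x n)).Finite := by
  have hε : (0 : ℝ) < (2⁻¹ : ℝ) ^ n := by positivity
  set ε : ℝ := (2⁻¹ : ℝ) ^ n with hεdef
  set G : Set ℝ := {y | ∃ m : ℤ, y = m * ε} with hG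
  have hGc : IsClosed G := by
    have h1 : IsClosed (range ((↑) : ℤ → ℝ)) := Int.isClosedEmbedding_coe_real.isClosed_range
    have h2 := (Homeomorph.mulRight₀ ε hε.ne').isClosedMap _ h1
    convert h2 using 1
    ext y
    constructor
    · rintro ⟨m, rfl⟩
      exact ⟨m, ⟨m, rfl⟩, rfl⟩
    · rintro ⟨_, ⟨m, rfl⟩, rfl⟩
      exact ⟨m, rfl⟩
  have hgap : ∀ y ∈ G, ∀ z ∈ G, y ≠ z → ε ≤ |y - z| := by
    rintro _ ⟨a, rfl⟩ _ ⟨b, rfl⟩ hab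
    have hne : a - b ≠ 0 := fun h => hab (by rw [sub_eq_zero.1 h])
    have h1 : (1 : ℝ) ≤ |(a : ℝ) - b| := by exact_mod_cast Int.one_le_abs hne
    rw [← sub_mul, abs_mul, abs_of_pos hε]
    nlinarith
  obtain ⟨δ, hδ, hδx⟩ := Metric.uniformContinuousOn_iff.1
    (isCompact_Icc.uniformContinuousOn_of_continuous hx) ε hε
  have hclosed : IsClosed (Icc 0 T ∩ x ⁻¹' G) := hx.preimage_isClosed_of_isClosed isClosed_Icc hGc
  have hgrid : ∀ k, lebesgueTime T x n (k + 1) = T ∨ x (lebesgueTime T x n (k + 1)) ∈ G := by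
    intro k
    have hmem : lebesgueTime T x n (k + 1) ∈ closure (Icc 0 T ∩ x ⁻¹' G ∪ {T}) := by
      rw [lebesgueTime]
      refine closure_mono ?_ (csInf_mem_closure ⟨T, Or.inr rfl⟩ ⟨0, ?_⟩)
      · rintro t (ht | ht)
        · exact Or.inl ⟨⟨(lebesgueTime_mem hT x n k).1.trans ht.1, ht.2.1⟩, ht.2.2.1⟩
        · exact Or.inr ht
      · rintro t (ht | ht)
        · exact (lebesgueTime_mem hT x n k).1.trans ht.1
        · rw [mem_singleton_iff.1 ht]; exact hT
    rw [(hclosed.union isClosed_singleton).closure_eq] at hmem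
    rcases hmem with h | h
    · exact Or.inr h.2
    · exact Or.inl h
  have hstep : ∀ k, min (lebesgueTime T x n (k + 1) + δ) T ≤ lebesgueTime T x n (k + 1 + 1) := by
    intro k
    rcases hgrid k with h | h
    · rw [lebesgueTime_eq_of_eq hT x n h (Nat.le_succ _)]
      exact min_le_right _ _
    · conv_rhs => rw [lebesgueTime]
      refine le_csInf ⟨T, Or.inr rfl⟩ ?_
      rintro t (ht | ht)
      · refine (min_le_left _ _).trans ?_
        by_contra hlt
        have hk := lebesgueTime_mem hT x n (k + 1)
        have h1 := hδx t ⟨hk.1.trans ht.1, ht.2.1⟩ _ hk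
          (by rw [Real.dist_eq, abs_of_nonneg (sub_nonneg.2 ht.1)]; linarith)
        rw [Real.dist_eq] at h1
        exact absurd (hgap _ ht.2.2.1 _ h ht.2.2.2) (not_le.2 h1)
      · rw [mem_singleton_iff.1 ht]
        exact min_le_right _ _
  have hlow : ∀ k : ℕ, min (k * δ) T ≤ lebesgueTime T x n (k + 1) := by
    intro k
    induction k with
    | zero => simpa using Or.inl (lebesgueTime_mem hT x n 1).1
    | succ k ih =>
      refine le_trans ?_ (hstep k)
      refine le_min ?_ (min_le_right _ _)
      push_cast
      rcases le_total (k * δ) T with h | h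
      · rw [min_eq_left h] at ih
        exact (min_le_left _ _).trans (by linarith)
      · rw [min_eq_right h] at ih
        exact (min_le_right _ _).trans (by linarith)
  obtain ⟨K, hK⟩ := exists_nat_ge (T / δ)
  have hKT : lebesgueTime T x n (K + 1) = T := by
    refine le_antisymm (lebesgueTime_mem hT x n _).2 ?_
    have h := hlow K
    rwa [min_eq_right ((div_le_iff₀ hδ).1 hK)] at h
  refine ((finite_Iic (K + 1)).image (lebesgueTime T x n)).subset ?_
  rintro _ ⟨j, rfl⟩
  rcases le_total j (K + 1) with h | h
  · exact ⟨j, h, rfl⟩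
  · exact ⟨K + 1, le_refl (K + 1), hKT.trans (lebesgueTime_eq_of_eq hT x n hKT h).symm⟩

/-- The `n`-th dyadic Lebesgue partition generated by a path with values in `ℝ^d`: its points are
the Lebesgue times, at level `n`, of all the coordinates of the path, and the end points. -/
noncomputable def dyadicLebesgue {d : ℕ} {T : ℝ} (hT : 0 ≤ T) {S : ℝ → EuclideanSpace ℝ (Fin d)}
    (hS : ContinuousOn S (Icc 0 T)) (n : ℕ) : IntervalPartition 0 T where
  points := (((finite_singleton T).insert 0).union (finite_iUnion fun i : Fin d =>
    finite_range_lebesgueTime hT (x := fun t => S t i)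
      ((EuclideanSpace.proj (𝕜 := ℝ) i).continuous.comp_continuousOn hS) n)).toFinset
  left_mem := by simp
  right_mem := by simp
  subset_Icc := by
    intro y hy
    simp only [Finite.mem_toFinset] at hy
    rcases hy with hy | hy
    · rcases hy with rfl | hy
      · exact ⟨le_refl _, hT⟩
      · rw [mem_singleton_iff.1 hy]; exact ⟨hT, le_refl _⟩
    · obtain ⟨i, k, rfl⟩ := mem_iUnion.1 hy
      exact lebesgueTime_mem hT _ n k

/-! ### Tensors -/

/-- `k`-tensors on `ℝ^d` in coordinates, with their canonical inner product. -/
abbrev Tens (d k : ℕ) : Type := EuclideanSpace ℝ (Fin k → Fin d)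

/-- The tensor power `v^{⊗ k}`. -/
noncomputable def tpow {d : ℕ} (v : EuclideanSpace ℝ (Fin d)) (k : ℕ) : Tens d k :=
  WithLp.toLp 2 fun i => ∏ j, v (i j)

/-- The tensor product of an `l`-tensor and an `m`-tensor, as a `k`-tensor, where `l + m = k`. -/
noncomputable def tmul {d l m k : ℕ} (h : l + m = k) (A : Tens d l) (B : Tens d m) : Tens d k :=
  WithLp.toLp 2 fun i =>
    A (fun j => i (Fin.cast h (Fin.castAdd m j))) * B (fun j => i (Fin.cast h (Fin.natAdd l j)))

/-- The symmetric part of a tensor. -/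
noncomputable def tsym {d k : ℕ} (A : Tens d k) : Tens d k :=
  WithLp.toLp 2 fun i => (k.factorial : ℝ)⁻¹ * ∑ σ : Equiv.Perm (Fin k), A (fun j => i (σ j))

/-- Symmetric tensors. -/
def IsSymTens {d k : ℕ} (A : Tens d k) : Prop :=
  ∀ (σ : Equiv.Perm (Fin k)) (i : Fin k → Fin d), A (fun j => i (σ j)) = A i

/-- The pairing `⟨A, B⟩` of an `a`-tensor `A` with an `(a + b)`-tensor `B`: the `b`-tensor
`(v₁, …, v_b) ↦ ⟨A ⊗ v₁ ⊗ ⋯ ⊗ v_b, B⟩`. -/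
noncomputable def contract {d a b : ℕ} (A : Tens d a) (B : Tens d (a + b)) : Tens d b :=
  WithLp.toLp 2 fun j => ∑ i : Fin a → Fin d, A i * B (Fin.append i j)

/-- The derivative `∇^k f (x)` as a `k`-tensor. -/
noncomputable def nabla {d : ℕ} (k : ℕ) (f : EuclideanSpace ℝ (Fin d) → ℝ)
    (x : EuclideanSpace ℝ (Fin d)) : Tens d k :=
  WithLp.toLp 2 fun i => iteratedFDeriv ℝ k f x (fun j => EuclideanSpace.single (i j) (1 : ℝ))

/-! ### `p`-th variation along a sequence of partitions -/

/-- `S ∈ V_p(π)`, with limiting tensor valued measure `μ` on `[0, T]`. A homogeneous polynomial of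
degree `p` with continuous coefficients in `t ∈ [0, T]` is `v ↦ ⟨φ t, v^{⊗ p}⟩` with a continuous
tensor valued `φ`, and its pairing with a symmetric tensor is the inner product with `φ t`. -/
structure HasPthVariation {d : ℕ} {T : ℝ} (p : ℕ) (π : ℕ → IntervalPartition 0 T)
    (S : ℝ → EuclideanSpace ℝ (Fin d)) (μ : VectorMeasure (Icc (0 : ℝ) T) (Tens d p)) : Prop where
  osc_tendsto : ∀ ε > 0, ∀ᶠ n in atTop, ∀ e ∈ (π n).intervals,
    ∀ r ∈ Icc e.1 e.2, ∀ s ∈ Icc e.1 e.2, ‖S s - S r‖ ≤ ε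
  symm : ∀ A, IsSymTens (μ A)
  no_atoms : ∀ x, μ {x} = 0
  tendsto : ∀ φ : ℝ → Tens d p, ContinuousOn φ (Icc 0 T) →
    Tendsto (fun n => ∑ e ∈ (π n).intervals, inner ℝ (φ e.1) (tpow (S e.2 - S e.1) p)) atTop
      (𝓝 (μ.integral (fun x => φ x) (innerSL ℝ)))

/-- The `p`-th variation `[S]^p (t) = μ ([0, t])`. -/
noncomputable def pthVariation {d p : ℕ} {T : ℝ} (μ : VectorMeasure (Icc (0 : ℝ) T) (Tens d p))
    (t : ℝ) : Tens d p :=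
  μ {x | (x : ℝ) ≤ t}

/-- `I` is the pathwise integral `∫₀ᵗ ⟨∇f(S), dS⟩`, the limit of the compensated Riemann sums
along the sequence of partitions. -/
def IsPathwiseIntegral {d : ℕ} {T : ℝ} (p : ℕ) (π : ℕ → IntervalPartition 0 T)
    (S : ℝ → EuclideanSpace ℝ (Fin d)) (f : EuclideanSpace ℝ (Fin d) → ℝ) (t I : ℝ) : Prop :=
  Tendsto (fun n => ∑ e ∈ (π n).intervals, ∑ k ∈ Finset.Icc 1 (p - 1),
    (k.factorial : ℝ)⁻¹ * inner ℝ (nabla k f (S e.1)) (tpow (S (min e.2 t) - S (min e.1 t)) k))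
    atTop (𝓝 I)

/-! ### Reduced rough paths and controlled paths -/

/-- Control functions on `{(s, t) : 0 ≤ s ≤ t ≤ T}`. -/
structure IsControl (T : ℝ) (c : ℝ → ℝ → ℝ) : Prop where
  cont : ContinuousOn (fun z : ℝ × ℝ => c z.1 z.2) {z | 0 ≤ z.1 ∧ z.1 ≤ z.2 ∧ z.2 ≤ T}
  nonneg : ∀ s t, 0 ≤ s → s ≤ t → t ≤ T → 0 ≤ c s t
  diag : ∀ t ∈ Icc 0 T, c t t = 0
  superadd : ∀ s u t, 0 ≤ s → s ≤ u → u ≤ t → t ≤ T → c s u + c u t ≤ c s t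

/-- `𝕏 = (1, 𝕏¹, …, 𝕏^⌊q⌋)` is a reduced rough path of finite `q`-variation on `[0, T]`; the
components of order larger than `⌊q⌋` are irrelevant. -/
structure IsReducedRoughPath {d : ℕ} (q T : ℝ) (X : (k : ℕ) → ℝ → ℝ → Tens d k) : Prop where
  zero : ∀ s t, 0 ≤ s → s ≤ t → t ≤ T → ∀ i, X 0 s t i = 1
  symm : ∀ k ≤ ⌊q⌋₊, ∀ s t, 0 ≤ s → s ≤ t → t ≤ T → IsSymTens (X k s t)
  bound : ∃ c, IsControl T c ∧ ∀ s t, 0 ≤ s → s ≤ t → t ≤ T →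
    ∑ k ∈ Finset.Icc 1 ⌊q⌋₊, ‖X k s t‖ ^ (q / k) ≤ c s t
  chen : ∀ k ≤ ⌊q⌋₊, ∀ s u t, 0 ≤ s → s ≤ u → u ≤ t → t ≤ T →
    X k s t = ∑ x : Finset.HasAntidiagonal.antidiagonal k,
      tsym (tmul (Finset.HasAntidiagonal.mem_antidiagonal.1 x.2) (X x.1.1 s u) (X x.1.2 u t))

/-- `Y = (Y⁰, …, Y^⌊q⌋)` is controlled by `𝕏`, that is, `Y ∈ 𝒟_𝕏^{⌊q⌋/q}([0, T])`. In the sum below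
the summation index is `m = k - l`. -/
structure IsControlled {d : ℕ} (q T : ℝ) (X : (k : ℕ) → ℝ → ℝ → Tens d k)
    (Y : (k : ℕ) → ℝ → Tens d k) : Prop where
  cont : ∀ k ≤ ⌊q⌋₊, ContinuousOn (Y k) (Icc 0 T)
  symm : ∀ k ≤ ⌊q⌋₊, ∀ t ∈ Icc 0 T, IsSymTens (Y k t)
  bound : ∃ c, IsControl T c ∧ ∀ s t, 0 ≤ s → s ≤ t → t ≤ T →
    ∑ l ∈ Finset.Icc 1 ⌊q⌋₊,
      ‖Y l t - ∑ m ∈ Finset.range (⌊q⌋₊ - l + 1), contract (X m s t) (Y (m + l) s)‖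
        ^ (q / ((⌊q⌋₊ : ℝ) - l + 1)) ≤ c s t

/-- `I` is the rough path integral `∫₀ᵗ ⟨Y, d𝕏⟩`: the limit, as the mesh size of the partitions
of `[0, t]` tends to zero, of the sums of `∑_{k = 1}^N ⟨Y^k(t_j), 𝕏^k_{t_j, t_{j+1}}⟩`. -/
def IsRoughIntegral {d : ℕ} (N : ℕ) (X : (k : ℕ) → ℝ → ℝ → Tens d k)
    (Y : (k : ℕ) → ℝ → Tens d k) (t I : ℝ) : Prop :=
  ∀ ε > 0, ∃ δ > 0, ∀ P : IntervalPartition 0 t, (∀ e ∈ P.intervals, e.2 - e.1 < δ) →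
    |∑ e ∈ P.intervals, ∑ k ∈ Finset.Icc 1 N, inner ℝ (Y k e.1) (X k e.1 e.2) - I| < ε

/-- The reduced rough path built from `S` and from `V = [S]^p`: `𝕏^k_{s,t}` is
`(S(t) - S(s))^{⊗ k} / k!` for `k ≠ p`, and for `k = p` it is
`(S(t) - S(s))^{⊗ p} / p! - (V(t) - V(s)) / p!`. -/
noncomputable def reducedLift {d p : ℕ} (S : ℝ → EuclideanSpace ℝ (Fin d)) (V : ℝ → Tens d p)
    (k : ℕ) (s t : ℝ) : Tens d k :=
  (k.factorial : ℝ)⁻¹ • tpow (S t - S s) k -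
    if h : k = p then
      (k.factorial : ℝ)⁻¹ • (WithLp.toLp 2 fun i => (V t - V s) (fun j => i (Fin.cast h.symm j)))
    else 0

/-- The path `Y` with `Y⁰ = 1` and `Y^k = ∇^k f(S)` for `k ≥ 1`. -/
noncomputable def gradientPath {d : ℕ} (f : EuclideanSpace ℝ (Fin d) → ℝ)
    (S : ℝ → EuclideanSpace ℝ (Fin d)) (k : ℕ) (s : ℝ) : Tens d k :=
  if k = 0 then WithLp.toLp 2 fun _ => 1 else nabla k f (S s)

end PathwiseRough

namespace PathwiseRough

/-! ### Finite partitions -/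

namespace IntervalPartition

variable {a b : ℝ} (P : IntervalPartition a b)

/-! Both integrals are shown to equal the value dictated by an Itô formula,
$I_t=f(S_t)-f(S_0)-\frac1{p!}\int_0^t\langle\nabla^pf(S),\mathrm d\mu\rangle$.

The quantitative input is special to Lebesgue partitions: on the intervals of $\pi_n$ the path
oscillates by $O(2^{-n})$, and $\pi_n$ has only $O(2^{np})$ points. For the count, let $M$ be the
number of points. Hits of the grid force $M2^{-n}\lesssim\sum|\Delta S_i|$, while Hölder bounds this
sum by $(dM)^{1-1/p}B^{1/p}$, where $B$ bounds the $p$-th power sums; solving for $M$ gives the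
claim (`exists_card_dyadicLebesgue_le`). The bound $B$ comes from testing the convergence to $\mu$
with the tensor of $v\mapsto\sum_i v_i^p$, nonnegative because $p$ is even. Since $q>p$, counting
intervals of $\pi_n$ with weight $2^{-nq}$ gives a convergent series, hence a control for the
$q$-variation of $S$ (`exists_monotone_norm_rpow_le`). The variation of the atomless $\mu$ controls
$[S]^p$. Chen's relation is the multinomial formula, and subtracting the additive increments of
$[S]^p$ at the top level does not disturb it.

Claim 2 is Taylor's formula: for $l\ge1$ the top level of $\mathbb X$ never enters, and the
Lipschitz bound on $\nabla^pf$ supplies the last power.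

For the pathwise integral, a Taylor expansion of order $p$ is summed along $\pi_n$. The remainder is
$o(1)$ times (number of intervals) times $2^{-np}$, so it vanishes, and the terms of order $p$
converge to the integral against $\mu$, also when stopped at $t$ (`tendsto_sum_inner_stopped`).

For the rough integral, let $E_{s,t}$ be the increment of $I$ minus the compensated summand. Chen's
relation and controlledness make $E$ additive up to a control to the power $(p+1)/q>1$. Along
$\pi_n$ restricted to $[s,t]$ the sums of $E$ tend to $0$, by the same Taylor argument. A Young type
inequality then bounds $E_{s,t}$ itself by a multiple of that power of the control, so its sums
vanish along every sequence of partitions with mesh tending to $0$ (`tendsto_sum_intervals_zero`).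
-/

theorem mem_intervals {e : ℝ × ℝ} : e ∈ P.intervals ↔ e.1 ∈ P.points ∧ e.2 ∈ P.points ∧
    e.1 < e.2 ∧ ∀ r ∈ P.points, ¬ (e.1 < r ∧ r < e.2) := by
  simp only [intervals, Finset.mem_filter, Finset.mem_product, and_assoc]

/-- Each point is the left end of at most one interval. -/
theorem card_intervals_le : P.intervals.card ≤ P.points.card := by
  refine Finset.card_le_card_of_injOn Prod.fst (fun e he => (P.mem_intervals.1 he).1) ?_
  intro e he e' he' h
  obtain ⟨_, h2, h3, h4⟩ := P.mem_intervals.1 he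
  obtain ⟨_, h2', h3', h4'⟩ := P.mem_intervals.1 he'
  refine Prod.ext h ?_
  rcases lt_trichotomy e.2 e'.2 with hlt | heq | hlt
  · exact absurd ⟨h ▸ h3, hlt⟩ (h4' _ h2)
  · exact heq
  · exact absurd ⟨h.symm ▸ h3', hlt⟩ (h4 _ h2')

/-- The points of a partition, in increasing order. -/
theorem exists_seq : ∃ (N : ℕ) (u : ℕ → ℝ), u 0 = a ∧ u N = b ∧ Monotone u ∧
    (∀ x, x ∈ P.points ↔ ∃ i ≤ N, u i = x) ∧
    ∀ F : ℝ × ℝ → ℝ, ∑ e ∈ P.intervals, F e = ∑ i ∈ Finset.range N, F (u i, u (i + 1)) := by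
  obtain ⟨N, hN⟩ : ∃ N, P.points.card = N + 1 :=
    Nat.exists_eq_succ_of_ne_zero (Finset.card_ne_zero_of_mem P.left_mem)
  let v := P.points.orderEmbOfFin hN
  let u : ℕ → ℝ := fun i => v ⟨min i N, by omega⟩
  have hu : ∀ i ≤ N, ∀ j ≤ N, u i < u j ↔ i < j := by
    intro i hi j hj
    simp [u, hi, hj]
  have hmono : Monotone u := fun i j hij => v.monotone (by simp only [Fin.mk_le_mk]; omega)
  have hmem : ∀ x, x ∈ P.points ↔ ∃ i ≤ N, u i = x := by
    intro x
    rw [← Finset.mem_coe, ← Finset.range_orderEmbOfFin P.points hN]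
    constructor
    · rintro ⟨i, rfl⟩
      exact ⟨i, by omega, by simp only [u]; congr; omega⟩
    · rintro ⟨i, _, rfl⟩
      exact ⟨_, rfl⟩
  have h0 : u 0 = a := by
    obtain ⟨i, _, hi⟩ := (hmem a).1 P.left_mem
    exact le_antisymm (hi ▸ hmono (Nat.zero_le i))
      (P.subset_Icc _ ((hmem _).2 ⟨0, by omega, rfl⟩)).1
  have h1 : u N = b := by
    obtain ⟨i, hiN, hi⟩ := (hmem b).1 P.right_mem
    exact le_antisymm (P.subset_Icc _ ((hmem _).2 ⟨N, le_rfl, rfl⟩)).2 (hi ▸ hmono hiN)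
  refine ⟨N, u, h0, h1, hmono, hmem, fun F => ?_⟩
  symm
  refine Finset.sum_bij (fun i _ => (u i, u (i + 1))) ?_ ?_ ?_ (fun _ _ => rfl)
  · intro i hi
    rw [Finset.mem_range] at hi
    refine P.mem_intervals.2 ⟨(hmem _).2 ⟨i, hi.le, rfl⟩, (hmem _).2 ⟨i + 1, hi, rfl⟩,
      (hu _ hi.le _ hi).2 (Nat.lt_succ_self i), ?_⟩
    rintro r hr ⟨h1, h2⟩
    obtain ⟨j, hj, rfl⟩ := (hmem r).1 hr
    have h1 := (hu _ hi.le _ hj).1 h1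
    have h2 := (hu _ hj _ hi).1 h2
    omega
  · intro i hi j hj h
    rw [Finset.mem_range] at hi hj
    have h := (Prod.ext_iff.1 h).1
    rcases lt_trichotomy i j with hlt | heq | hlt
    · exact absurd h ((hu _ hi.le _ hj.le).2 hlt).ne
    · exact heq
    · exact absurd h ((hu _ hj.le _ hi.le).2 hlt).ne'
  · rintro ⟨x, y⟩ he
    obtain ⟨hx, hy, hxy, hb⟩ := P.mem_intervals.1 he
    obtain ⟨i, hi, rfl⟩ := (hmem x).1 hx
    obtain ⟨j, hj, rfl⟩ := (hmem y).1 hy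
    have hij := (hu _ hi _ hj).1 hxy
    have hji : j = i + 1 := by
      by_contra hne
      exact hb (u (i + 1)) ((hmem _).2 ⟨i + 1, by omega, rfl⟩)
        ⟨(hu _ hi _ (by omega)).2 (Nat.lt_succ_self i), (hu _ (by omega) _ hj).2 (by omega)⟩
    exact ⟨i, Finset.mem_range.2 (by omega), by rw [hji]⟩

theorem sum_intervals_sub (g : ℝ → ℝ) : ∑ e ∈ P.intervals, (g e.2 - g e.1) = g b - g a := by
  obtain ⟨N, u, h0, h1, -, -, h⟩ := P.exists_seq
  rw [h fun e => g e.2 - g e.1, Finset.sum_range_sub (fun i => g (u i)), h0, h1]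

theorem intervals_mem_Icc {e : ℝ × ℝ} (he : e ∈ P.intervals) :
    a ≤ e.1 ∧ e.1 ≤ e.2 ∧ e.2 ≤ b :=
  have h := P.mem_intervals.1 he
  ⟨(P.subset_Icc _ h.1).1, h.2.2.1.le, (P.subset_Icc _ h.2.1).2⟩

/-- A subinterval whose interior contains no point of the partition lies in one of its
intervals. -/
theorem exists_intervals_of_forall_notMem {s t : ℝ} (hs : a ≤ s) (hst : s < t) (ht : t ≤ b)
    (h : ∀ r ∈ P.points, ¬ (s < r ∧ r < t)) : ∃ e ∈ P.intervals, e.1 ≤ s ∧ t ≤ e.2 := by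
  have hA : (P.points.filter (· ≤ s)).Nonempty := ⟨a, by simp [P.left_mem, hs]⟩
  have hB : (P.points.filter (t ≤ ·)).Nonempty := ⟨b, by simp [P.right_mem, ht]⟩
  have hx := Finset.max'_mem _ hA
  have hy := Finset.min'_mem _ hB
  rw [Finset.mem_filter] at hx hy
  refine ⟨(_, _), P.mem_intervals.2 ⟨hx.1, hy.1, hx.2.trans_lt (hst.trans_le hy.2), ?_⟩,
    hx.2, hy.2⟩
  rintro r hr ⟨h1, h2⟩
  refine h r hr ⟨lt_of_not_ge fun hle => ?_, lt_of_not_ge fun hle => ?_⟩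
  · exact absurd (Finset.le_max' _ r (Finset.mem_filter.2 ⟨hr, hle⟩)) (not_le.2 h1)
  · exact absurd (Finset.min'_le _ r (Finset.mem_filter.2 ⟨hr, hle⟩)) (not_le.2 h2)

end IntervalPartition

/-! ### Young's inequality for almost additive functionals -/

/-- A two parameter functional which is additive up to `C * (H t - H s) ^ θ`, with `θ > 1` and
`H` monotone, differs from its sum over a partition by a multiple of `(H t - H s) ^ θ`. -/
theorem abs_sub_sum_le_rpow {T : ℝ} {E : ℝ → ℝ → ℝ} {H : ℝ → ℝ} {C θ : ℝ} (hC : 0 ≤ C)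
    (hθ : 1 < θ)
    (hH : MonotoneOn H (Icc 0 T)) (hE0 : ∀ t ∈ Icc 0 T, E t t = 0)
    (hE : ∀ s u t, 0 ≤ s → s ≤ u → u ≤ t → t ≤ T →
      |E s t - E s u - E u t| ≤ C * (H t - H s) ^ θ) {u : ℕ → ℝ} (hu : Monotone u) {N : ℕ}
    (hu0 : 0 ≤ u 0) (huN : u N ≤ T) {a b : ℕ} (hab : a ≤ b) (hb : b ≤ N) :
    |E (u a) (u b) - ∑ i ∈ Finset.Ico a b, E (u i) (u (i + 1))| ≤
      2 * C / (1 - 2 ^ (1 - θ)) * (H (u b) - H (u a)) ^ θ := by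
  have h2 : (2 : ℝ) ^ (1 - θ) < 1 := Real.rpow_lt_one_of_one_lt_of_neg one_lt_two (by linarith)
  -- `K` is the fixed point of the recursion below: two splittings cost at most `C * w ^ θ` each,
  -- and two pieces of size at most `w / 2` cost together `2 * K * (w / 2) ^ θ = K * 2 ^ (1 - θ) * w
  -- ^ θ`.
  set K := 2 * C / (1 - 2 ^ (1 - θ)) with hK
  have hKC : 2 * C + K * 2 ^ (1 - θ) = K := by
    rw [hK]; field_simp [(sub_pos.2 h2).ne']; ring
  have hmem : ∀ i ≤ N, u i ∈ Icc 0 T := fun i hi =>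
    ⟨hu0.trans (hu (Nat.zero_le i)), (hu hi).trans huN⟩
  obtain ⟨n, hn⟩ : ∃ n, b - a = n := ⟨_, rfl⟩
  induction n using Nat.strong_induction_on generalizing a b with
  | _ n ih =>
  rcases hab.eq_or_lt with rfl | hlt
  · have : (0:ℝ) ^ θ = 0 := Real.zero_rpow (by linarith)
    simp [hE0 _ (hmem _ hb), this]
  have hM : ∀ i ≤ N, ∀ j ≤ N, i ≤ j → H (u i) ≤ H (u j) := fun i hi j hj hij =>
    hH (hmem i hi) (hmem j hj) (hu hij)
  set w := H (u b) - H (u a) with hw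
  have hw0 : 0 ≤ w := sub_nonneg.2 (hM _ (hab.trans hb) _ hb hab)
  -- `j` is the last index before `b` at which `H` has gained at most half of `w`. The step from `j`
  -- to `j + 1` occurs verbatim in the sum, and the pieces on either side of it carry at most `w /
  -- 2` each, so induction applies to them.
  obtain ⟨j, haj, hjb, hj1, hj2⟩ : ∃ j, a ≤ j ∧ j < b ∧ H (u j) - H (u a) ≤ w / 2 ∧
      H (u b) - H (u (j + 1)) ≤ w / 2 := by
    let Q : ℕ → Prop := fun j => a ≤ j ∧ H (u j) - H (u a) ≤ w / 2
    classical
    have hQ : Q a := ⟨le_rfl, by simp; positivity⟩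
    have hle : a ≤ b - 1 := by omega
    have hg := Nat.findGreatest_spec (P := Q) hle hQ
    refine ⟨Nat.findGreatest Q (b - 1), hg.1, ?_, hg.2, ?_⟩
    · have := Nat.findGreatest_le (P := Q) (b - 1); omega
    · by_cases h : Nat.findGreatest Q (b - 1) + 1 ≤ b - 1
      · have hn := Nat.findGreatest_is_greatest (P := Q) (Nat.lt_succ_self _) h
        by_contra hcon
        refine hn ⟨hg.1.trans (Nat.le_succ _), ?_⟩
        simp only [Nat.succ_eq_add_one]
        linarith
      · have h1 := Nat.findGreatest_le (P := Q) (b - 1)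
        have : Nat.findGreatest Q (b - 1) + 1 = b := by omega
        rw [this]; simp; positivity
  have hsplit : ∑ i ∈ Finset.Ico a b, E (u i) (u (i + 1)) =
      ∑ i ∈ Finset.Ico a j, E (u i) (u (i + 1)) + E (u j) (u (j + 1)) +
        ∑ i ∈ Finset.Ico (j + 1) b, E (u i) (u (i + 1)) := by
    rw [← Finset.sum_Ico_consecutive _ haj hjb.le,
      ← Finset.sum_Ico_consecutive _ (Nat.le_succ j) hjb]
    simp [add_assoc]
  have hC1 := hE (u a) (u j) (u b) (hmem a (by omega)).1 (hu haj) (hu hjb.le) (hmem b hb).2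
  have hC2 := hE (u j) (u (j + 1)) (u b) (hmem j (by omega)).1 (hu (Nat.le_succ j)) (hu hjb)
    (hmem b hb).2
  have hI1 := ih (j - a) (by omega) haj (by omega) rfl
  have hI2 := ih (b - (j + 1)) (by omega) hjb hb rfl
  have hθ0 : 0 ≤ θ := by linarith
  have hK0 : 0 ≤ K := div_nonneg (by positivity) (sub_pos.2 h2).le
  have hhalf : ∀ x, 0 ≤ x → x ≤ w / 2 → K * x ^ θ ≤ K * 2 ^ (1 - θ) * w ^ θ / 2 := by
    intro x hx hxw
    calc K * x ^ θ ≤ K * (w / 2) ^ θ := by gcongr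
      _ = K * 2 ^ (1 - θ) * w ^ θ / 2 := by
        rw [Real.div_rpow hw0 zero_le_two, Real.rpow_sub two_pos, Real.rpow_one]
        field_simp
  have hB1 := hhalf _ (sub_nonneg.2 (hM a (by omega) j (by omega) haj)) hj1
  have hB2 := hhalf _ (sub_nonneg.2 (hM (j + 1) (by omega) b hb hjb)) hj2
  have hB3 : C * (H (u b) - H (u j)) ^ θ ≤ C * w ^ θ := by
    have h1 := hM j (by omega) b hb hjb.le
    have h2 := hM a (by omega) j (by omega) haj
    gcongr
    rw [hw]; linarith
  rw [hsplit]
  have hfin : K * w ^ θ = 2 * C * w ^ θ + K * 2 ^ (1 - θ) * w ^ θ := by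
    rw [← add_mul, hKC]
  rw [hfin]
  rw [abs_le] at *
  constructor <;> linarith [hC1.1, hC1.2, hC2.1, hC2.2, hI1.1, hI1.2, hI2.1, hI2.2]

/-- If an almost additive functional has arbitrarily small sums over some partitions of every
interval, then its sums tend to zero with the mesh of the partition. -/
theorem tendsto_sum_intervals_zero {T : ℝ} {E : ℝ → ℝ → ℝ} {H : ℝ → ℝ} {C θ : ℝ} (hC : 0 ≤ C)
    (hθ : 1 < θ) (hH : MonotoneOn H (Icc 0 T)) (hHc : ContinuousOn H (Icc 0 T))
    (hE0 : ∀ t ∈ Icc 0 T, E t t = 0)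
    (hE : ∀ s u t, 0 ≤ s → s ≤ u → u ≤ t → t ≤ T →
      |E s t - E s u - E u t| ≤ C * (H t - H s) ^ θ)
    (hsmall : ∀ s t, 0 ≤ s → s ≤ t → t ≤ T → ∀ ε > 0, ∃ P : IntervalPartition s t,
      |∑ e ∈ P.intervals, E e.1 e.2| ≤ ε) {t : ℝ} (ht : t ∈ Icc 0 T) :
    ∀ ε > 0, ∃ δ > 0, ∀ P : IntervalPartition 0 t, (∀ e ∈ P.intervals, e.2 - e.1 < δ) →
      |∑ e ∈ P.intervals, E e.1 e.2| < ε := by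
  have h2 : (2 : ℝ) ^ (1 - θ) < 1 := Real.rpow_lt_one_of_one_lt_of_neg one_lt_two (by linarith)
  obtain ⟨K, hK⟩ : ∃ K, K = 2 * C / (1 - 2 ^ (1 - θ)) := ⟨_, rfl⟩
  have hK0 : 0 ≤ K := hK ▸ div_nonneg (by positivity) (sub_pos.2 h2).le
  -- Comparing `E s t` with a partition whose sum is at most `ε` and letting `ε → 0` turns almost
  -- additivity into a pointwise bound on `E`.
  have hbound : ∀ s t, 0 ≤ s → s ≤ t → t ≤ T → |E s t| ≤ K * (H t - H s) ^ θ := by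
    intro s t hs hst htT
    refine le_of_forall_pos_le_add fun ε hε => ?_
    obtain ⟨P, hP⟩ := hsmall s t hs hst htT ε hε
    obtain ⟨N, u, h0, h1, hu, -, hsum⟩ := P.exists_seq
    have h := abs_sub_sum_le_rpow hC hθ hH hE0 hE hu (h0 ▸ hs) (h1 ▸ htT) (Nat.zero_le N) le_rfl
    rw [hsum fun e => E e.1 e.2] at hP
    rw [Nat.Ico_zero_eq_range, h0, h1, ← hK] at h
    have h3 := abs_sub_abs_le_abs_sub (E s t) (∑ i ∈ Finset.range N, E (u i) (u (i + 1)))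
    linarith
  intro ε hε
  have hHT : 0 ≤ H t - H 0 := sub_nonneg.2 (hH ⟨le_rfl, ht.1.trans ht.2⟩ ht ht.1)
  have hlim : Tendsto (fun η : ℝ => K * η ^ (θ - 1) * (H t - H 0)) (𝓝 0) (𝓝 0) := by
    have h : ContinuousAt (fun η : ℝ => K * η ^ (θ - 1) * (H t - H 0)) 0 := by
      have h' : ContinuousAt (fun η : ℝ => η ^ (θ - 1)) 0 :=
        Real.continuousAt_rpow_const _ _ (Or.inr (by linarith))
      exact (h'.const_mul K).mul_const _
    have h' := h.tendsto
    simp only [Real.zero_rpow (by linarith : θ - 1 ≠ 0), mul_zero, zero_mul] at h'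
    exact h'
  -- If `H` grows by at most `η` on each interval, then one factor `(H e.2 - H e.1) ^ (θ - 1)` is at
  -- most `η ^ (θ - 1)` and the remaining increments of `H` telescope.
  obtain ⟨η, hη, hη0⟩ := (((tendsto_order.1 hlim).2 ε hε).filter_mono
    (nhdsWithin_le_nhds (s := Ioi 0)) |>.and self_mem_nhdsWithin).exists
  obtain ⟨δ, hδ, hδH⟩ := Metric.uniformContinuousOn_iff.1
    (isCompact_Icc.uniformContinuousOn_of_continuous hHc) η hη0
  refine ⟨δ, hδ, fun P hP => (?_ : _ ≤ _).trans_lt hη⟩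
  rw [← P.sum_intervals_sub H, Finset.mul_sum]
  refine (Finset.abs_sum_le_sum_abs _ _).trans (Finset.sum_le_sum fun e he => ?_)
  obtain ⟨h1, h2, h3⟩ := P.intervals_mem_Icc he
  have hm1 : e.1 ∈ Icc 0 T := ⟨h1, h2.trans (h3.trans ht.2)⟩
  have hm2 : e.2 ∈ Icc 0 T := ⟨h1.trans h2, h3.trans ht.2⟩
  have hnn : 0 ≤ H e.2 - H e.1 := sub_nonneg.2 (hH hm1 hm2 h2)
  have hlt : H e.2 - H e.1 ≤ η := by
    have := hδH e.2 hm2 e.1 hm1 (by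
      rw [Real.dist_eq, abs_of_nonneg (sub_nonneg.2 h2)]; exact hP e he)
    exact (le_abs_self _).trans this.le
  refine (hbound _ _ h1 h2 hm2.2).trans ?_
  rw [mul_assoc]
  refine mul_le_mul_of_nonneg_left ?_ hK0
  rcases hnn.eq_or_lt with h | h
  · rw [← h, Real.zero_rpow (by linarith), mul_zero]
  · calc (H e.2 - H e.1) ^ θ = (H e.2 - H e.1) ^ (θ - 1) * (H e.2 - H e.1) := by
          rw [Real.rpow_sub_one h.ne']; field_simp
      _ ≤ η ^ (θ - 1) * (H e.2 - H e.1) := by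
          have : 0 ≤ θ - 1 := by linarith
          gcongr

end PathwiseRough

namespace PathwiseRough

/-! ### Lebesgue times -/

/-- Every subset of the dyadic grid is closed. -/
theorem isClosed_of_subset_grid {ε : ℝ} (hε : ε ≠ 0) {A : Set ℝ}
    (hA : ∀ y ∈ A, ∃ m : ℤ, y = m * ε) : IsClosed A := by
  have h1 : IsClosed (((↑) : ℤ → ℝ) '' {m | (m : ℝ) * ε ∈ A}) :=
    Int.isClosedEmbedding_coe_real.isClosedMap _ (isClosed_discrete _)
  have h2 := (Homeomorph.mulRight₀ ε hε).isClosedMap _ h1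
  convert h2 using 1
  ext y
  constructor
  · intro hy
    obtain ⟨m, rfl⟩ := hA y hy
    exact ⟨m, ⟨m, hy, rfl⟩, rfl⟩
  · rintro ⟨_, ⟨m, hm, rfl⟩, rfl⟩
    exact hm

variable {T : ℝ} {x : ℝ → ℝ}

/-- The infimum is attained: the grid with the value `x τ` removed is still closed, so the
admissible times form a closed set. -/
theorem lebesgueTime_succ_mem (hT : 0 ≤ T) (hx : ContinuousOn x (Icc 0 T)) (n k : ℕ) :
    lebesgueTime T x n (k + 1) = T ∨
      ((∃ m : ℤ, x (lebesgueTime T x n (k + 1)) = m * (2⁻¹ : ℝ) ^ n) ∧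
        x (lebesgueTime T x n (k + 1)) ≠ x (lebesgueTime T x n k)) := by
  set τ := lebesgueTime T x n k with hτ
  have hτm : τ ∈ Icc 0 T := lebesgueTime_mem hT x n k
  set G : Set ℝ := {y | (∃ m : ℤ, y = m * (2⁻¹ : ℝ) ^ n) ∧ y ≠ x τ} with hG
  have hGc : IsClosed G := isClosed_of_subset_grid (ε := (2⁻¹ : ℝ) ^ n) (by positivity)
    fun y hy => hy.1
  have hA : IsClosed (Icc τ T ∩ x ⁻¹' G) :=
    (hx.mono (Icc_subset_Icc_left hτm.1)).preimage_isClosed_of_isClosed isClosed_Icc hGc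
  have hmem : lebesgueTime T x n (k + 1) ∈ Icc τ T ∩ x ⁻¹' G ∪ {T} := by
    have heq : {t : ℝ | τ ≤ t ∧ t ≤ T ∧ (∃ m : ℤ, x t = m * (2⁻¹ : ℝ) ^ n) ∧ x t ≠ x τ} ∪ {T} =
        Icc τ T ∩ x ⁻¹' G ∪ {T} := by
      ext t; simp [hG, and_assoc]
    rw [lebesgueTime, ← hτ, heq]
    refine (hA.union isClosed_singleton).csInf_mem ⟨T, Or.inr rfl⟩ ⟨τ, ?_⟩
    rintro t (ht | rfl)
    · exact ht.1.1
    · exact hτm.2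
  rcases hmem with h | h
  · exact Or.inr h.2
  · exact Or.inl h

theorem lebesgueTime_monotone (hT : 0 ≤ T) (x : ℝ → ℝ) (n : ℕ) :
    Monotone (lebesgueTime T x n) :=
  monotone_nat_of_le_succ (lebesgueTime_le_succ hT x n)

theorem lebesgueTime_lt_succ (hT : 0 ≤ T) (hx : ContinuousOn x (Icc 0 T)) (n k : ℕ)
    (hk : lebesgueTime T x n k < T) : lebesgueTime T x n k < lebesgueTime T x n (k + 1) := by
  refine lt_of_le_of_ne (lebesgueTime_le_succ hT x n k) fun h => ?_
  rcases lebesgueTime_succ_mem hT hx n k with h1 | h1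
  · exact hk.ne (h.trans h1)
  · exact h1.2 (by rw [← h])

/-- Otherwise the times would increase strictly forever, against the finiteness of their range. -/
theorem exists_lebesgueTime_eq (hT : 0 ≤ T) (hx : ContinuousOn x (Icc 0 T)) (n : ℕ) :
    ∃ K, lebesgueTime T x n K = T := by
  by_contra! h
  have hlt : ∀ k, lebesgueTime T x n k < T := fun k =>
    lt_of_le_of_ne (lebesgueTime_mem hT x n k).2 (h k)
  have hmono : StrictMono (lebesgueTime T x n) :=
    strictMono_nat_of_lt_succ fun k => lebesgueTime_lt_succ hT hx n k (hlt k)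
  exact infinite_range_of_injective hmono.injective (finite_range_lebesgueTime hT hx n)

/-- Between two consecutive Lebesgue times the path stays within distance `2⁻ⁿ` of its initial
value. -/
theorem abs_sub_lebesgueTime_le (hT : 0 ≤ T) (hx : ContinuousOn x (Icc 0 T)) (n k : ℕ) {t : ℝ}
    (ht : t ∈ Icc (lebesgueTime T x n k) (lebesgueTime T x n (k + 1))) :
    |x t - x (lebesgueTime T x n k)| ≤ (2⁻¹ : ℝ) ^ n := by
  set ε := (2⁻¹ : ℝ) ^ n with hεd
  have hε : 0 < ε := by positivity
  set τ := lebesgueTime T x n k with hτ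
  have hτm : τ ∈ Icc 0 T := lebesgueTime_mem hT x n k
  have htT : t ≤ T := ht.2.trans (lebesgueTime_mem hT x n _).2
  have hcont : ContinuousOn x (uIcc τ t) := by
    rw [uIcc_of_le ht.1]
    exact hx.mono (Icc_subset_Icc hτm.1 htT)
  by_contra! hlt
  -- Values more than one mesh apart have a grid point strictly between them, which the path visits
  -- before `t`; this contradicts the choice of the next time. Floor plus one and ceiling minus one
  -- give a grid point different from `x τ` even when `x τ` lies on the grid.
  have key : ∃ m : ℤ, (m : ℝ) * ε ∈ uIcc (x τ) (x t) ∧ (m : ℝ) * ε ≠ x τ ∧ (m : ℝ) * ε ≠ x t := by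
    rcases lt_abs.1 hlt with h | h
    · refine ⟨⌊x τ / ε⌋ + 1, ?_⟩
      have h1 := Int.lt_floor_add_one (x τ / ε)
      have h2 := Int.floor_le (x τ / ε)
      rw [div_lt_iff₀ hε] at h1
      rw [le_div_iff₀ hε] at h2
      rw [uIcc_of_le (by linarith)]
      push_cast
      refine ⟨⟨h1.le, by linarith⟩, h1.ne', by linarith⟩
    · refine ⟨⌈x τ / ε⌉ - 1, ?_⟩
      have h1 := Int.ceil_lt_add_one (x τ / ε)
      have h2 := Int.le_ceil (x τ / ε)
      rw [← sub_lt_iff_lt_add, lt_div_iff₀ hε] at h1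
      rw [div_le_iff₀ hε] at h2
      rw [uIcc_of_ge (by linarith)]
      push_cast
      refine ⟨⟨by linarith, h1.le⟩, h1.ne, by linarith⟩
  obtain ⟨m, hm, hm1, hm2⟩ := key
  obtain ⟨r, hr, hrm⟩ := intermediate_value_uIcc hcont hm
  rw [uIcc_of_le ht.1] at hr
  have hrt : r < t := lt_of_le_of_ne hr.2 fun h => hm2 (by rw [← hrm, h])
  have hle : lebesgueTime T x n (k + 1) ≤ r := by
    rw [lebesgueTime]
    refine csInf_le ⟨τ, ?_⟩ (Or.inl ⟨hr.1, hr.2.trans htT, ⟨m, hrm⟩, ?_⟩)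
    · rintro s (hs | rfl)
      · exact hs.1
      · exact hτm.2
    · rw [hrm]; exact hm1
  linarith [ht.2]

/-- Consecutive Lebesgue times inside `(0, T)` are separated by increments of size `2⁻ⁿ`. -/
theorem le_abs_sub_lebesgueTime (hT : 0 ≤ T) (hx : ContinuousOn x (Icc 0 T)) (n k : ℕ)
    (hk : lebesgueTime T x n (k + 1 + 1) < T) :
    (2⁻¹ : ℝ) ^ n ≤ |x (lebesgueTime T x n (k + 1 + 1)) - x (lebesgueTime T x n (k + 1))| := by
  have hε : (0 : ℝ) < (2⁻¹ : ℝ) ^ n := by positivity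
  -- Both values must lie on the grid. This excludes the time of index `0`, whose value is
  -- arbitrary, and the conventional value `T`.
  obtain ⟨⟨a, ha⟩, hne⟩ := (lebesgueTime_succ_mem hT hx n (k + 1)).resolve_left hk.ne
  obtain ⟨⟨b, hb⟩, -⟩ := (lebesgueTime_succ_mem hT hx n k).resolve_left
    ((lebesgueTime_le_succ hT x n (k + 1)).trans_lt hk).ne
  rw [ha, hb] at hne ⊢
  have hab : a - b ≠ 0 := fun h => hne (by rw [sub_eq_zero.1 h])
  have h1 : (1 : ℝ) ≤ |(a : ℝ) - b| := by exact_mod_cast Int.one_le_abs hab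
  rw [← sub_mul, abs_mul, abs_of_pos hε]
  nlinarith

/-- The number of Lebesgue times is controlled by the variation along any partition which contains
them. -/
theorem exists_lebesgueTime_finset (hT : 0 ≤ T) (hx : ContinuousOn x (Icc 0 T)) (n : ℕ)
    (P : IntervalPartition 0 T) (hP : ∀ k, lebesgueTime T x n k ∈ P.points) :
    ∃ A : Finset ℝ, range (lebesgueTime T x n) ⊆ A ∧
      (A.card : ℝ) * (2⁻¹ : ℝ) ^ n ≤
        3 * (2⁻¹ : ℝ) ^ n + ∑ e ∈ P.intervals, |x e.2 - x e.1| := by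
  classical
  have hex := exists_lebesgueTime_eq hT hx n
  set K := Nat.find hex with hKdef
  have hK : lebesgueTime T x n K = T := Nat.find_spec hex
  have hlt : ∀ k < K, lebesgueTime T x n k < T := fun k hk =>
    lt_of_le_of_ne (lebesgueTime_mem hT x n k).2 (Nat.find_min hex hk)
  have hmono := lebesgueTime_monotone hT x n
  obtain ⟨N, u, h0, h1, hu, hmem, hsum⟩ := P.exists_seq
  choose j hjN hj using fun k => (hmem _).1 (hP k)
  have hvar : ∀ m, m + 1 < K → m * (2⁻¹ : ℝ) ^ n ≤
      ∑ i ∈ Finset.range (j (m + 1)), |x (u (i + 1)) - x (u i)| := by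
    intro m
    induction m with
    | zero => intro _; simp; exact Finset.sum_nonneg fun _ _ => abs_nonneg _
    | succ m ih =>
      intro hm
      have hjj : j (m + 1) ≤ j (m + 1 + 1) := by
        by_contra! hcon
        have h2 := hu hcon.le
        rw [hj, hj] at h2
        exact absurd (lebesgueTime_lt_succ hT hx n (m + 1) (hlt _ (by omega))) (not_lt.2 h2)
      rw [← Finset.sum_range_add_sum_Ico _ hjj]
      have h2 := ih (by omega)
      have h3 := le_abs_sub_lebesgueTime hT hx n m (hlt _ (by omega))
      have h4 : |x (lebesgueTime T x n (m + 1 + 1)) - x (lebesgueTime T x n (m + 1))| ≤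
          ∑ i ∈ Finset.Ico (j (m + 1)) (j (m + 1 + 1)), |x (u (i + 1)) - x (u i)| := by
        rw [← hj (m + 1 + 1), ← hj (m + 1), ← Finset.sum_Ico_sub (fun i => x (u i)) hjj]
        exact Finset.abs_sum_le_sum_abs _ _
      push_cast
      linarith
  refine ⟨(Finset.range (K + 1)).image (lebesgueTime T x n), ?_, ?_⟩
  · rintro _ ⟨k, rfl⟩
    simp only [Finset.coe_image, Finset.coe_range]
    rcases lt_or_ge k (K + 1) with h | h
    · exact ⟨k, h, rfl⟩
    · exact ⟨K, Nat.lt_succ_self K, hK.trans (lebesgueTime_eq_of_eq hT x n hK (by omega)).symm⟩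
  · have hcard : (((Finset.range (K + 1)).image (lebesgueTime T x n)).card : ℝ) ≤ K + 1 := by
      exact_mod_cast Finset.card_image_le.trans (by simp)
    have hε : (0 : ℝ) < (2⁻¹ : ℝ) ^ n := by positivity
    refine (mul_le_mul_of_nonneg_right hcard hε.le).trans ?_
    -- Of the `K + 1` times, only the `K - 2` gaps between the first and the `(K - 1)`-th time are
    -- known to carry an increment of size `2⁻ⁿ`; hence the loss of `3` in the statement.
    rcases Nat.lt_or_ge K 2 with h | h
    · have : (K : ℝ) + 1 ≤ 3 := by exact_mod_cast (by omega : K + 1 ≤ 3)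
      have hs : 0 ≤ ∑ e ∈ P.intervals, |x e.2 - x e.1| := Finset.sum_nonneg fun _ _ => abs_nonneg _
      nlinarith
    · obtain ⟨m, hm⟩ : ∃ m, K = m + 2 := ⟨K - 2, by omega⟩
      have h2 := hvar m (by omega)
      rw [hsum fun e => |x e.2 - x e.1|]
      have h3 : ∑ i ∈ Finset.range (j (m + 1)), |x (u (i + 1)) - x (u i)| ≤
          ∑ i ∈ Finset.range N, |x (u (i + 1)) - x (u i)| :=
        Finset.sum_le_sum_of_subset_of_nonneg (Finset.range_mono (hjN _))
          fun _ _ _ => abs_nonneg _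
      have h4 : (K : ℝ) = m + 2 := by exact_mod_cast hm
      rw [h4]
      linarith

end PathwiseRough

namespace PathwiseRough

/-! ### Size and oscillation of the dyadic Lebesgue partitions -/

theorem euclidean_norm_le_card_mul {ι : Type*} [Fintype ι] {v : EuclideanSpace ℝ ι} {m : ℝ}
    (hm : 0 ≤ m) (h : ∀ i, |v i| ≤ m) : ‖v‖ ≤ Fintype.card ι * m := by
  rw [EuclideanSpace.norm_eq, Real.sqrt_le_left (by positivity)]
  have h1 : ∑ i, ‖v i‖ ^ 2 ≤ ∑ _i : ι, m ^ 2 :=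
    Finset.sum_le_sum fun i _ => by
      rw [Real.norm_eq_abs]
      exact pow_le_pow_left₀ (abs_nonneg _) (h i) 2
  have h2 : (Fintype.card ι : ℝ) ≤ Fintype.card ι ^ 2 := by
    exact_mod_cast Nat.le_self_pow two_ne_zero (Fintype.card ι)
  simp only [Finset.sum_const, Finset.card_univ, nsmul_eq_mul] at h1
  nlinarith [sq_nonneg m]

variable {d : ℕ} {T : ℝ} {S : ℝ → EuclideanSpace ℝ (Fin d)}

theorem continuousOn_coord (hS : ContinuousOn S (Icc 0 T)) (i : Fin d) :
    ContinuousOn (fun t => S t i) (Icc 0 T) :=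
  (EuclideanSpace.proj (𝕜 := ℝ) i).continuous.comp_continuousOn hS

theorem mem_points_dyadicLebesgue {hT : 0 ≤ T} {hS : ContinuousOn S (Icc 0 T)} {n : ℕ} {t : ℝ} :
    t ∈ (dyadicLebesgue hT hS n).points ↔
      (t = 0 ∨ t = T) ∨ ∃ i k, lebesgueTime T (fun t => S t i) n k = t := by
  simp only [dyadicLebesgue, Finite.mem_toFinset]
  constructor
  · rintro (h | h)
    · exact Or.inl h
    · obtain ⟨i, k, hk⟩ := mem_iUnion.1 h
      exact Or.inr ⟨i, k, hk⟩
  · rintro (h | ⟨i, k, hk⟩)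
    · exact Or.inl h
    · exact Or.inr (mem_iUnion.2 ⟨i, k, hk⟩)

/-- The oscillation of a path on the intervals of its `n`-th dyadic Lebesgue partition is of order
`2⁻ⁿ`. -/
theorem norm_sub_le_of_mem_dyadicLebesgue (hT : 0 ≤ T) (hS : ContinuousOn S (Icc 0 T)) (n : ℕ)
    {e : ℝ × ℝ} (he : e ∈ (dyadicLebesgue hT hS n).intervals) {r s : ℝ} (hr : r ∈ Icc e.1 e.2)
    (hs : s ∈ Icc e.1 e.2) : ‖S r - S s‖ ≤ d * (2 * (2⁻¹ : ℝ) ^ n) := by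
  refine (euclidean_norm_le_card_mul (m := 2 * (2⁻¹ : ℝ) ^ n) (by positivity) fun i => ?_).trans_eq
    (by rw [Fintype.card_fin])
  have hx := continuousOn_coord hS i
  have hI := (dyadicLebesgue hT hS n).intervals_mem_Icc he
  obtain ⟨_, _, hlt, hno⟩ := (dyadicLebesgue hT hS n).mem_intervals.1 he
  -- The interval `e` lies between two consecutive Lebesgue times of the coordinate `i`, namely the
  -- last one before or at `e.1` and its successor. Comparison with the value at the former gives
  -- the factor `2`.
  have hex : ∃ k, e.1 < lebesgueTime T (fun t => S t i) n k := by
    obtain ⟨K, hK⟩ := exists_lebesgueTime_eq hT hx n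
    exact ⟨K, by rw [hK]; exact hlt.trans_le hI.2.2⟩
  classical
  obtain ⟨k, hk⟩ : ∃ k, Nat.find hex = k + 1 := by
    refine Nat.exists_eq_succ_of_ne_zero fun h0 => ?_
    have h := Nat.find_spec hex
    rw [h0, lebesgueTime] at h
    exact absurd h (not_lt.2 hI.1)
  have h1 : lebesgueTime T (fun t => S t i) n k ≤ e.1 :=
    not_lt.1 (Nat.find_min hex (by omega))
  have h2 : e.2 ≤ lebesgueTime T (fun t => S t i) n (k + 1) := by
    by_contra! hcon
    refine hno _ (mem_points_dyadicLebesgue.2 (Or.inr ⟨i, k + 1, rfl⟩)) ⟨?_, hcon⟩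
    rw [← hk]
    exact Nat.find_spec hex
  have hr' := abs_sub_lebesgueTime_le hT hx n k (t := r) ⟨h1.trans hr.1, hr.2.trans h2⟩
  have hs' := abs_sub_lebesgueTime_le hT hx n k (t := s) ⟨h1.trans hs.1, hs.2.trans h2⟩
  simp only [PiLp.sub_apply]
  rw [abs_le] at *
  constructor <;> linarith [hr'.1, hr'.2, hs'.1, hs'.2]

/-- If the `p`-th power sums along the dyadic Lebesgue partitions are bounded, then the `n`-th
partition has at most of the order of `2 ^ (n p)` points. -/
theorem exists_card_dyadicLebesgue_le (hT : 0 ≤ T) (hS : ContinuousOn S (Icc 0 T)) {p : ℕ}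
    (hp : 0 < p) {B : ℝ} (hB : ∀ n, ∑ e ∈ (dyadicLebesgue hT hS n).intervals,
      ∑ i, |S e.2 i - S e.1 i| ^ p ≤ B) :
    ∃ C, 0 < C ∧ ∀ n, ((dyadicLebesgue hT hS n).points.card : ℝ) ≤ C * ((2 : ℝ) ^ n) ^ p := by
  classical
  obtain ⟨m, rfl⟩ : ∃ m, p = m + 1 := ⟨p - 1, by omega⟩
  have hB0 : 0 ≤ B := le_trans (Finset.sum_nonneg fun e _ => Finset.sum_nonneg fun i _ => by
    positivity) (hB 0)
  refine ⟨2 * (2 + 3 * d) + 2 ^ (m + 1) * d ^ m * B, by positivity, fun n => ?_⟩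
  set P := dyadicLebesgue hT hS n with hP
  set M : ℝ := (P.points.card : ℝ) with hM
  set ε : ℝ := (2⁻¹ : ℝ) ^ n with hεd
  have hε : 0 < ε := by positivity
  have h2n : (2 : ℝ) ^ n = ε⁻¹ := by rw [hεd, inv_pow, inv_inv]
  have hM0 : 0 < M := by
    rw [hM]; exact_mod_cast Finset.card_pos.2 ⟨_, P.left_mem⟩
  choose A hA1 hA2 using fun i => exists_lebesgueTime_finset hT (continuousOn_coord hS i) n P
    fun k => mem_points_dyadicLebesgue.2 (Or.inr ⟨i, k, rfl⟩)
  have hsub : P.points ⊆ {0, T} ∪ Finset.univ.biUnion A := by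
    intro t ht
    rcases mem_points_dyadicLebesgue.1 ht with (rfl | rfl) | ⟨i, k, rfl⟩
    · simp
    · simp
    · exact Finset.mem_union_right _ (Finset.mem_biUnion.2 ⟨i, Finset.mem_univ _, hA1 i ⟨k, rfl⟩⟩)
  have hMle : M ≤ 2 + ∑ i, ((A i).card : ℝ) := by
    have h := (Finset.card_le_card hsub).trans ((Finset.card_union_le _ _).trans
      (add_le_add Finset.card_le_two Finset.card_biUnion_le))
    rw [hM]
    exact_mod_cast h
  set X : ℝ := ∑ z ∈ P.intervals ×ˢ (Finset.univ : Finset (Fin d)), |S z.1.2 z.2 - S z.1.1 z.2|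
    with hX
  have hX0 : 0 ≤ X := Finset.sum_nonneg fun _ _ => abs_nonneg _
  -- Counting the points coordinate by coordinate bounds their number by the total 1-variation `X`
  -- along the partition, up to `2 + 3 * d` exceptional points.
  have hMX : M * ε ≤ (2 + 3 * d) * ε + X := by
    have h1 : M * ε ≤ 2 * ε + ∑ i, (A i).card * ε := by
      rw [← Finset.sum_mul, ← add_mul]
      exact mul_le_mul_of_nonneg_right hMle hε.le
    have h2 := Finset.sum_le_sum fun i (_ : i ∈ Finset.univ) => hA2 i
    rw [Finset.sum_add_distrib, Finset.sum_comm, ← Finset.sum_product'] at h2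
    simp only [← hεd, ← hX, Finset.sum_const, Finset.card_univ, Fintype.card_fin,
      nsmul_eq_mul] at h2
    have h3 : (2 + 3 * (d : ℝ)) * ε = 2 * ε + d * (3 * ε) := by ring
    rw [h3]
    linarith
  have hone : (1 : ℝ) ≤ (2 ^ n) ^ (m + 1) := one_le_pow₀ (one_le_pow₀ one_le_two)
  -- Power mean inequality over at most `M * d` terms. Together with `M * ε ≲ X` it reads `M ^ (m +
  -- 1) * ε ^ (m + 1) ≲ M ^ m`, which bounds `M`.
  have hpow : X ^ (m + 1) ≤ (M * d) ^ m * B := by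
    refine (pow_sum_le_card_mul_sum_pow (fun _ _ => abs_nonneg _) m).trans ?_
    rw [Finset.sum_product, Finset.card_product, Finset.card_univ, Fintype.card_fin]
    have h1 : (P.intervals.card : ℝ) ≤ M := by rw [hM]; exact_mod_cast P.card_intervals_le
    push_cast
    gcongr
    exact hB n
  -- For large `M` the exceptional points are absorbed into half of `M * ε`; small `M` is covered by
  -- the first summand of the constant.
  rcases le_or_gt M (2 * (2 + 3 * d)) with hle | hgt
  · calc M ≤ 2 * (2 + 3 * d) + 2 ^ (m + 1) * d ^ m * B := hle.trans (by
          have : 0 ≤ 2 ^ (m + 1) * (d : ℝ) ^ m * B := by positivity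
          linarith)
      _ ≤ _ := le_mul_of_one_le_right (by positivity) hone
  · have h1 : M * ε / 2 ≤ X := by nlinarith
    have h2 := (pow_le_pow_left₀ (by positivity) h1 (m + 1)).trans hpow
    have h3 : M ≤ (2 ^ (m + 1) * d ^ m * B) * (2 ^ n) ^ (m + 1) := by
      rw [h2n, inv_pow, ← div_eq_mul_inv, le_div_iff₀ (by positivity)]
      rw [div_pow, mul_pow, mul_pow, div_le_iff₀ (by positivity), pow_succ M] at h2
      have h4 : M ^ m * (M * ε ^ (m + 1)) ≤ M ^ m * (2 ^ (m + 1) * d ^ m * B) := by nlinarith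
      exact le_of_mul_le_mul_left h4 (by positivity)
    refine h3.trans (mul_le_mul_of_nonneg_right ?_ (by positivity))
    have : 0 ≤ 2 * (2 + 3 * (d : ℝ)) := by positivity
    linarith

/-! ### The control of the `q`-variation -/

/-- The continuous piecewise linear function which increases from `0` to `1` on `[a, b]`. -/
noncomputable def ramp (a b t : ℝ) : ℝ := max 0 (min 1 ((t - a) / (b - a)))

theorem continuous_ramp (a b : ℝ) : Continuous (ramp a b) := by
  unfold ramp
  fun_prop

theorem monotone_ramp {a b : ℝ} (h : a ≤ b) : Monotone (ramp a b) := by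
  intro s t hst
  unfold ramp
  have : 0 ≤ b - a := sub_nonneg.2 h
  gcongr

theorem ramp_nonneg (a b t : ℝ) : 0 ≤ ramp a b t := le_max_left _ _

theorem ramp_le_one (a b t : ℝ) : ramp a b t ≤ 1 := max_le zero_le_one (min_le_left _ _)

theorem ramp_of_le {a b t : ℝ} (hab : a ≤ b) (h : t ≤ a) : ramp a b t = 0 :=
  max_eq_left ((min_le_right _ _).trans
    (div_nonpos_of_nonpos_of_nonneg (by linarith) (by linarith)))

theorem ramp_of_ge {a b t : ℝ} (hab : a < b) (h : b ≤ t) : ramp a b t = 1 := by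
  have : 1 ≤ (t - a) / (b - a) := by rw [le_div_iff₀ (by linarith)]; linarith
  rw [ramp, min_eq_left this, max_eq_right zero_le_one]

theorem IntervalPartition.exists_intervals_subset_Icc {a b : ℝ} (P : IntervalPartition a b)
    {r r' : ℝ} (hr : r ∈ P.points) (hr' : r' ∈ P.points) (h : r < r') :
    ∃ e ∈ P.intervals, r ≤ e.1 ∧ e.2 ≤ r' := by
  have hne : (P.points.filter (r < ·)).Nonempty := ⟨r', by simp [hr', h]⟩
  have hm := Finset.mem_filter.1 (Finset.min'_mem _ hne)
  refine ⟨(r, _), P.mem_intervals.2 ⟨hr, hm.1, hm.2, ?_⟩, le_rfl,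
    Finset.min'_le _ _ (Finset.mem_filter.2 ⟨hr', h⟩)⟩
  rintro y hy ⟨h1, h2⟩
  exact absurd (Finset.min'_le _ y (Finset.mem_filter.2 ⟨hy, h1⟩)) (not_le.2 h2)

/-- If a path oscillates by at most `η` on the intervals of a partition, then it oscillates by at
most `2 η` on every interval which contains no interval of the partition. -/
theorem IntervalPartition.exists_intervals_of_lt_norm_sub {a b : ℝ} (P : IntervalPartition a b)
    {η : ℝ} (hη : ∀ e ∈ P.intervals, ∀ r ∈ Icc e.1 e.2, ∀ s ∈ Icc e.1 e.2, ‖S r - S s‖ ≤ η)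
    {s t : ℝ} (hs : a ≤ s) (hst : s < t) (ht : t ≤ b) (h : 2 * η < ‖S t - S s‖) (hη0 : 0 ≤ η) :
    ∃ e ∈ P.intervals, s ≤ e.1 ∧ e.2 ≤ t := by
  by_contra! hcon
  have hsingle : ∀ s' t', a ≤ s' → s' < t' → t' ≤ b →
      (∀ r ∈ P.points, ¬ (s' < r ∧ r < t')) → ‖S t' - S s'‖ ≤ η := by
    intro s' t' hs' hst' ht' hno
    obtain ⟨e, he, h1, h2⟩ := P.exists_intervals_of_forall_notMem hs' hst' ht' hno
    exact hη e he _ ⟨h1.trans hst'.le, h2⟩ _ ⟨h1, hst'.le.trans h2⟩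
  by_cases hno : ∀ r ∈ P.points, ¬ (s < r ∧ r < t)
  · linarith [hsingle s t hs hst ht hno]
  · push Not at hno
    obtain ⟨r, hr, hsr, hrt⟩ := hno
    -- Two partition points inside `(s, t)` would enclose an interval of the partition. So there is
    -- only one, and the path is estimated on either side of it.
    have hpair : ∀ y ∈ P.points, ∀ y' ∈ P.points, s < y → y < y' → y' < t → False := by
      intro y hy y' hy' h1 h2 h3
      obtain ⟨e, he, h4, h5⟩ := P.exists_intervals_subset_Icc hy hy' h2
      exact absurd (h5.trans h3.le) (not_le.2 (hcon e he (h1.le.trans h4)))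
    have h1 := hsingle s r hs hsr (hrt.le.trans ht) fun y hy hy' =>
      hpair y hy r hr hy'.1 hy'.2 hrt
    have h2 := hsingle r t (hs.trans hsr.le) hrt ht fun y hy hy' =>
      hpair r hr y hy hsr hy'.1 hy'.2
    have h3 := norm_sub_le_norm_sub_add_norm_sub (S t) (S r) (S s)
    linarith

/-- A path which oscillates by `O(2⁻ⁿ)` on the intervals of partitions with `O(2 ^ (n p))` points
has finite `q`-variation for all `q > p`. -/
theorem exists_monotone_norm_rpow_le (hS : ContinuousOn S (Icc 0 T))
    (P : ℕ → IntervalPartition 0 T) {p : ℕ} {q C D : ℝ} (hpq : (p : ℝ) < q) (hD : 0 ≤ D)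
    (hcard : ∀ n, ((P n).points.card : ℝ) ≤ C * ((2 : ℝ) ^ n) ^ p)
    (hosc : ∀ n, ∀ e ∈ (P n).intervals, ∀ r ∈ Icc e.1 e.2, ∀ s ∈ Icc e.1 e.2,
      ‖S r - S s‖ ≤ D * (2⁻¹ : ℝ) ^ n) :
    ∃ H : ℝ → ℝ, Continuous H ∧ Monotone H ∧ ∀ s t, 0 ≤ s → s ≤ t → t ≤ T →
      ‖S t - S s‖ ^ q ≤ H t - H s := by
  have hq0 : 0 < q := lt_of_le_of_lt (Nat.cast_nonneg p) hpq
  obtain ⟨R, hR⟩ := isCompact_Icc.exists_bound_of_continuousOn hS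
  set w : ℕ → ℝ := fun n => ((2⁻¹ : ℝ) ^ n) ^ q with hw
  have hw0 : ∀ n, 0 ≤ w n := fun n => by positivity
  -- Level `n` counts, with weight `2 ^ (-n q)`, the intervals of `P n` already traversed; the ramps
  -- make this count continuous. There are `O(2 ^ (n p))` intervals, so the sum over `n` is
  -- dominated by a geometric series of ratio `2 ^ (p - q) < 1`.
  set h : ℕ → ℝ → ℝ := fun n t => w n * ∑ e ∈ (P n).intervals, ramp e.1 e.2 t with hh
  have hh0 : ∀ n t, 0 ≤ h n t := fun n t =>
    mul_nonneg (hw0 n) (Finset.sum_nonneg fun _ _ => ramp_nonneg _ _ _)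
  have hle : ∀ n t, ‖h n t‖ ≤ C * ((2 : ℝ) ^ (p - q)) ^ n := by
    intro n t
    rw [Real.norm_of_nonneg (hh0 n t)]
    have h1 : ∑ e ∈ (P n).intervals, ramp e.1 e.2 t ≤ C * ((2 : ℝ) ^ n) ^ p := by
      refine (Finset.sum_le_card_nsmul _ _ 1 fun _ _ => ramp_le_one _ _ _).trans ?_
      rw [nsmul_eq_mul, mul_one]
      exact le_trans (by exact_mod_cast (P n).card_intervals_le) (hcard n)
    refine (mul_le_mul_of_nonneg_left h1 (hw0 n)).trans (le_of_eq ?_)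
    have h2 : w n * ((2 : ℝ) ^ n) ^ p = ((2 : ℝ) ^ (p - q)) ^ n := by
      rw [hw]
      simp only
      rw [← Real.rpow_natCast, ← Real.rpow_natCast, ← Real.rpow_natCast, ← Real.rpow_natCast,
        Real.inv_rpow zero_le_two, ← Real.rpow_neg zero_le_two, ← Real.rpow_mul zero_le_two,
        ← Real.rpow_mul zero_le_two, ← Real.rpow_mul zero_le_two, ← Real.rpow_add two_pos]
      congr 1
      ring
    rw [← h2]
    ring
  have hsum : Summable fun n => C * ((2 : ℝ) ^ (p - q)) ^ n := by
    refine (summable_geometric_of_lt_one (by positivity) ?_).mul_left C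
    exact Real.rpow_lt_one_of_one_lt_of_neg one_lt_two (by linarith)
  have hcont : ∀ n, Continuous (h n) := fun n =>
    continuous_const.mul (continuous_finsetSum _ fun e _ => continuous_ramp e.1 e.2)
  have hmono : ∀ n, Monotone (h n) := by
    intro n s t hst
    refine mul_le_mul_of_nonneg_left (Finset.sum_le_sum fun e he => ?_) (hw0 n)
    exact monotone_ramp ((P n).intervals_mem_Icc he).2.1 hst
  have hsumm : ∀ t, Summable fun n => h n t := fun t =>
    Summable.of_norm_bounded hsum fun n => hle n t
  set H : ℝ → ℝ := fun t => ∑' n, h n t with hH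
  have hHc : Continuous H := continuous_tsum hcont hsum fun n t => hle n t
  have hHm : Monotone H := fun s t hst =>
    (hsumm s).tsum_le_tsum (fun n => hmono n hst) (hsumm t)
  have hHh : ∀ m s t, s ≤ t → h m t - h m s ≤ H t - H s := by
    intro m s t hst
    rw [hH, ← (hsumm t).tsum_sub (hsumm s)]
    exact ((hsumm t).sub (hsumm s)).le_tsum m fun n _ => sub_nonneg.2 (hmono n hst)
  have hR0 : 0 ≤ 2 * |R| + 4 * D := by positivity
  refine ⟨fun t => (2 * |R| + 4 * D) ^ q * H t, continuous_const.mul hHc,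
    hHm.const_mul (by positivity), fun s t hs hst htT => ?_⟩
  rw [← mul_sub]
  rcases eq_or_ne (S t) (S s) with heq | hne
  · rw [heq, sub_self, norm_zero, Real.zero_rpow hq0.ne']
    exact mul_nonneg (by positivity) (sub_nonneg.2 (hHm hst))
  have hlt : s < t := lt_of_le_of_ne hst fun h => hne (by rw [h])
  have hpos : 0 < ‖S t - S s‖ := norm_pos_iff.2 (sub_ne_zero.2 hne)
  have hex : ∃ m : ℕ, 2 * (D * (2⁻¹ : ℝ) ^ m) < ‖S t - S s‖ := by
    have hlim : Tendsto (fun m : ℕ => 2 * (D * (2⁻¹ : ℝ) ^ m)) atTop (𝓝 (2 * (D * 0))) :=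
      ((tendsto_pow_atTop_nhds_zero_of_lt_one (by norm_num) (by norm_num)).const_mul D).const_mul 2
    rw [mul_zero, mul_zero] at hlim
    exact ((tendsto_order.1 hlim).2 _ hpos).exists
  classical
  -- `m` is the first level which resolves the increment. Failure at level `m - 1` bounds the
  -- increment by `4 * D * 2⁻ᵐ`, or by `2 * |R|` when `m = 0`; success at level `m` puts a whole
  -- interval of `P m` inside `[s, t]`, so `H` grows by at least `w m`.
  obtain ⟨m, hm⟩ : ∃ m, m = Nat.find hex := ⟨_, rfl⟩
  have hm1 : 2 * (D * (2⁻¹ : ℝ) ^ m) < ‖S t - S s‖ := hm ▸ Nat.find_spec hex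
  have hup : ‖S t - S s‖ ≤ (2 * |R| + 4 * D) * (2⁻¹ : ℝ) ^ m := by
    rcases m with _ | k
    · have h1 := norm_sub_le (S t) (S s)
      have h2 := hR t ⟨hs.trans hst, htT⟩
      have h3 := hR s ⟨hs, hst.trans htT⟩
      have h4 := le_abs_self R
      rw [pow_zero, mul_one]
      linarith
    · have h1 := not_lt.1 (Nat.find_min hex (m := k) (by omega))
      have h2 : (0 : ℝ) ≤ 2 * |R| * 2⁻¹ ^ (k + 1) := by positivity
      have h3 : (2⁻¹ : ℝ) ^ k = 2 * 2⁻¹ ^ (k + 1) := by rw [pow_succ]; ring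
      rw [h3] at h1
      linarith
  obtain ⟨e, he, hse, het⟩ := (P m).exists_intervals_of_lt_norm_sub (hosc m) hs hlt htT hm1
    (by positivity)
  have hwm : w m ≤ h m t - h m s := by
    have h1 : ∀ e' ∈ (P m).intervals, 0 ≤ ramp e'.1 e'.2 t - ramp e'.1 e'.2 s := fun e' he' =>
      sub_nonneg.2 (monotone_ramp ((P m).intervals_mem_Icc he').2.1 hst)
    have h2 := Finset.single_le_sum h1 he
    have h3 := ((P m).mem_intervals.1 he).2.2.1
    rw [ramp_of_ge h3 het, ramp_of_le h3.le hse, sub_zero, Finset.sum_sub_distrib] at h2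
    rw [hh]
    simp only
    rw [← mul_sub]
    exact le_mul_of_one_le_right (hw0 m) h2
  calc ‖S t - S s‖ ^ q ≤ ((2 * |R| + 4 * D) * (2⁻¹ : ℝ) ^ m) ^ q := by gcongr
    _ = (2 * |R| + 4 * D) ^ q * w m := Real.mul_rpow hR0 (by positivity)
    _ ≤ _ := mul_le_mul_of_nonneg_left (hwm.trans (hHh m s t hst)) (by positivity)

end PathwiseRough

namespace PathwiseRough

/-! ### Tensors -/

variable {d : ℕ}

theorem inner_tens {k : ℕ} (A B : Tens d k) : inner ℝ A B = ∑ i, A i * B i := by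
  simp only [PiLp.inner_apply, RCLike.inner_apply, conj_trivial, mul_comm]

theorem inner_euclidean (u v : EuclideanSpace ℝ (Fin d)) : inner ℝ u v = ∑ i, u i * v i := by
  simp only [PiLp.inner_apply, RCLike.inner_apply, conj_trivial, mul_comm]

theorem inner_tpow (u v : EuclideanSpace ℝ (Fin d)) (k : ℕ) :
    inner ℝ (tpow u k) (tpow v k) = inner ℝ u v ^ k := by
  rw [inner_tens, inner_euclidean]
  simp only [tpow, ← Finset.prod_mul_distrib]
  rw [← Fin.prod_const k, Finset.prod_univ_sum]
  simp

theorem norm_tpow (v : EuclideanSpace ℝ (Fin d)) (k : ℕ) : ‖tpow v k‖ = ‖v‖ ^ k := by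
  rw [← pow_left_inj₀ (norm_nonneg _) (by positivity) two_ne_zero, ← real_inner_self_eq_norm_sq,
    inner_tpow, real_inner_self_eq_norm_sq, ← pow_mul, ← pow_mul, mul_comm]

theorem tpow_zero_left {k : ℕ} (hk : k ≠ 0) : tpow (0 : EuclideanSpace ℝ (Fin d)) k = 0 := by
  rw [← norm_eq_zero, norm_tpow, norm_zero, zero_pow hk]

theorem isSymTens_tpow (v : EuclideanSpace ℝ (Fin d)) (k : ℕ) : IsSymTens (tpow v k) := by
  intro σ i
  exact Equiv.prod_comp σ fun j => v (i j)

theorem IsSymTens.sub {k : ℕ} {A B : Tens d k} (hA : IsSymTens A) (hB : IsSymTens B) :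
    IsSymTens (A - B) := fun σ i => by
  simp only [PiLp.sub_apply, hA σ i, hB σ i]

theorem IsSymTens.smul {k : ℕ} {A : Tens d k} (c : ℝ) (hA : IsSymTens A) :
    IsSymTens (c • A) := fun σ i => by
  simp only [PiLp.smul_apply, hA σ i]

theorem tsym_eq_self {k : ℕ} {A : Tens d k} (hA : IsSymTens A) : tsym A = A := by
  ext i
  have h : ∀ σ : Equiv.Perm (Fin k), A (fun j => i (σ j)) = A i := fun σ => hA σ i
  simp only [tsym, h, Finset.sum_const, Finset.card_univ, Fintype.card_perm, Fintype.card_fin,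
    nsmul_eq_mul]
  rw [← mul_assoc, inv_mul_cancel₀ (by positivity), one_mul]

theorem tsym_sub {k : ℕ} (A B : Tens d k) : tsym (A - B) = tsym A - tsym B := by
  ext i
  simp only [tsym, PiLp.sub_apply, Finset.sum_sub_distrib, mul_sub]

/-- Reindexing the sum moves a permutation from `A` to `Y`, where it has no effect. Thus Chen's
relation, which holds only after symmetrisation, can be paired with symmetric derivatives. -/
theorem inner_tsym {k : ℕ} {Y : Tens d k} (hY : IsSymTens Y) (A : Tens d k) :
    inner ℝ Y (tsym A) = inner ℝ Y A := by
  have h : ∀ σ : Equiv.Perm (Fin k), ∑ i, Y i * A (fun j => i (σ j)) = ∑ i, Y i * A i := by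
    intro σ
    rw [← Equiv.sum_comp (Equiv.arrowCongr σ (Equiv.refl (Fin d)))
      (fun i => Y i * A (fun j => i (σ j)))]
    refine Finset.sum_congr rfl fun i _ => ?_
    have h1 := hY σ.symm i
    simp only [Equiv.arrowCongr_apply, Equiv.coe_refl, Function.comp_def, id,
      Equiv.symm_apply_apply]
    change (Y fun j => i (σ.symm j)) * A (fun j => i j) = _
    rw [h1]
  rw [inner_tens, inner_tens]
  simp only [tsym, Finset.mul_sum]
  rw [Finset.sum_comm]
  simp only [mul_left_comm _ ((k.factorial : ℝ)⁻¹), ← Finset.mul_sum, h]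
  simp only [Finset.sum_const, Finset.card_univ, Fintype.card_perm, Fintype.card_fin,
    nsmul_eq_mul]
  rw [← mul_assoc, inv_mul_cancel₀ (by positivity), one_mul]

/-- Contraction with `A` is the adjoint of the tensor product by `A`; multi-indices of length `a +
b` are split by `Fin.append`. -/
theorem inner_contract {a b : ℕ} (A : Tens d a) (Y : Tens d (a + b)) (B : Tens d b) :
    inner ℝ (contract A Y) B = inner ℝ Y (tmul rfl A B) := by
  rw [inner_tens, inner_tens, ← (Fin.appendEquiv a b).sum_comp, Fintype.sum_prod_type,
    Finset.sum_comm]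
  simp only [contract, tmul, Finset.sum_mul]
  refine Finset.sum_congr rfl fun j _ => Finset.sum_congr rfl fun i _ => ?_
  simp [Fin.appendEquiv]
  ring

theorem tmul_sub_left {l m k : ℕ} (h : l + m = k) (A A' : Tens d l) (B : Tens d m) :
    tmul h (A - A') B = tmul h A B - tmul h A' B := by
  ext i
  simp only [tmul, PiLp.sub_apply, sub_mul]

theorem tmul_sub_right {l m k : ℕ} (h : l + m = k) (A : Tens d l) (B B' : Tens d m) :
    tmul h A (B - B') = tmul h A B - tmul h A B' := by
  ext i
  simp only [tmul, PiLp.sub_apply, mul_sub]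

theorem tmul_of_forall_eq_one_right {k : ℕ} (h : k + 0 = k) (A : Tens d k) {B : Tens d 0}
    (hB : ∀ i, B i = 1) : tmul h A B = A := by
  ext i
  simp only [tmul, hB, mul_one]
  rfl

theorem tmul_of_forall_eq_one_left {k : ℕ} (h : 0 + k = k) {A : Tens d 0} (B : Tens d k)
    (hA : ∀ i, A i = 1) : tmul h A B = B := by
  ext i
  simp only [tmul, hA, one_mul]
  refine congrArg B (funext fun j => congrArg i (Fin.ext ?_))
  simp

/-! ### The multinomial formula for symmetrised tensor products -/

/-- A bijection between subsets of a finite set extends to a permutation of the whole set. -/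
theorem exists_perm_mem_iff {k : ℕ} {A B : Finset (Fin k)} (h : A.card = B.card) :
    ∃ τ : Equiv.Perm (Fin k), ∀ j, τ j ∈ B ↔ j ∈ A := by
  classical
  have e : {x // x ∈ A} ≃ {x // x ∈ B} := Finset.equivOfCardEq h
  refine ⟨e.extendSubtype, fun j => ⟨fun hj => ?_, fun hj => e.extendSubtype_mem j hj⟩⟩
  by_contra hn
  exact e.extendSubtype_not_mem j hn hj

/-- The symmetrised products of `a` over a set of factors and of `b` over its complement only depend
on the number of factors. -/
theorem sum_perm_prod_ite_congr {k : ℕ} (a b : Fin k → ℝ) {A B : Finset (Fin k)}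
    (h : A.card = B.card) :
    ∑ σ : Equiv.Perm (Fin k), ∏ j, (if j ∈ A then a (σ j) else b (σ j)) =
      ∑ σ : Equiv.Perm (Fin k), ∏ j, (if j ∈ B then a (σ j) else b (σ j)) := by
  obtain ⟨τ, hτ⟩ := exists_perm_mem_iff h
  rw [← Equiv.sum_comp (Equiv.mulRight τ)]
  refine Finset.sum_congr rfl fun σ _ => ?_
  rw [← Equiv.prod_comp τ fun j => if j ∈ B then a (σ j) else b (σ j)]
  simp only [hτ, Equiv.coe_mulRight, Equiv.Perm.coe_mul, Function.comp_apply]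

/-- The multinomial formula for symmetric products. -/
theorem chen_tpow (a b : EuclideanSpace ℝ (Fin d)) (k : ℕ) :
    (k.factorial : ℝ)⁻¹ • tpow (a + b) k =
      ∑ x : Finset.HasAntidiagonal.antidiagonal k,
        tsym (tmul (Finset.HasAntidiagonal.mem_antidiagonal.1 x.2)
          ((x.1.1.factorial : ℝ)⁻¹ • tpow a x.1.1) ((x.1.2.factorial : ℝ)⁻¹ • tpow b x.1.2)) := by
  classical
  ext i
  -- `g B` is the symmetrised product with factors `a` at the positions in `B` and `b` elsewhere.
  -- The products on the right-hand side are the case of the first `l` positions.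
  let g : Finset (Fin k) → ℝ := fun A =>
    ∑ σ : Equiv.Perm (Fin k), ∏ j, (if j ∈ A then a (i (σ j)) else b (i (σ j)))
  let A : ℕ → Finset (Fin k) := fun l => Finset.univ.filter fun j => (j : ℕ) < l
  have hterm : ∀ x : Finset.HasAntidiagonal.antidiagonal k,
      tsym (tmul (Finset.HasAntidiagonal.mem_antidiagonal.1 x.2)
          ((x.1.1.factorial : ℝ)⁻¹ • tpow a x.1.1) ((x.1.2.factorial : ℝ)⁻¹ • tpow b x.1.2)) i =
        (k.factorial : ℝ)⁻¹ * ((x.1.1.factorial : ℝ)⁻¹ * (x.1.2.factorial : ℝ)⁻¹ *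
          g (A x.1.1)) := by
    rintro ⟨⟨l, m⟩, hx⟩
    have h : l + m = k := Finset.HasAntidiagonal.mem_antidiagonal.1 hx
    subst h
    simp only [tsym, tmul, tpow, PiLp.smul_apply, smul_eq_mul, g, Finset.mul_sum]
    refine Finset.sum_congr rfl fun σ _ => ?_
    have h1 : ∀ j : Fin l, Fin.castAdd m j ∈ A l := fun j => by simp [A]
    have h2 : ∀ j : Fin m, Fin.natAdd l j ∉ A l := fun j => by simp [A]
    rw [Fin.prod_univ_add]
    simp only [h1, h2, if_true, if_false, Fin.cast_eq_self]
    ring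
  have hcardA : ∀ l ≤ k, (A l).card = l := by
    intro l hl
    simp only [A]
    rw [Fin.card_filter_val_lt, min_eq_right hl]
  -- Expand the product over subsets `B`, once for each permutation of the factors. After summation
  -- over permutations all `B` with `l` elements contribute `g (A l)`, which produces the binomial
  -- coefficient.
  have hsum : (k.factorial : ℝ) * ∏ j, (a (i j) + b (i j)) =
      ∑ l ∈ Finset.range (k + 1), (k.choose l : ℝ) * g (A l) := by
    have h1 : ∀ σ : Equiv.Perm (Fin k), ∏ j, (a (i j) + b (i j)) =
        ∑ B ∈ (Finset.univ : Finset (Fin k)).powerset,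
          ∏ j, (if j ∈ B then a (i (σ j)) else b (i (σ j))) := by
      intro σ
      rw [← Equiv.prod_comp σ, Finset.prod_add]
      refine Finset.sum_congr rfl fun B _ => ?_
      rw [Finset.prod_ite]
      congr 1
      · congr 1; ext; simp
      · congr 1; ext; simp
    have h2 : (k.factorial : ℝ) * ∏ j, (a (i j) + b (i j)) =
        ∑ _σ : Equiv.Perm (Fin k), ∏ j, (a (i j) + b (i j)) := by
      simp [Finset.card_univ, Fintype.card_perm]
    rw [h2, Finset.sum_congr rfl fun σ _ => h1 σ, Finset.sum_comm, Finset.sum_powerset,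
      Finset.card_univ, Fintype.card_fin]
    refine Finset.sum_congr rfl fun l hl => ?_
    have hl' : l ≤ k := by rw [Finset.mem_range] at hl; omega
    rw [Finset.sum_congr rfl fun B hB => sum_perm_prod_ite_congr (fun j => a (i j))
      (fun j => b (i j)) ((Finset.mem_powersetCard.1 hB).2.trans (hcardA l hl').symm)]
    simp [g]
  have hR : (∑ x : Finset.HasAntidiagonal.antidiagonal k,
        tsym (tmul (Finset.HasAntidiagonal.mem_antidiagonal.1 x.2)
          ((x.1.1.factorial : ℝ)⁻¹ • tpow a x.1.1)
          ((x.1.2.factorial : ℝ)⁻¹ • tpow b x.1.2))) i =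
      ∑ x ∈ Finset.HasAntidiagonal.antidiagonal k, (k.factorial : ℝ)⁻¹ *
        ((x.1.factorial : ℝ)⁻¹ * (x.2.factorial : ℝ)⁻¹ * g (A x.1)) := by
    simp only [WithLp.ofLp_sum, Finset.sum_apply]
    refine (Finset.sum_congr rfl fun x _ => hterm x).trans ?_
    exact Finset.sum_coe_sort (Finset.HasAntidiagonal.antidiagonal k)
      (fun x => (k.factorial : ℝ)⁻¹ *
        ((x.1.factorial : ℝ)⁻¹ * (x.2.factorial : ℝ)⁻¹ * g (A x.1)))
  rw [hR, Finset.Nat.sum_antidiagonal_eq_sum_range_succ_mk]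
  have hk : (k.factorial : ℝ) ≠ 0 := by positivity
  simp only [tpow, PiLp.smul_apply, PiLp.add_apply, smul_eq_mul]
  rw [← Finset.mul_sum]
  congr 1
  rw [← mul_right_inj' hk, hsum, Finset.mul_sum]
  refine Finset.sum_congr rfl fun l hl => ?_
  have hl' : l ≤ k := by rw [Finset.mem_range] at hl; omega
  rw [Nat.cast_choose ℝ hl']
  field_simp

end PathwiseRough

namespace PathwiseRough

variable {d : ℕ}

/-! ### Controls -/

theorem isControl_sub {T : ℝ} {H : ℝ → ℝ} (hc : ContinuousOn H (Icc 0 T))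
    (hm : MonotoneOn H (Icc 0 T)) : IsControl T fun s t => H t - H s where
  cont := by
    refine ContinuousOn.sub (hc.comp continuousOn_snd ?_) (hc.comp continuousOn_fst ?_)
    · rintro ⟨s, t⟩ ⟨h1, h2, h3⟩
      exact ⟨h1.trans h2, h3⟩
    · rintro ⟨s, t⟩ ⟨h1, h2, h3⟩
      exact ⟨h1, h2.trans h3⟩
  nonneg := fun s t hs hst ht =>
    sub_nonneg.2 (hm ⟨hs, hst.trans ht⟩ ⟨hs.trans hst, ht⟩ hst)
  diag := fun t _ => sub_self _
  superadd := fun s u t _ _ _ _ => by linarith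

/-- Every control is dominated by an additive one. -/
theorem IsControl.exists_monotoneOn {T : ℝ} {c : ℝ → ℝ → ℝ} (hc : IsControl T c) :
    ∃ H : ℝ → ℝ, ContinuousOn H (Icc 0 T) ∧ MonotoneOn H (Icc 0 T) ∧
      ∀ s t, 0 ≤ s → s ≤ t → t ≤ T → c s t ≤ H t - H s := by
  -- Superadditivity at `0 ≤ s ≤ t` says exactly `c s t ≤ c 0 t - c 0 s`.
  refine ⟨c 0, ?_, ?_, ?_⟩
  · exact hc.cont.comp (f := fun t : ℝ => ((0 : ℝ), t)) (by fun_prop)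
      fun t ht => ⟨le_rfl, ht.1, ht.2⟩
  · intro s hs t ht hst
    have h1 := hc.superadd 0 s t le_rfl hs.1 hst ht.2
    have h2 := hc.nonneg s t hs.1 hst ht.2
    linarith
  · intro s t hs hst ht
    have h1 := hc.superadd 0 s t le_rfl hs hst ht
    linarith

/-! ### The reduced lift is a reduced rough path -/

variable {p : ℕ} {S : ℝ → EuclideanSpace ℝ (Fin d)} {V : ℝ → Tens d p}

/-- The increments of the variation path, seen as a `k`-tensor which vanishes for `k ≠ p`. -/
noncomputable def variationIncrement (V : ℝ → Tens d p) (k : ℕ) (s t : ℝ) : Tens d k :=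
  if h : k = p then
    (k.factorial : ℝ)⁻¹ • (WithLp.toLp 2 fun i => (V t - V s) (fun j => i (Fin.cast h.symm j)))
  else 0

theorem variationIncrement_self (V : ℝ → Tens d p) (s t : ℝ) :
    variationIncrement V p s t = (p.factorial : ℝ)⁻¹ • (V t - V s) := by
  rw [variationIncrement, dif_pos rfl]
  rfl

theorem variationIncrement_of_ne (V : ℝ → Tens d p) {k : ℕ} (h : k ≠ p) (s t : ℝ) :
    variationIncrement V k s t = 0 := dif_neg h

theorem variationIncrement_add (V : ℝ → Tens d p) (k : ℕ) (s u t : ℝ) :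
    variationIncrement V k s u + variationIncrement V k u t = variationIncrement V k s t := by
  by_cases h : k = p
  · subst h
    simp only [variationIncrement_self, ← smul_add]
    congr 1
    abel
  · simp only [variationIncrement_of_ne V h, add_zero]

theorem isSymTens_variationIncrement (hV : ∀ t, IsSymTens (V t)) (k : ℕ) (s t : ℝ) :
    IsSymTens (variationIncrement V k s t) := by
  by_cases h : k = p
  · subst h
    rw [variationIncrement_self]
    exact ((hV t).sub (hV s)).smul _
  · rw [variationIncrement_of_ne V h]
    intro σ i
    rfl

theorem reducedLift_eq (S : ℝ → EuclideanSpace ℝ (Fin d)) (V : ℝ → Tens d p) (k : ℕ) (s t : ℝ) :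
    reducedLift S V k s t =
      (k.factorial : ℝ)⁻¹ • tpow (S t - S s) k - variationIncrement V k s t := rfl

theorem reducedLift_of_ne (S : ℝ → EuclideanSpace ℝ (Fin d)) (V : ℝ → Tens d p) {k : ℕ}
    (h : k ≠ p) (s t : ℝ) :
    reducedLift S V k s t = (k.factorial : ℝ)⁻¹ • tpow (S t - S s) k := by
  rw [reducedLift_eq, variationIncrement_of_ne V h, sub_zero]

theorem inv_factorial_smul_tpow_zero (v : EuclideanSpace ℝ (Fin d)) (i : Fin 0 → Fin d) :
    ((Nat.factorial 0 : ℝ)⁻¹ • tpow v 0) i = 1 := by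
  simp [tpow]

theorem reducedLift_zero (hp0 : 0 < p) (s t : ℝ) (i : Fin 0 → Fin d) :
    reducedLift S V 0 s t i = 1 := by
  rw [reducedLift_of_ne S V hp0.ne, inv_factorial_smul_tpow_zero]

theorem isSymTens_reducedLift (hV : ∀ t, IsSymTens (V t)) (k : ℕ) (s t : ℝ) :
    IsSymTens (reducedLift S V k s t) :=
  ((isSymTens_tpow _ _).smul _).sub (isSymTens_variationIncrement hV k s t)

/-- Since `k ≤ p`, a factor of order `p` forces the other factor to have order `0`, hence to be `1`.
So the correction enters linearly, only through the two extreme products, and corrections are never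
multiplied together. -/
theorem tsym_tmul_reducedLift (hp0 : 0 < p) (hV : ∀ t, IsSymTens (V t)) {l m k : ℕ}
    (h : l + m = k) (hk : k ≤ p) (s u t : ℝ) :
    tsym (tmul h (reducedLift S V l s u) (reducedLift S V m u t)) =
      tsym (tmul h ((l.factorial : ℝ)⁻¹ • tpow (S u - S s) l)
        ((m.factorial : ℝ)⁻¹ • tpow (S t - S u) m)) -
      (if m = 0 then variationIncrement V k s u else 0) -
      (if l = 0 then variationIncrement V k u t else 0) := by
  by_cases hl : l = p
  · have hm : m = 0 := by omega
    subst hm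
    obtain rfl : l = k := by omega
    rw [reducedLift_of_ne S V hp0.ne, reducedLift_eq, tmul_sub_left, tsym_sub,
      tmul_of_forall_eq_one_right h (variationIncrement V l s u) (inv_factorial_smul_tpow_zero _),
      tsym_eq_self (isSymTens_variationIncrement hV _ _ _), if_pos rfl, if_neg (by omega),
      sub_zero]
  · rw [reducedLift_of_ne S V hl]
    by_cases hm : m = p
    · have hl0 : l = 0 := by omega
      subst hl0
      obtain rfl : m = k := by omega
      rw [reducedLift_eq, tmul_sub_right, tsym_sub,
        tmul_of_forall_eq_one_left h (variationIncrement V m u t) (inv_factorial_smul_tpow_zero _),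
        tsym_eq_self (isSymTens_variationIncrement hV _ _ _), if_pos rfl, if_neg (by omega),
        sub_zero]
    · have h1 : (if m = 0 then variationIncrement V k s u else 0) = 0 := by
        split_ifs with h0
        · exact variationIncrement_of_ne V (by omega) _ _
        · rfl
      have h2 : (if l = 0 then variationIncrement V k u t else 0) = 0 := by
        split_ifs with h0
        · exact variationIncrement_of_ne V (by omega) _ _
        · rfl
      rw [reducedLift_of_ne S V hm, h1, h2, sub_zero, sub_zero]

/-- Chen's relation for the reduced lift. -/
theorem chen_reducedLift (hp0 : 0 < p) (hV : ∀ t, IsSymTens (V t)) {k : ℕ} (hk : k ≤ p)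
    (s u t : ℝ) :
    reducedLift S V k s t = ∑ x : Finset.HasAntidiagonal.antidiagonal k,
      tsym (tmul (Finset.HasAntidiagonal.mem_antidiagonal.1 x.2)
        (reducedLift S V x.1.1 s u) (reducedLift S V x.1.2 u t)) := by
  rw [Finset.sum_congr rfl fun x _ => tsym_tmul_reducedLift hp0 hV
    (Finset.HasAntidiagonal.mem_antidiagonal.1 x.2) hk s u t, Finset.sum_sub_distrib,
    Finset.sum_sub_distrib, ← chen_tpow,
    Finset.sum_coe_sort (Finset.HasAntidiagonal.antidiagonal k)
      (fun x => if x.2 = 0 then variationIncrement V k s u else 0),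
    Finset.sum_coe_sort (Finset.HasAntidiagonal.antidiagonal k)
      (fun x => if x.1 = 0 then variationIncrement V k u t else 0),
    Finset.Nat.sum_antidiagonal_eq_sum_range_succ_mk,
    Finset.Nat.sum_antidiagonal_eq_sum_range_succ_mk, reducedLift_eq,
    ← variationIncrement_add V k s u t, sub_sub]
  congr 3
  · abel
  · rw [Finset.sum_eq_single k]
    · simp
    · intro l hl hlk
      rw [Finset.mem_range] at hl
      exact if_neg (by simp only; omega)
    · simp
  · rw [Finset.sum_eq_single 0]
    · simp
    · intro l _ hl0
      exact if_neg hl0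
    · simp

theorem add_rpow_le_two_rpow_mul {a b r : ℝ} (ha : 0 ≤ a) (hb : 0 ≤ b) (hr : 0 ≤ r) :
    (a + b) ^ r ≤ 2 ^ r * (a ^ r + b ^ r) := by
  have hm : 0 ≤ max a b := ha.trans (le_max_left _ _)
  calc (a + b) ^ r ≤ (2 * max a b) ^ r := by
        gcongr
        linarith [le_max_left a b, le_max_right a b]
    _ = 2 ^ r * max a b ^ r := Real.mul_rpow zero_le_two hm
    _ ≤ 2 ^ r * (a ^ r + b ^ r) := by
        gcongr
        have h1 : 0 ≤ a ^ r := by positivity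
        have h2 : 0 ≤ b ^ r := by positivity
        rcases max_choice a b with h | h <;> rw [h] <;> linarith

theorem norm_inv_factorial_smul_le {k l : ℕ} (A : Tens d l) :
    ‖(k.factorial : ℝ)⁻¹ • A‖ ≤ ‖A‖ := by
  rw [norm_smul, Real.norm_of_nonneg (by positivity)]
  refine mul_le_of_le_one_left (norm_nonneg _) (inv_le_one_of_one_le₀ ?_)
  exact_mod_cast Nat.one_le_iff_ne_zero.2 k.factorial_ne_zero

/-- The tensor power contributes `‖S t - S s‖ ^ q`. The correction is of order `h`, and `h ^ (q / p)
≤ M ^ (q / p - 1) * h` because `q > p` and `h ≤ M`. -/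
theorem norm_reducedLift_rpow_le {q h M : ℝ} (hp0 : 0 < p) (hpq : (p : ℝ) < q) {s t : ℝ}
    (hhM : h ≤ M) (hh : 0 ≤ h) (hS : ‖S t - S s‖ ^ q ≤ h) (hV : ‖V t - V s‖ ≤ h) {k : ℕ}
    (hk1 : 1 ≤ k) :
    ‖reducedLift S V k s t‖ ^ (q / k) ≤ 2 ^ (q / k) * (1 + M ^ (q / p - 1)) * h := by
  have hk0 : (0 : ℝ) < k := by exact_mod_cast hk1
  have hp0' : (0 : ℝ) < p := by exact_mod_cast hp0
  have hq0 : 0 < q := hp0'.trans hpq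
  have hM : 0 ≤ M := hh.trans hhM
  have hMr : 0 ≤ M ^ (q / p - 1) := by positivity
  have hr : 0 < q / k := by positivity
  have htp : ‖(k.factorial : ℝ)⁻¹ • tpow (S t - S s) k‖ ^ (q / k) ≤ h := by
    refine le_trans ?_ hS
    calc ‖(k.factorial : ℝ)⁻¹ • tpow (S t - S s) k‖ ^ (q / k) ≤ (‖S t - S s‖ ^ k) ^ (q / k) := by
          gcongr
          exact (norm_inv_factorial_smul_le _).trans (norm_tpow _ _).le
      _ = ‖S t - S s‖ ^ q := by
          rw [← Real.rpow_natCast, ← Real.rpow_mul (norm_nonneg _)]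
          congr 1
          field_simp
  have hvar : ‖variationIncrement V k s t‖ ^ (q / k) ≤ M ^ (q / p - 1) * h := by
    by_cases hkp : k = p
    · subst hkp
      rw [variationIncrement_self]
      calc ‖(k.factorial : ℝ)⁻¹ • (V t - V s)‖ ^ (q / k) ≤ h ^ (q / k) := by
            gcongr
            exact (norm_inv_factorial_smul_le _).trans hV
        _ ≤ M ^ (q / k - 1) * h := by
            rcases hh.eq_or_lt with h0 | h0
            · rw [← h0, Real.zero_rpow hr.ne', mul_zero]
            · have h1 : 0 ≤ q / k - 1 := by
                rw [sub_nonneg, le_div_iff₀ hk0]; linarith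
              calc h ^ (q / k) = h ^ (q / k - 1) * h := by
                    rw [Real.rpow_sub_one h0.ne']; field_simp
                _ ≤ _ := by gcongr
    · rw [variationIncrement_of_ne V hkp, norm_zero, Real.zero_rpow hr.ne']
      positivity
  rw [reducedLift_eq]
  calc
    _ ≤ (‖(k.factorial : ℝ)⁻¹ • tpow (S t - S s) k‖ + ‖variationIncrement V k s t‖) ^ (q / k) := by
        gcongr
        exact norm_sub_le _ _
    _ ≤ _ := add_rpow_le_two_rpow_mul (norm_nonneg _) (norm_nonneg _) hr.le
    _ ≤ 2 ^ (q / k) * (h + M ^ (q / p - 1) * h) := by gcongr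
    _ = _ := by ring

theorem isReducedRoughPath_reducedLift {q T : ℝ} (hp0 : 0 < p) (hpq : (p : ℝ) < q)
    (hq : ⌊q⌋₊ = p) (hV : ∀ t, IsSymTens (V t)) {H : ℝ → ℝ} (hHc : ContinuousOn H (Icc 0 T))
    (hHm : MonotoneOn H (Icc 0 T))
    (hSH : ∀ s t, 0 ≤ s → s ≤ t → t ≤ T → ‖S t - S s‖ ^ q ≤ H t - H s)
    (hVH : ∀ s t, 0 ≤ s → s ≤ t → t ≤ T → ‖V t - V s‖ ≤ H t - H s) :
    IsReducedRoughPath q T (reducedLift S V) where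
  zero := fun s t _ _ _ i => reducedLift_zero hp0 s t i
  symm := fun k _ s t _ _ _ => isSymTens_reducedLift hV k s t
  chen := fun k hk s u t _ _ _ _ => chen_reducedLift hp0 hV (hk.trans hq.le) s u t
  bound := by
    set M := H T - H 0 with hM
    set K := ∑ k ∈ Finset.Icc 1 ⌊q⌋₊, (2 : ℝ) ^ (q / k) * (1 + M ^ (q / p - 1)) with hK
    by_cases hT : 0 ≤ T
    · have hM0 : 0 ≤ M := sub_nonneg.2 (hHm ⟨le_rfl, hT⟩ ⟨hT, le_rfl⟩ hT)
      have hK0 : 0 ≤ K := Finset.sum_nonneg fun k _ => by positivity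
      refine ⟨fun s t => K * H t - K * H s, isControl_sub (continuousOn_const.mul hHc) ?_, ?_⟩
      · exact fun s hs t ht hst => mul_le_mul_of_nonneg_left (hHm hs ht hst) hK0
      · intro s t hs hst ht
        have hsm : s ∈ Icc 0 T := ⟨hs, hst.trans ht⟩
        have htm : t ∈ Icc 0 T := ⟨hs.trans hst, ht⟩
        simp only [← mul_sub]
        rw [hK, Finset.sum_mul]
        refine Finset.sum_le_sum fun k hk => ?_
        refine norm_reducedLift_rpow_le hp0 hpq ?_ (sub_nonneg.2 (hHm hsm htm hst))
          (hSH s t hs hst ht) (hVH s t hs hst ht) (Finset.mem_Icc.1 hk).1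
        have h1 := hHm htm ⟨hT, le_rfl⟩ ht
        have h2 := hHm ⟨le_rfl, hT⟩ hsm hs
        rw [hM]; linarith
    · exact ⟨fun s t => H t - H s, isControl_sub hHc hHm,
        fun s t hs hst ht => absurd (hs.trans (hst.trans ht)) hT⟩

/-! ### Compensated Riemann sums are almost additive -/

theorem inner_tsym_tmul {l m k : ℕ} (h : l + m = k) {Y : (k : ℕ) → Tens d k}
    (hY : IsSymTens (Y k)) (A : Tens d l) (B : Tens d m) :
    inner ℝ (Y k) (tsym (tmul h A B)) = inner ℝ (contract A (Y (l + m))) B := by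
  subst h
  rw [inner_tsym hY, inner_contract]

/-- Chen's relation splits `X k s t`. The terms with trivial second factor cancel the sum over `[s,
u]`; the others, regrouped by the order `l` of that factor, form the prediction at time `u` of `Y l`
from the data at `s`. Only the prediction errors remain. -/
theorem sum_inner_sub_sub {q T : ℝ} {X : (k : ℕ) → ℝ → ℝ → Tens d k} {Y : (k : ℕ) → ℝ → Tens d k}
    (hX : IsReducedRoughPath q T X) (hY : ∀ k ≤ ⌊q⌋₊, ∀ t ∈ Icc 0 T, IsSymTens (Y k t))
    {s u t : ℝ} (hs : 0 ≤ s) (hsu : s ≤ u) (hut : u ≤ t) (ht : t ≤ T) :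
    ∑ k ∈ Finset.Icc 1 ⌊q⌋₊, inner ℝ (Y k s) (X k s t) -
      ∑ k ∈ Finset.Icc 1 ⌊q⌋₊, inner ℝ (Y k s) (X k s u) -
      ∑ k ∈ Finset.Icc 1 ⌊q⌋₊, inner ℝ (Y k u) (X k u t) =
    -∑ l ∈ Finset.Icc 1 ⌊q⌋₊, inner ℝ (Y l u - ∑ m ∈ Finset.range (⌊q⌋₊ - l + 1),
      contract (X m s u) (Y (m + l) s)) (X l u t) := by
  set N := ⌊q⌋₊
  let g : ℕ → ℕ → ℝ := fun m l => inner ℝ (contract (X m s u) (Y (m + l) s)) (X l u t)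
  have hsT : s ∈ Icc 0 T := ⟨hs, hsu.trans (hut.trans ht)⟩
  have hmain : ∀ k ∈ Finset.Icc 1 N, inner ℝ (Y k s) (X k s t) =
      inner ℝ (Y k s) (X k s u) + ∑ l ∈ Finset.Icc 1 k, g (k - l) l := by
    intro k hk
    have hkN := (Finset.mem_Icc.1 hk).2
    have h0 : g k 0 = inner ℝ (Y k s) (X k s u) := by
      simp only [g]
      rw [inner_contract, tmul_of_forall_eq_one_right rfl (X k s u)
        (hX.zero u t (hs.trans hsu) hut ht)]
      rfl
    rw [hX.chen k hkN s u t hs hsu hut ht, inner_sum]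
    rw [Finset.sum_congr rfl fun x _ => inner_tsym_tmul (Y := fun k => Y k s)
      (Finset.HasAntidiagonal.mem_antidiagonal.1 x.2) (hY k hkN s hsT) _ _]
    rw [Finset.sum_coe_sort (Finset.HasAntidiagonal.antidiagonal k) (fun x => g x.1 x.2),
      ← Finset.Nat.sum_antidiagonal_swap, Finset.Nat.sum_antidiagonal_eq_sum_range_succ_mk,
      Finset.sum_range_succ']
    simp only [Prod.swap, Nat.sub_zero, h0]
    rw [add_comm, Finset.range_eq_Ico, Finset.sum_Ico_add' (fun l => g (k - l) l) 0 k 1]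
    rfl
  have hswap : ∑ k ∈ Finset.Icc 1 N, ∑ l ∈ Finset.Icc 1 k, g (k - l) l =
      ∑ l ∈ Finset.Icc 1 N, ∑ m ∈ Finset.range (N - l + 1), g m l := by
    rw [Finset.sum_comm' (s' := fun l => Finset.Icc l N) (t' := Finset.Icc 1 N) (by
      intro k l; simp only [Finset.mem_Icc]; omega)]
    refine Finset.sum_congr rfl fun l hl => ?_
    have hlN := (Finset.mem_Icc.1 hl).2
    have hI : Finset.Icc l N = Finset.Ico l (N + 1) := by
      ext; simp only [Finset.mem_Icc, Finset.mem_Ico]; omega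
    rw [hI, Finset.sum_Ico_eq_sum_range]
    have h1 : N + 1 - l = N - l + 1 := by omega
    rw [h1]
    refine Finset.sum_congr rfl fun m _ => ?_
    rw [Nat.add_sub_cancel_left]
  rw [Finset.sum_congr rfl hmain, Finset.sum_add_distrib, hswap]
  simp only [inner_sub_left, sum_inner, Finset.sum_sub_distrib, g]
  ring

theorem le_rpow_of_rpow_inv_le {x y r : ℝ} (hx : 0 ≤ x) (hr : 0 < r) (h : x ^ r⁻¹ ≤ y) :
    x ≤ y ^ r := by
  calc x = (x ^ r⁻¹) ^ r := by rw [← Real.rpow_mul hx, inv_mul_cancel₀ hr.ne', Real.rpow_one]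
    _ ≤ y ^ r := by gcongr

/-- The compensated Riemann sums of a controlled path are additive up to a power larger than one
of a control. -/
theorem exists_abs_sum_inner_sub_sub_le {q T : ℝ} (hq : 0 < q)
    {X : (k : ℕ) → ℝ → ℝ → Tens d k}
    {Y : (k : ℕ) → ℝ → Tens d k} (hX : IsReducedRoughPath q T X) (hY : IsControlled q T X Y) :
    ∃ H : ℝ → ℝ, ContinuousOn H (Icc 0 T) ∧ MonotoneOn H (Icc 0 T) ∧
      ∀ s u t, 0 ≤ s → s ≤ u → u ≤ t → t ≤ T →
        |∑ k ∈ Finset.Icc 1 ⌊q⌋₊, inner ℝ (Y k s) (X k s t) -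
          ∑ k ∈ Finset.Icc 1 ⌊q⌋₊, inner ℝ (Y k s) (X k s u) -
          ∑ k ∈ Finset.Icc 1 ⌊q⌋₊, inner ℝ (Y k u) (X k u t)| ≤
        ⌊q⌋₊ * (H t - H s) ^ ((⌊q⌋₊ + 1 : ℝ) / q) := by
  obtain ⟨c₁, hc₁, hb₁⟩ := hX.bound
  obtain ⟨c₂, hc₂, hb₂⟩ := hY.bound
  obtain ⟨H₁, hcont₁, hm₁, hH₁⟩ := hc₁.exists_monotoneOn
  obtain ⟨H₂, hcont₂, hm₂, hH₂⟩ := hc₂.exists_monotoneOn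
  refine ⟨fun t => H₁ t + H₂ t, hcont₁.add hcont₂, hm₁.add hm₂, ?_⟩
  intro s u t hs hsu hut ht
  rw [sum_inner_sub_sub hX hY.symm hs hsu hut ht, abs_neg]
  set N := ⌊q⌋₊
  set ω := H₁ t + H₂ t - (H₁ s + H₂ s) with hω
  have hsm : s ∈ Icc 0 T := ⟨hs, hsu.trans (hut.trans ht)⟩
  have hum : u ∈ Icc 0 T := ⟨hs.trans hsu, hut.trans ht⟩
  have htm : t ∈ Icc 0 T := ⟨hum.1.trans hut, ht⟩
  have h1su := hm₁ hsm hum hsu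
  have h1ut := hm₁ hum htm hut
  have h2su := hm₂ hsm hum hsu
  have h2ut := hm₂ hum htm hut
  have hω0 : 0 ≤ ω := by rw [hω]; linarith
  -- The exponents `(N - l + 1) / q` of the prediction error and `l / q` of `X l` add up to `(N + 1)
  -- / q` for every `l`.
  have hterm : ∀ l ∈ Finset.Icc 1 N, |inner ℝ (Y l u - ∑ m ∈ Finset.range (N - l + 1),
      contract (X m s u) (Y (m + l) s)) (X l u t)| ≤ ω ^ ((N + 1 : ℝ) / q) := by
    intro l hl
    obtain ⟨hl1, hlN⟩ := Finset.mem_Icc.1 hl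
    have hl1' : (1 : ℝ) ≤ l := by exact_mod_cast hl1
    have hlN' : (l : ℝ) ≤ N := by exact_mod_cast hlN
    have hX1 : ‖X l u t‖ ≤ ω ^ (l / q : ℝ) := by
      refine le_rpow_of_rpow_inv_le (norm_nonneg _) (by positivity) ?_
      rw [inv_div]
      have h := Finset.single_le_sum (f := fun k : ℕ => ‖X k u t‖ ^ (q / k : ℝ))
        (fun k _ => by positivity) hl
      have h3 := hb₁ u t hum.1 hut ht
      have h4 := hH₁ u t hum.1 hut ht
      rw [hω]
      linarith
    have hY1 : ‖Y l u - ∑ m ∈ Finset.range (N - l + 1), contract (X m s u) (Y (m + l) s)‖ ≤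
        ω ^ (((N : ℝ) - l + 1) / q) := by
      refine le_rpow_of_rpow_inv_le (norm_nonneg _) (by apply div_pos _ hq; linarith) ?_
      rw [inv_div]
      have h := Finset.single_le_sum (f := fun l : ℕ => ‖Y l u - ∑ m ∈ Finset.range (N - l + 1),
        contract (X m s u) (Y (m + l) s)‖ ^ (q / ((N : ℝ) - l + 1))) (fun k _ => by positivity) hl
      have h3 := hb₂ s u hs hsu hum.2
      have h4 := hH₂ s u hs hsu hum.2
      rw [hω]
      linarith
    refine (abs_real_inner_le_norm _ _).trans ((mul_le_mul hY1 hX1 (norm_nonneg _)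
      (by positivity)).trans (le_of_eq ?_))
    rw [← Real.rpow_add_of_nonneg hω0 (by apply div_nonneg _ hq.le; linarith) (by positivity)]
    congr 1
    ring
  refine (Finset.abs_sum_le_sum_abs _ _).trans ((Finset.sum_le_sum hterm).trans ?_)
  simp

end PathwiseRough

namespace PathwiseRough

/-! ### Symmetry of iterated derivatives -/

section Calculus

variable {E : Type*} [NormedAddCommGroup E] [NormedSpace ℝ E] {f : E → ℝ}

theorem differentiable_iteratedFDeriv_of_lt {N : ℕ} (hf : ContDiff ℝ N f) {n : ℕ} (h : n < N) :
    Differentiable ℝ (iteratedFDeriv ℝ n f) :=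
  (hf.iteratedFDeriv_right (m := 1) (i := n) (by exact_mod_cast (by omega : 1 + n ≤ N))).differentiable
    one_ne_zero

/-- The iterated derivatives of a real function of class `C^n` are symmetric. -/
theorem iteratedFDeriv_comp_perm_of_contDiff {n : ℕ} (hf : ContDiff ℝ n f) (x : E) (v : Fin n → E)
    (σ : Equiv.Perm (Fin n)) : iteratedFDeriv ℝ n f x (v ∘ σ) = iteratedFDeriv ℝ n f x v := by
  induction n generalizing x with
  | zero => simp
  | succ n ih =>
    have hfn : ContDiff ℝ n f := hf.of_le (by exact_mod_cast Nat.le_succ n)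
    -- Adjacent transpositions generate all permutations. The swap of the two outermost slots is the
    -- symmetry of a second derivative; any other adjacent swap acts on the inner slots and is
    -- handled by induction.
    have hσ : σ ∈ Submonoid.closure
        (range fun i : Fin n => Equiv.swap i.castSucc i.succ) := by
      rw [Equiv.Perm.mclosure_swap_castSucc_succ]
      trivial
    induction hσ using Submonoid.closure_induction generalizing v with
    | one => simp
    | mul σ τ _ _ h1 h2 =>
      have : v ∘ ⇑(σ * τ) = (v ∘ σ) ∘ τ := rfl
      rw [this, h2, h1]
    | mem σ hσ =>
      obtain ⟨i, rfl⟩ := hσ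
      rcases n with _ | n
      · exact i.elim0
      have hd : DifferentiableAt ℝ (iteratedFDeriv ℝ (n + 1) f) x :=
        differentiable_iteratedFDeriv_of_lt hf (Nat.lt_succ_self _) x
      refine Fin.cases ?_ (fun i => ?_) i
      · have hsymm : IsSymmSndFDerivAt ℝ (iteratedFDeriv ℝ n f) x := by
          refine ContDiffAt.isSymmSndFDerivAt (n := 2) (ContDiff.contDiffAt ?_) (by simp)
          exact hf.iteratedFDeriv_right (by exact_mod_cast (by omega : 2 + n ≤ n + 1 + 1))
        have hdd : DifferentiableAt ℝ (fderiv ℝ (iteratedFDeriv ℝ n f)) x :=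
          ((hf.iteratedFDeriv_right (m := 2) (i := n)
            (by exact_mod_cast (by omega : 2 + n ≤ n + 1 + 1))).fderiv_right (m := 1)
              (by norm_num [one_add_one_eq_two])).differentiable one_ne_zero x
        have h2 : ∀ w : Fin (n + 1 + 1) → E, iteratedFDeriv ℝ (n + 1 + 1) f x w =
            fderiv ℝ (fderiv ℝ (iteratedFDeriv ℝ n f)) x (w 0) (w 1) (Fin.tail (Fin.tail w)) := by
          intro w
          rw [hd.iteratedFDeriv_succ_apply_left']
          have h4 := (ContinuousMultilinearMap.apply ℝ (fun _ : Fin n => E) ℝ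
            (Fin.tail (Fin.tail w))).hasFDerivAt.comp x
              (hdd.hasFDerivAt.clm_apply (hasFDerivAt_const (w 1) x))
          refine (congrArg (fun L : E →L[ℝ] ℝ => L (w 0)) h4.fderiv).trans ?_
          simp
        rw [h2, h2]
        have h3 : Fin.tail (Fin.tail (v ∘ ⇑(Equiv.swap (Fin.castSucc (0 : Fin (n + 1)))
            (Fin.succ 0)))) = Fin.tail (Fin.tail v) := by
          funext j
          simp only [Fin.tail, Function.comp_apply]
          rw [Equiv.swap_apply_of_ne_of_ne]
          · exact Fin.succ_ne_zero _
          · intro h; exact Fin.succ_ne_zero _ (Fin.succ_injective _ h)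
        rw [h3]
        simp only [Function.comp_apply, Fin.castSucc_zero, Fin.succ_zero_eq_one,
          Equiv.swap_apply_left, Equiv.swap_apply_right]
        rw [hsymm.eq]
      · rw [hd.iteratedFDeriv_succ_apply_left', hd.iteratedFDeriv_succ_apply_left']
        have h0 : (v ∘ ⇑(Equiv.swap (Fin.castSucc i.succ) (Fin.succ i.succ))) 0 = v 0 := by
          simp only [Function.comp_apply]
          rw [Equiv.swap_apply_of_ne_of_ne]
          · rw [Fin.castSucc_succ]; exact (Fin.succ_ne_zero _).symm
          · exact (Fin.succ_ne_zero _).symm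
        have ht : Fin.tail (v ∘ ⇑(Equiv.swap (Fin.castSucc i.succ) (Fin.succ i.succ))) =
            Fin.tail v ∘ ⇑(Equiv.swap (Fin.castSucc i) (Fin.succ i)) := by
          funext j
          simp only [Fin.tail, Function.comp_apply]
          rw [Fin.castSucc_succ, ← (Fin.succ_injective _).map_swap]
        rw [h0, ht]
        congr 2
        funext y
        exact ih hfn y _ _

/-! ### Taylor's formula for the iterated derivatives -/

theorem iteratedFDeriv_apply_cast {n n' : ℕ} (h : n = n') (y : E) (z : Fin n' → E) :
    iteratedFDeriv ℝ n f y (z ∘ Fin.cast h) = iteratedFDeriv ℝ n' f y z := by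
  subst h
  rfl

/-- By the chain rule, differentiating along the line inserts one more `v` in the outermost slot;
the cast only identifies `m + 1 + l` with `m + l + 1`. -/
theorem hasDerivAt_iteratedFDeriv_append {N : ℕ} (hf : ContDiff ℝ N f) {m l : ℕ} (h : m + l < N)
    (x v : E) (w : Fin l → E) (θ : ℝ) :
    HasDerivAt (fun θ : ℝ => iteratedFDeriv ℝ (m + l) f (x + θ • v)
      (Fin.append (fun _ : Fin m => v) w))
      (iteratedFDeriv ℝ (m + 1 + l) f (x + θ • v) (Fin.append (fun _ : Fin (m + 1) => v) w)) θ := by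
  have hd := differentiable_iteratedFDeriv_of_lt hf h (x + θ • v)
  have h1 : Fin.append (fun _ : Fin (m + 1) => v) w =
      Fin.cons v (Fin.append (fun _ : Fin m => v) w) ∘ Fin.cast (Nat.add_right_comm m 1 l) := by
    rw [← Fin.append_cons]
    congr 1
    funext j
    refine Fin.cases rfl (fun _ => rfl) j
  rw [h1, iteratedFDeriv_apply_cast, iteratedFDeriv_succ_apply_left]
  have h2 : HasDerivAt (fun θ : ℝ => x + θ • v) v θ := by
    simpa using ((hasDerivAt_id θ).smul_const v).const_add x
  have h3 := hd.hasFDerivAt.comp_hasDerivAt θ h2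
  exact ((ContinuousMultilinearMap.apply ℝ (fun _ : Fin (m + l) => E) ℝ
    (Fin.append (fun _ : Fin m => v) w)).hasFDerivAt.comp_hasDerivAt θ h3)

/-- Taylor's formula with the Lagrange form of the remainder for the iterated derivatives. -/
theorem exists_taylor_iteratedFDeriv {n l : ℕ} (hf : ContDiff ℝ (n + l : ℕ) f) (x v : E)
    (w : Fin l → E) : ∃ θ ∈ Icc (0 : ℝ) 1,
      iteratedFDeriv ℝ l f (x + v) w = ∑ m ∈ Finset.range n, (m.factorial : ℝ)⁻¹ *
        iteratedFDeriv ℝ (m + l) f x (Fin.append (fun _ : Fin m => v) w) +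
      (n.factorial : ℝ)⁻¹ *
        iteratedFDeriv ℝ (n + l) f (x + θ • v) (Fin.append (fun _ : Fin n => v) w) := by
  -- `D m` is the `m`-th derivative of a scalar function on the segment, which reduces the claim to
  -- the one-dimensional formula. That formula has a remainder of order at least one, so `n = 0` is
  -- treated apart, with `θ = 1`.
  let D : ℕ → ℝ → ℝ := fun m θ =>
    iteratedFDeriv ℝ (m + l) f (x + θ • v) (Fin.append (fun _ : Fin m => v) w)
  have hD : ∀ m < n, ∀ θ, HasDerivAt (D m) (D (m + 1) θ) θ := fun m hm θ =>
    hasDerivAt_iteratedFDeriv_append hf (by omega) x v w θ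
  have happ : Fin.append (fun _ : Fin 0 => v) w = w ∘ Fin.cast (Nat.zero_add l) := by
    rw [show (fun _ : Fin 0 => v) = Fin.elim0 from funext fun i => i.elim0, Fin.elim0_append]
  have h0 : D 0 1 = iteratedFDeriv ℝ l f (x + v) w := by
    simp only [D, one_smul]
    rw [happ, iteratedFDeriv_apply_cast]
  have hiter : ∀ m ≤ n, iteratedDeriv m (D 0) = D m := by
    intro m
    induction m with
    | zero => intro _; exact iteratedDeriv_zero
    | succ m ih =>
      intro hm
      rw [iteratedDeriv_succ, ih (by omega)]
      funext θ
      exact (hD m hm θ).deriv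
  have hcont : ContDiff ℝ n (D 0) := by
    have h1 : ContDiff ℝ n (iteratedFDeriv ℝ (0 + l) f) :=
      hf.iteratedFDeriv_right (by exact_mod_cast (by omega : n + (0 + l) ≤ n + l))
    exact (ContinuousMultilinearMap.apply ℝ (fun _ : Fin (0 + l) => E) ℝ
      (Fin.append (fun _ : Fin 0 => v) w)).contDiff.comp (h1.comp (by fun_prop))
  rw [← h0]
  rcases n with _ | n
  · refine ⟨1, ⟨zero_le_one, le_rfl⟩, ?_⟩
    simp [D]
  · obtain ⟨θ, hθ, h⟩ := taylor_mean_remainder_lagrange_iteratedDeriv (f := D 0) (x := 1) (x₀ := 0)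
      (n := n) zero_ne_one (by exact_mod_cast hcont.contDiffOn)
    rw [uIoo_of_le zero_le_one] at hθ
    refine ⟨θ, ⟨hθ.1.le, hθ.2.le⟩, ?_⟩
    rw [taylor_within_apply, hiter (n + 1) le_rfl, sub_eq_iff_eq_add'] at h
    rw [h]
    congr 1
    · refine Finset.sum_congr rfl fun m hm => ?_
      have hmn : m ≤ n + 1 := by rw [Finset.mem_range] at hm; omega
      rw [iteratedDerivWithin_eq_iteratedDeriv (uniqueDiffOn_uIcc zero_ne_one)
        (hcont.of_le (by exact_mod_cast hmn)).contDiffAt left_mem_uIcc, hiter m hmn]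
      simp [D]
    · simp only [D, sub_zero, one_pow, mul_one]
      ring

end Calculus

/-! ### Derivatives as tensors -/

variable {d : ℕ} {f : EuclideanSpace ℝ (Fin d) → ℝ}

theorem isSymTens_nabla {k : ℕ} (hf : ContDiff ℝ k f) (x : EuclideanSpace ℝ (Fin d)) :
    IsSymTens (nabla k f x) := by
  intro σ i
  exact iteratedFDeriv_comp_perm_of_contDiff hf x
    (fun j => EuclideanSpace.single (i j) (1 : ℝ)) σ

theorem multilinear_apply_const {M : Type*} [AddCommGroup M] [Module ℝ M] {m : ℕ}
    (g : MultilinearMap ℝ (fun _ : Fin m => EuclideanSpace ℝ (Fin d)) M)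
    (v : EuclideanSpace ℝ (Fin d)) :
    g (fun _ => v) = ∑ i : Fin m → Fin d, (∏ j, v (i j)) •
      g (fun j => EuclideanSpace.single (i j) (1 : ℝ)) := by
  have hv : v = ∑ a : Fin d, v a • EuclideanSpace.single a (1 : ℝ) := by
    ext b
    simp [Finset.sum_apply, Pi.single_apply]
  conv_lhs => rw [hv]
  rw [MultilinearMap.map_sum]
  refine Finset.sum_congr rfl fun i _ => ?_
  rw [MultilinearMap.map_smul_univ]

theorem inner_nabla_tpow (k : ℕ) (x v : EuclideanSpace ℝ (Fin d)) :
    inner ℝ (nabla k f x) (tpow v k) = iteratedFDeriv ℝ k f x (fun _ => v) := by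
  rw [inner_tens]
  have h := multilinear_apply_const (iteratedFDeriv ℝ k f x).toMultilinearMap v
  simp only [ContinuousMultilinearMap.coe_coe] at h
  rw [h]
  exact Finset.sum_congr rfl fun i _ => mul_comm _ _

theorem append_eq_elim {α : Type*} {m l : ℕ} (z : Fin m → α) (w : Fin l → α) :
    Fin.append z w = Sum.elim z w ∘ finSumFinEquiv.symm := by
  funext j
  refine Fin.addCases (fun a => ?_) (fun a => ?_) j <;> simp

/-- Contraction with `v^{⊗ m}` fills the first `m` slots of the derivative with `v`: curry these
slots and expand `v` in the basis. -/
theorem contract_tpow_nabla (m l : ℕ) (x v : EuclideanSpace ℝ (Fin d)) (j : Fin l → Fin d) :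
    contract (tpow v m) (nabla (m + l) f x) j =
      iteratedFDeriv ℝ (m + l) f x
        (Fin.append (fun _ : Fin m => v) fun a => EuclideanSpace.single (j a) (1 : ℝ)) := by
  let g := ((iteratedFDeriv ℝ (m + l) f x).toMultilinearMap.domDomCongr
    finSumFinEquiv.symm).currySum
  have hg : ∀ (z : Fin m → EuclideanSpace ℝ (Fin d)) (w : Fin l → EuclideanSpace ℝ (Fin d)),
      g z w = iteratedFDeriv ℝ (m + l) f x (Fin.append z w) := by
    intro z w
    rw [append_eq_elim]
    rfl
  rw [← hg, multilinear_apply_const, _root_.sum_apply]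
  refine Finset.sum_congr rfl fun i _ => ?_
  have h : Fin.append (fun a => EuclideanSpace.single (i a) (1 : ℝ))
      (fun a => EuclideanSpace.single (j a) (1 : ℝ)) =
      fun b => EuclideanSpace.single (Fin.append i j b) (1 : ℝ) := by
    funext b
    refine Fin.addCases (fun a => ?_) (fun a => ?_) b <;> simp
  rw [_root_.smul_apply, hg, smul_eq_mul, h]
  rfl

/-- The Taylor remainder of `∇^l f` is controlled by the oscillation of the highest derivative. -/
theorem abs_nabla_sub_taylor_le {n l : ℕ} (hf : ContDiff ℝ (n + l : ℕ) f)
    (x v : EuclideanSpace ℝ (Fin d)) (j : Fin l → Fin d) {ε : ℝ}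
    (hε : ∀ θ ∈ Icc (0 : ℝ) 1,
      ‖iteratedFDeriv ℝ (n + l) f (x + θ • v) - iteratedFDeriv ℝ (n + l) f x‖ ≤ ε) :
    |nabla l f (x + v) j - ∑ m ∈ Finset.range (n + 1), (m.factorial : ℝ)⁻¹ *
      contract (tpow v m) (nabla (m + l) f x) j| ≤ ε * ‖v‖ ^ n := by
  obtain ⟨θ, hθ, h⟩ := exists_taylor_iteratedFDeriv hf x v
    fun a => EuclideanSpace.single (j a) (1 : ℝ)
  simp only [contract_tpow_nabla]
  have h1 : nabla l f (x + v) j = iteratedFDeriv ℝ l f (x + v)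
    fun a => EuclideanSpace.single (j a) (1 : ℝ) := rfl
  -- The last Taylor term is subtracted from the Lagrange remainder, leaving the difference of the
  -- top derivative at two points. No derivative of order `n + l + 1` is needed.
  rw [h1, h, Finset.sum_range_succ, add_sub_add_left_eq_sub, ← mul_sub,
    ← _root_.sub_apply, abs_mul, abs_of_nonneg (by positivity)]
  have h2 : ((n.factorial : ℝ))⁻¹ ≤ 1 := by
    refine inv_le_one_of_one_le₀ ?_
    exact_mod_cast Nat.one_le_iff_ne_zero.2 n.factorial_ne_zero
  refine (mul_le_of_le_one_left (abs_nonneg _) h2).trans ?_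
  refine (ContinuousMultilinearMap.le_opNorm
    (iteratedFDeriv ℝ (n + l) f (x + θ • v) - iteratedFDeriv ℝ (n + l) f x) _).trans ?_
  have h3 : ∏ i : Fin (n + l), ‖Fin.append (fun _ : Fin n => v)
      (fun a => EuclideanSpace.single (j a) (1 : ℝ)) i‖ = ‖v‖ ^ n := by
    rw [Fin.prod_univ_add]
    simp
  rw [h3]
  exact mul_le_mul_of_nonneg_right (hε θ hθ) (by positivity)

end PathwiseRough

namespace PathwiseRough

/-! ### Atomless vector measures on an interval -/

section Measure

theorem enorm_le_sum_enorm {ι : Type*} [Fintype ι] (v : EuclideanSpace ℝ ι) :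
    ‖v‖ₑ ≤ ∑ i, ‖v i‖ₑ := by
  classical
  have hv : v = ∑ a : ι, v a • EuclideanSpace.single a (1 : ℝ) := by
    ext b
    simp [Finset.sum_apply, Pi.single_apply]
  conv_lhs => rw [hv]
  refine (enorm_sum_le _ _).trans (Finset.sum_le_sum fun i _ => ?_)
  rw [enorm_smul]
  simp [← ofReal_norm]

/-- A vector measure with values in a finite dimensional Euclidean space has finite variation. -/
theorem isFiniteMeasure_variation {X ι : Type*} [MeasurableSpace X] [Fintype ι]
    (μ : VectorMeasure X (EuclideanSpace ℝ ι)) : IsFiniteMeasure μ.variation := by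
  -- The coordinates are signed measures, of finite total variation by the Jordan decomposition, and
  -- the sum of their variations dominates that of `μ`.
  let s : ι → SignedMeasure X := fun i =>
    μ.mapRange (EuclideanSpace.proj (𝕜 := ℝ) i : EuclideanSpace ℝ ι →L[ℝ] ℝ).toAddMonoidHom
      (EuclideanSpace.proj (𝕜 := ℝ) i : EuclideanSpace ℝ ι →L[ℝ] ℝ).continuous
  have hfin : IsFiniteMeasure (∑ i, (s i).variation) := by
    refine ⟨?_⟩
    rw [Measure.coe_finsetSum, Finset.sum_apply]
    refine ENNReal.sum_lt_top.2 fun i _ => ?_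
    rw [← SignedMeasure.totalVariation_eq_variation]
    exact measure_lt_top _ _
  refine isFiniteMeasure_of_le (∑ i, (s i).variation)
    (VectorMeasure.variation_le_of_forall_enorm_le fun A _ => ?_)
  rw [Measure.coe_finsetSum, Finset.sum_apply]
  exact (enorm_le_sum_enorm _).trans (Finset.sum_le_sum fun i _ =>
    VectorMeasure.enorm_measure_le_variation (s i) A)

variable {T : ℝ} {F : Type*} [NormedAddCommGroup F]

theorem measurableSet_val_le (t : ℝ) : MeasurableSet {x : Icc (0 : ℝ) T | (x : ℝ) ≤ t} :=
  measurableSet_le measurable_subtype_coe measurable_const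

theorem measurableSet_val_Ioc (s t : ℝ) :
    MeasurableSet {x : Icc (0 : ℝ) T | s < (x : ℝ) ∧ (x : ℝ) ≤ t} :=
  (measurableSet_lt measurable_const measurable_subtype_coe).inter (measurableSet_val_le t)

theorem variation_singleton_eq_zero {μ : VectorMeasure (Icc (0 : ℝ) T) F} (h : ∀ x, μ {x} = 0)
    (x : Icc (0 : ℝ) T) : μ.variation {x} = 0 := by
  rw [VectorMeasure.variation_apply_eq_zero (measurableSet_singleton x)]
  intro t ht _
  rcases subset_singleton_iff_eq.1 ht with rfl | rfl
  · exact μ.empty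
  · exact h x

theorem setOf_le_eq_union {s t : ℝ} (hst : s ≤ t) :
    ({x | (x : ℝ) ≤ t} : Set (Icc (0 : ℝ) T)) =
      ({x | (x : ℝ) ≤ s} : Set (Icc (0 : ℝ) T)) ∪ {x | s < (x : ℝ) ∧ (x : ℝ) ≤ t} := by
  ext x
  simp only [mem_ofPred_eq, mem_union]
  constructor
  · intro h
    rcases le_or_gt (x : ℝ) s with h' | h'
    · exact Or.inl h'
    · exact Or.inr ⟨h', h⟩
  · rintro (h | h)
    · exact h.trans hst
    · exact h.2

theorem disjoint_setOf_le (s t : ℝ) : Disjoint {x : Icc (0 : ℝ) T | (x : ℝ) ≤ s}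
    {x | s < (x : ℝ) ∧ (x : ℝ) ≤ t} :=
  Set.disjoint_left.2 fun _ h1 h2 => absurd h2.1 (not_lt.2 h1)

theorem vectorMeasure_le_sub_le (μ : VectorMeasure (Icc (0 : ℝ) T) F) {s t : ℝ} (hst : s ≤ t) :
    μ {x | (x : ℝ) ≤ t} - μ {x | (x : ℝ) ≤ s} = μ {x | s < (x : ℝ) ∧ (x : ℝ) ≤ t} := by
  rw [setOf_le_eq_union hst, VectorMeasure.of_union (disjoint_setOf_le s t)
    (measurableSet_val_le s) (measurableSet_val_Ioc s t), add_sub_cancel_left]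

theorem measureReal_le_sub_le (ν : Measure (Icc (0 : ℝ) T)) [IsFiniteMeasure ν] {s t : ℝ}
    (hst : s ≤ t) : ν.real {x | (x : ℝ) ≤ t} - ν.real {x | (x : ℝ) ≤ s} =
      ν.real {x | s < (x : ℝ) ∧ (x : ℝ) ≤ t} := by
  rw [setOf_le_eq_union hst, measureReal_union (disjoint_setOf_le s t)
    (measurableSet_val_Ioc s t), add_sub_cancel_left]

/-- The distribution function of an atomless finite measure is continuous. -/
theorem continuousOn_measureReal_le (ν : Measure (Icc (0 : ℝ) T)) [IsFiniteMeasure ν]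
    (hν : ∀ x, ν {x} = 0) :
    ContinuousOn (fun t : ℝ => ν.real {x | (x : ℝ) ≤ t}) (Icc 0 T) := by
  -- Pushed forward to `ℝ`, the distribution function becomes, up to a constant, the primitive of
  -- `1` against an atomless measure.
  let ν' : Measure ℝ := ν.map Subtype.val
  have hfin : IsFiniteMeasure ν' := Measure.isFiniteMeasure_map ν _
  have hna : NullSingletonClass ν' := by
    refine ⟨fun y => ?_⟩
    rw [Measure.map_apply measurable_subtype_coe (measurableSet_singleton y)]
    by_cases hy : y ∈ Icc 0 T
    · convert hν ⟨y, hy⟩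
      ext x
      simp [Subtype.ext_iff]
    · convert measure_empty (μ := ν)
      ext x
      simp only [mem_preimage, mem_singleton_iff, mem_empty_iff_false, iff_false]
      rintro rfl
      exact hy x.2
  have hc : Continuous fun t : ℝ => ∫ _x in (0 : ℝ)..t, (1 : ℝ) ∂ν' :=
    intervalIntegral.continuous_primitive (fun a b => intervalIntegrable_const) 0
  refine (hc.add (continuous_const (y := ν.real {x | (x : ℝ) ≤ 0}))).continuousOn.congr
    fun t ht => ?_
  have h1 : ∫ _x in (0 : ℝ)..t, (1 : ℝ) ∂ν' = ν.real {x | (0 : ℝ) < (x : ℝ) ∧ (x : ℝ) ≤ t} := by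
    rw [intervalIntegral.integral_of_le ht.1, setIntegral_const, smul_eq_mul, mul_one,
      measureReal_def, Measure.map_apply measurable_subtype_coe measurableSet_Ioc]
    rfl
  change ν.real {x | (x : ℝ) ≤ t} =
    (∫ _x in (0 : ℝ)..t, (1 : ℝ) ∂ν') + ν.real {x | (x : ℝ) ≤ 0}
  rw [h1, ← measureReal_le_sub_le ν ht.1]
  ring

end Measure

/-! ### Integration of continuous tensor fields against the limiting measure -/

variable {d p : ℕ} {T : ℝ}

/-- The integral of a continuous tensor valued function over `[0, t]`. -/
noncomputable def tensorIntegral (μ : VectorMeasure (Icc (0 : ℝ) T) (Tens d p))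
    (φ : ℝ → Tens d p) (t : ℝ) : ℝ :=
  μ.integral ({x : Icc (0 : ℝ) T | (x : ℝ) ≤ t}.indicator fun x => φ x) (innerSL ℝ)

theorem integrable_of_continuousOn (μ : VectorMeasure (Icc (0 : ℝ) T) (Tens d p))
    {φ : ℝ → Tens d p} (hφ : ContinuousOn φ (Icc 0 T)) :
    μ.Integrable (fun x : Icc (0 : ℝ) T => φ x) := by
  have := isFiniteMeasure_variation μ
  have hc : Continuous fun x : Icc (0 : ℝ) T => φ x := hφ.comp_continuous continuous_subtype_val
    fun x => x.2
  obtain ⟨C, hC⟩ := isCompact_Icc.exists_bound_of_continuousOn hφ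
  exact Integrable.of_bound hc.aestronglyMeasurable C (Eventually.of_forall fun x => hC x x.2)

theorem norm_integral_le_integral_norm_inner (μ : VectorMeasure (Icc (0 : ℝ) T) (Tens d p))
    (g : Icc (0 : ℝ) T → Tens d p) :
    |μ.integral g (innerSL ℝ)| ≤ ∫ x, ‖g x‖ ∂μ.variation :=
  VectorMeasure.norm_integral_le_integral_norm.trans
    (mul_le_of_le_one_left (integral_nonneg fun _ => norm_nonneg _) (norm_innerSL_le ℝ))

/-- The left-hand side is the integral of `φ - φ s` over `(s, t]`, at most the oscillation of `φ`
times the variation of `μ` there. -/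
theorem abs_tensorIntegral_sub_sub_le (μ : VectorMeasure (Icc (0 : ℝ) T) (Tens d p))
    {φ : ℝ → Tens d p} (hφ : ContinuousOn φ (Icc 0 T)) {s t η : ℝ} (hst : s ≤ t)
    (hη : ∀ r ∈ Icc s t, r ∈ Icc 0 T → ‖φ r - φ s‖ ≤ η) :
    |tensorIntegral μ φ t - tensorIntegral μ φ s -
      inner ℝ (φ s) (pthVariation μ t - pthVariation μ s)| ≤
      η * (μ.variation.real {x | (x : ℝ) ≤ t} - μ.variation.real {x | (x : ℝ) ≤ s}) := by
  have := isFiniteMeasure_variation μ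
  have hint := integrable_of_continuousOn μ hφ
  have hint' : ∀ A, MeasurableSet A →
      μ.Integrable (A.indicator fun x : Icc (0 : ℝ) T => φ x) := fun A hA => hint.indicator hA
  set A : Set (Icc (0 : ℝ) T) := {x | s < (x : ℝ) ∧ (x : ℝ) ≤ t} with hA
  have hAm : MeasurableSet A := measurableSet_val_Ioc s t
  have hc : inner ℝ (φ s) (pthVariation μ t - pthVariation μ s) =
      μ.integral (A.indicator fun _ => φ s) (innerSL ℝ) := by
    rw [VectorMeasure.integral_indicator_const _ hAm, pthVariation, pthVariation,
      vectorMeasure_le_sub_le μ hst]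
    rfl
  have hcint : μ.Integrable (A.indicator fun _ : Icc (0 : ℝ) T => φ s) :=
    (integrable_const (φ s)).indicator hAm
  rw [hc, tensorIntegral, tensorIntegral, ← VectorMeasure.integral_sub
    (hint' _ (measurableSet_val_le t)) (hint' _ (measurableSet_val_le s)),
    ← VectorMeasure.integral_sub ((hint' _ (measurableSet_val_le t)).sub
      (hint' _ (measurableSet_val_le s))) hcint]
  have heq : ({x : Icc (0 : ℝ) T | (x : ℝ) ≤ t}.indicator fun x => φ x) -
      ({x : Icc (0 : ℝ) T | (x : ℝ) ≤ s}.indicator fun x => φ x) - (A.indicator fun _ => φ s) =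
      A.indicator fun x => φ x - φ s := by
    funext x
    simp only [Pi.sub_apply, indicator_apply, mem_ofPred_eq, hA]
    rcases le_or_gt (x : ℝ) s with h1 | h1
    · rw [if_pos (h1.trans hst), if_pos h1, if_neg (fun h => absurd h.1 (not_lt.2 h1)),
        if_neg (fun h => absurd h.1 (not_lt.2 h1))]
      simp
    · by_cases h2 : (x : ℝ) ≤ t
      · simp [h1, h2, not_le.2 h1]
      · simp [h1, h2, not_le.2 h1]
  rw [heq]
  refine (norm_integral_le_integral_norm_inner μ _).trans ?_
  rw [measureReal_le_sub_le _ hst, mul_comm]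
  calc ∫ x, ‖A.indicator (fun x : Icc (0 : ℝ) T => φ x - φ s) x‖ ∂μ.variation
      ≤ ∫ x, A.indicator (fun _ => η) x ∂μ.variation := by
        refine integral_mono_of_nonneg (Eventually.of_forall fun _ => norm_nonneg _)
          ((integrable_const η).indicator hAm) (Eventually.of_forall fun x => ?_)
        simp only [norm_indicator_eq_indicator_norm]
        by_cases hx : x ∈ A
        · simp only [indicator_of_mem hx]
          exact hη x ⟨hx.1.le, hx.2⟩ x.2
        · simp only [indicator_of_notMem hx, le_refl]
    _ = μ.variation.real A * η := by
        rw [integral_indicator_const _ hAm, smul_eq_mul]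

/-! ### Convergence of the `p`-th power sums stopped at a fixed time -/

/-- The tensor whose pairing with `v^{⊗ p}` is `∑ᵢ vᵢ^p`. -/
noncomputable def diagTens (d p : ℕ) : Tens d p :=
  ∑ a : Fin d, tpow (EuclideanSpace.single a (1 : ℝ)) p

theorem inner_diagTens (v : EuclideanSpace ℝ (Fin d)) :
    inner ℝ (diagTens d p) (tpow v p) = ∑ a, v a ^ p := by
  simp only [diagTens, sum_inner, inner_tpow, EuclideanSpace.inner_single_left, map_one, one_mul]

/-- For even `p` all the terms `v a ^ p` are nonnegative, so their sum dominates the largest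
coordinate and hence the norm. -/
theorem norm_pow_le_inner_diagTens (hp : Even p) (hp0 : 0 < p) (v : EuclideanSpace ℝ (Fin d)) :
    ‖v‖ ^ p ≤ d ^ p * inner ℝ (diagTens d p) (tpow v p) := by
  rw [inner_diagTens]
  have hnn : ∀ a ∈ Finset.univ, 0 ≤ v a ^ p := fun a _ => hp.pow_nonneg _
  have hp' : (p : ℝ) ≠ 0 := by exact_mod_cast hp0.ne'
  have hs : 0 ≤ ∑ a, v a ^ p := Finset.sum_nonneg hnn
  have h : ‖v‖ ≤ Fintype.card (Fin d) * (∑ a, v a ^ p) ^ (p : ℝ)⁻¹ := by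
    refine euclidean_norm_le_card_mul (by positivity) fun a => ?_
    rw [Real.le_rpow_inv_iff_of_pos (abs_nonneg _) hs (by positivity), Real.rpow_natCast,
      hp.pow_abs]
    exact Finset.single_le_sum hnn (Finset.mem_univ a)
  rw [Fintype.card_fin] at h
  refine (pow_le_pow_left₀ (norm_nonneg _) h p).trans (le_of_eq ?_)
  rw [mul_pow, ← Real.rpow_natCast (_ ^ _) p, ← Real.rpow_mul hs, inv_mul_cancel₀ hp',
    Real.rpow_one]

theorem tendsto_ramp_of_lt {t r : ℝ} (h : t < r) {ε : ℕ → ℝ} (hε : Tendsto ε atTop (𝓝 0))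
    (hε0 : ∀ m, 0 < ε m) : ∀ᶠ m in atTop, ramp t (t + ε m) r = 1 := by
  filter_upwards [(tendsto_order.1 hε).2 (r - t) (sub_pos.2 h)] with m hm
  exact ramp_of_ge (by linarith [hε0 m]) (by linarith)

theorem tendsto_ramp_of_gt {t r : ℝ} (h : r < t) {ε : ℕ → ℝ} (hε : Tendsto ε atTop (𝓝 0))
    (hε0 : ∀ m, 0 < ε m) : ∀ᶠ m in atTop, ramp (t - ε m) t r = 0 := by
  filter_upwards [(tendsto_order.1 hε).2 (t - r) (sub_pos.2 h)] with m hm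
  exact ramp_of_le (by linarith [hε0 m]) (by linarith)

/-- Dominated convergence: the continuous cutoffs converge pointwise to the indicator of `[0, t]`.
-/
theorem tendsto_integral_cutoff (μ : VectorMeasure (Icc (0 : ℝ) T) (Tens d p))
    {φ : ℝ → Tens d p} (hφ : ContinuousOn φ (Icc 0 T)) (t : ℝ) {ε : ℕ → ℝ}
    (hε : Tendsto ε atTop (𝓝 0)) (hε0 : ∀ m, 0 < ε m) :
    Tendsto (fun m => μ.integral (fun x : Icc (0 : ℝ) T => (1 - ramp t (t + ε m) x) • φ x)
      (innerSL ℝ)) atTop (𝓝 (tensorIntegral μ φ t)) := by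
  have := isFiniteMeasure_variation μ
  obtain ⟨C, hC⟩ := isCompact_Icc.exists_bound_of_continuousOn hφ
  have hc : Continuous fun x : Icc (0 : ℝ) T => φ x := hφ.comp_continuous continuous_subtype_val
    fun x => x.2
  refine VectorMeasure.tendsto_integral_filter_of_norm_le_const
    (Eventually.of_forall fun m => ?_) ⟨C, Eventually.of_forall fun m =>
      Eventually.of_forall fun x => ?_⟩ (Eventually.of_forall fun x => ?_)
  · exact ((continuous_const.sub ((continuous_ramp _ _).comp continuous_subtype_val)).smul
      hc).aestronglyMeasurable
  · rw [norm_smul, Real.norm_of_nonneg (sub_nonneg.2 (ramp_le_one _ _ _))]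
    exact (mul_le_of_le_one_left (norm_nonneg _)
      (by linarith [ramp_nonneg t (t + ε m) x])).trans (hC x x.2)
  · rcases le_or_gt (x : ℝ) t with h | h
    · have h1 : ∀ m, ramp t (t + ε m) x = 0 := fun m => ramp_of_le (by linarith [hε0 m]) h
      simp [h1, h]
    · refine tendsto_const_nhds.congr' ?_
      filter_upwards [tendsto_ramp_of_lt h hε hε0] with m hm
      simp [hm, not_le.2 h]

/-- The bumps shrink to the single point `t`, which carries no mass because `μ` has no atoms. -/
theorem tendsto_integral_bump {μ : VectorMeasure (Icc (0 : ℝ) T) (Tens d p)}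
    (hμ : ∀ x, μ {x} = 0) (D : Tens d p) (t : ℝ) {ε : ℕ → ℝ}
    (hε : Tendsto ε atTop (𝓝 0)) (hε0 : ∀ m, 0 < ε m) :
    Tendsto (fun m => μ.integral (fun x : Icc (0 : ℝ) T =>
      (ramp (t - ε m) t x - ramp t (t + ε m) x) • D) (innerSL ℝ)) atTop (𝓝 0) := by
  have := isFiniteMeasure_variation μ
  have hne : ∀ᵐ x : Icc (0 : ℝ) T ∂μ.variation, (x : ℝ) ≠ t := by
    by_cases ht : t ∈ Icc 0 T
    · refine measure_mono_null ?_ (variation_singleton_eq_zero hμ ⟨t, ht⟩)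
      intro x hx
      simpa [Subtype.ext_iff] using hx
    · refine Eventually.of_forall fun x hx => ht (hx ▸ x.2)
  have h0 : μ.integral (fun _ : Icc (0 : ℝ) T => (0 : Tens d p)) (innerSL ℝ) = 0 :=
    VectorMeasure.integral_zero
  suffices h : Tendsto (fun m => μ.integral (fun x : Icc (0 : ℝ) T =>
      (ramp (t - ε m) t x - ramp t (t + ε m) x) • D) (innerSL ℝ)) atTop
      (𝓝 (μ.integral (fun _ : Icc (0 : ℝ) T => (0 : Tens d p)) (innerSL ℝ))) from
    h.trans_eq (congrArg 𝓝 h0)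
  refine VectorMeasure.tendsto_integral_filter_of_norm_le_const
    (Eventually.of_forall fun m => ?_) ⟨‖D‖, Eventually.of_forall fun m =>
      Eventually.of_forall fun x => ?_⟩ (hne.mono fun x hx => ?_)
  · exact ((((continuous_ramp _ _).comp continuous_subtype_val).sub
      ((continuous_ramp _ _).comp continuous_subtype_val)).smul
      continuous_const).aestronglyMeasurable
  · rw [norm_smul]
    refine mul_le_of_le_one_left (norm_nonneg _) ?_
    rw [Real.norm_eq_abs, abs_le]
    constructor <;> linarith [ramp_nonneg t (t + ε m) x, ramp_nonneg (t - ε m) t x,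
      ramp_le_one t (t + ε m) x, ramp_le_one (t - ε m) t x]
  · refine tendsto_const_nhds.congr' ?_
    rcases lt_or_gt_of_ne hx with h | h
    · filter_upwards [tendsto_ramp_of_gt h hε hε0] with m hm
      rw [hm, ramp_of_le (by linarith [hε0 m]) h.le, sub_zero, zero_smul]
    · filter_upwards [tendsto_ramp_of_lt h hε hε0] with m hm
      rw [hm, ramp_of_ge (by linarith [hε0 m]) h.le, sub_self, zero_smul]

/-- If `t ≤ a`, the stopped increment vanishes and the cutoff weight equals the bump. If `b ≤ t`,
the two terms agree. If `a < t < b`, both are of order `δ ^ p`; the difference of indicators is then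
`1`, and it telescopes, so this error is counted once. -/
theorem abs_inner_stopped_sub_cutoff_le (hp : Even p) (hp0 : 0 < p)
    {S : ℝ → EuclideanSpace ℝ (Fin d)} {A : Tens d p} {Φ δ ε a b t : ℝ} (hA : ‖A‖ ≤ Φ)
    (hε : 0 < ε) (hab : a < b)
    (hosc : ∀ r ∈ Icc a b, ∀ s ∈ Icc a b, ‖S r - S s‖ ≤ δ) :
    |inner ℝ A (tpow (S (min b t) - S (min a t)) p) -
      inner ℝ ((1 - ramp t (t + ε) a) • A) (tpow (S b - S a) p)| ≤
    Φ * d ^ p * inner ℝ ((ramp (t - ε) t a - ramp t (t + ε) a) • diagTens d p)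
      (tpow (S b - S a) p) + 2 * Φ * δ ^ p * ((Ici t).indicator 1 b - (Ici t).indicator 1 a) := by
  have hΦ : 0 ≤ Φ := (norm_nonneg _).trans hA
  have hδ : 0 ≤ δ := (norm_nonneg _).trans (hosc a ⟨le_rfl, hab.le⟩ a ⟨le_rfl, hab.le⟩)
  have hQ := norm_pow_le_inner_diagTens hp hp0 (S b - S a)
  have hinner : ∀ v, |inner ℝ A (tpow v p)| ≤ Φ * ‖v‖ ^ p := fun v => by
    refine (abs_real_inner_le_norm _ _).trans ?_
    rw [norm_tpow]
    gcongr
  rw [real_inner_smul_left, real_inner_smul_left]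
  set Q := inner ℝ (diagTens d p) (tpow (S b - S a) p) with hQd
  have hQ0 : 0 ≤ Q := by
    rw [hQd, inner_diagTens]
    exact Finset.sum_nonneg fun _ _ => hp.pow_nonneg _
  rcases le_or_gt t a with h | h
  · rw [min_eq_right h, min_eq_right (h.trans hab.le), sub_self, tpow_zero_left hp0.ne',
      inner_zero_right, zero_sub, abs_neg, abs_mul,
      abs_of_nonneg (sub_nonneg.2 (ramp_le_one _ _ _)), ramp_of_ge (by linarith) h,
      indicator_of_mem (show a ∈ Ici t from h),
      indicator_of_mem (show b ∈ Ici t from h.trans hab.le)]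
    have h1 := (hinner (S b - S a)).trans (mul_le_mul_of_nonneg_left hQ hΦ)
    have h2 := mul_le_mul_of_nonneg_left h1 (sub_nonneg.2 (ramp_le_one t (t + ε) a))
    simp only [Pi.one_apply, sub_self, mul_zero, add_zero]
    linarith
  · rw [ramp_of_le (a := t) (by linarith) h.le, sub_zero, sub_zero, one_mul, min_eq_left h.le,
      indicator_of_notMem (show a ∉ Ici t from not_le.2 h), sub_zero]
    have hψ : 0 ≤ Φ * d ^ p * (ramp (t - ε) t a * Q) := by
      have := ramp_nonneg (t - ε) t a
      positivity
    rcases le_or_gt b t with hb | hb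
    · rw [min_eq_left hb, sub_self, abs_zero]
      have h3 : 0 ≤ (Ici t).indicator (1 : ℝ → ℝ) b := indicator_nonneg (fun _ _ => zero_le_one) _
      positivity
    · rw [min_eq_right hb.le, indicator_of_mem (show b ∈ Ici t from hb.le)]
      have h1 : ∀ r ∈ Icc a b, |inner ℝ A (tpow (S r - S a) p)| ≤ Φ * δ ^ p := fun r hr =>
        (hinner _).trans (by
          have := hosc r hr a ⟨le_rfl, hab.le⟩
          gcongr)
      have h2 := h1 t ⟨h.le, hb.le⟩
      have h3 := h1 b ⟨hab.le, le_rfl⟩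
      have h4 := abs_sub (inner ℝ A (tpow (S t - S a) p)) (inner ℝ A (tpow (S b - S a) p))
      simp only [Pi.one_apply, mul_one]
      linarith

theorem abs_sum_inner_stopped_sub_cutoff_le (hp : Even p) (hp0 : 0 < p)
    (P : IntervalPartition 0 T) {S : ℝ → EuclideanSpace ℝ (Fin d)} {φ : ℝ → Tens d p}
    {Φ δ ε : ℝ} (t : ℝ) (hΦ0 : 0 ≤ Φ) (hΦ : ∀ r ∈ Icc 0 T, ‖φ r‖ ≤ Φ) (hε : 0 < ε)
    (hosc : ∀ e ∈ P.intervals, ∀ r ∈ Icc e.1 e.2, ∀ s ∈ Icc e.1 e.2, ‖S r - S s‖ ≤ δ) :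
    |∑ e ∈ P.intervals, inner ℝ (φ e.1) (tpow (S (min e.2 t) - S (min e.1 t)) p) -
      ∑ e ∈ P.intervals, inner ℝ ((1 - ramp t (t + ε) e.1) • φ e.1) (tpow (S e.2 - S e.1) p)| ≤
    Φ * d ^ p * ∑ e ∈ P.intervals,
      inner ℝ ((ramp (t - ε) t e.1 - ramp t (t + ε) e.1) • diagTens d p)
        (tpow (S e.2 - S e.1) p) + 2 * Φ * δ ^ p := by
  have hterm : ∀ e ∈ P.intervals,
      |inner ℝ (φ e.1) (tpow (S (min e.2 t) - S (min e.1 t)) p) -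
        inner ℝ ((1 - ramp t (t + ε) e.1) • φ e.1) (tpow (S e.2 - S e.1) p)| ≤
      Φ * d ^ p * inner ℝ ((ramp (t - ε) t e.1 - ramp t (t + ε) e.1) • diagTens d p)
        (tpow (S e.2 - S e.1) p) +
        2 * Φ * δ ^ p * ((Ici t).indicator 1 e.2 - (Ici t).indicator 1 e.1) := fun e he =>
    abs_inner_stopped_sub_cutoff_le hp hp0 (hΦ e.1 (P.subset_Icc _ (P.mem_intervals.1 he).1)) hε
      (P.mem_intervals.1 he).2.2.1 (hosc e he)
  rw [← Finset.sum_sub_distrib]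
  refine (Finset.abs_sum_le_sum_abs _ _).trans ((Finset.sum_le_sum hterm).trans ?_)
  rw [Finset.sum_add_distrib, ← Finset.mul_sum, ← Finset.mul_sum,
    P.sum_intervals_sub ((Ici t).indicator 1)]
  have h4 : (Ici t).indicator (1 : ℝ → ℝ) T - (Ici t).indicator 1 0 ≤ 1 := by
    have h5 : 0 ≤ (Ici t).indicator (1 : ℝ → ℝ) 0 := indicator_nonneg (fun _ _ => zero_le_one) _
    have h6 : (Ici t).indicator (1 : ℝ → ℝ) T ≤ 1 :=
      indicator_le_self' (fun _ _ => zero_le_one) T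
    linarith
  have h7 : 0 ≤ 2 * Φ * δ ^ p := mul_nonneg (by positivity) (hp.pow_nonneg _)
  have h8 := mul_le_mul_of_nonneg_left h4 h7
  linarith

/-- The defining convergence of the `p`-th variation, stopped at a fixed time. -/
theorem tendsto_sum_inner_stopped (hp : Even p) (hp0 : 0 < p) {π : ℕ → IntervalPartition 0 T}
    {S : ℝ → EuclideanSpace ℝ (Fin d)} {μ : VectorMeasure (Icc (0 : ℝ) T) (Tens d p)}
    (hμ : HasPthVariation p π S μ) {δ : ℕ → ℝ} (hδ : Tendsto δ atTop (𝓝 0))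
    (hosc : ∀ n, ∀ e ∈ (π n).intervals, ∀ r ∈ Icc e.1 e.2, ∀ s ∈ Icc e.1 e.2,
      ‖S r - S s‖ ≤ δ n) {φ : ℝ → Tens d p} (hφ : ContinuousOn φ (Icc 0 T)) (t : ℝ) :
    Tendsto (fun n => ∑ e ∈ (π n).intervals,
      inner ℝ (φ e.1) (tpow (S (min e.2 t) - S (min e.1 t)) p)) atTop
      (𝓝 (tensorIntegral μ φ t)) := by
  obtain ⟨Φ₀, hΦ₀⟩ := isCompact_Icc.exists_bound_of_continuousOn hφ
  obtain ⟨Φ, hΦ0, hΦ⟩ : ∃ Φ : ℝ, 0 < Φ ∧ ∀ r ∈ Icc 0 T, ‖φ r‖ ≤ Φ :=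
    ⟨max Φ₀ 1, by positivity, fun r hr => (hΦ₀ r hr).trans (le_max_left _ _)⟩
  obtain ⟨ε, hε, hε0⟩ : ∃ ε : ℕ → ℝ, Tendsto ε atTop (𝓝 0) ∧ ∀ m, 0 < ε m :=
    ⟨fun m => 1 / ((m : ℝ) + 1), tendsto_one_div_add_atTop_nhds_zero_nat, fun m => by positivity⟩
  rw [Metric.tendsto_atTop]
  intro η hη
  -- The width `ε` is fixed first, making both the error of the cutoff integral and the bump
  -- integral small. Only then does `n` tend to infinity, with continuous test functions to which
  -- the definition of `μ` applies.
  have hI := (tendsto_order.1 (tendsto_iff_dist_tendsto_zero.1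
    (tendsto_integral_cutoff μ hφ t hε hε0))).2 (η / 4) (by positivity)
  have hJ := (tendsto_order.1 ((tendsto_integral_bump hμ.no_atoms (diagTens d p) t hε
    hε0).const_mul (Φ * d ^ p))).2 (η / 4) (by rw [mul_zero]; positivity)
  obtain ⟨m, hIm, hJm⟩ := (hI.and hJ).exists
  replace hε := hε0 m
  generalize ε m = ε at hIm hJm hε
  have hN1 := (tendsto_order.1 (tendsto_iff_dist_tendsto_zero.1 (hμ.tendsto
    (fun r => (1 - ramp t (t + ε) r) • φ r)
    ((continuous_const.sub (continuous_ramp _ _)).continuousOn.smul hφ)))).2 (η / 4)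
    (by positivity)
  have hN2 := (tendsto_order.1 ((hμ.tendsto
    (fun r => (ramp (t - ε) t r - ramp t (t + ε) r) • diagTens d p)
    (((continuous_ramp _ _).sub (continuous_ramp _ _)).continuousOn.smul
      continuousOn_const)).const_mul (Φ * d ^ p))).2 (η / 4) hJm
  have hN3 : ∀ᶠ n in atTop, 2 * Φ * δ n ^ p < η / 4 := by
    have h := (hδ.pow p).const_mul (2 * Φ)
    rw [zero_pow hp0.ne', mul_zero] at h
    exact (tendsto_order.1 h).2 _ (by positivity)
  refine eventually_atTop.1 ?_
  filter_upwards [hN1, hN2, hN3] with n h1 h2 h3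
  have hmain := abs_sum_inner_stopped_sub_cutoff_le hp hp0 (π n) t hΦ0.le hΦ hε (hosc n)
  rw [Real.dist_eq] at h1 hIm ⊢
  rw [abs_lt] at h1 hIm ⊢
  rw [abs_le] at hmain
  constructor <;> linarith [h1.1, h1.2, hIm.1, hIm.2, hmain.1, hmain.2]

end PathwiseRough

namespace PathwiseRough

variable {d p : ℕ} {T : ℝ} {f : EuclideanSpace ℝ (Fin d) → ℝ} {S : ℝ → EuclideanSpace ℝ (Fin d)}

/-! ### Taylor expansions along a continuous path -/

theorem continuous_nabla {k : ℕ} (hf : ContDiff ℝ k f) : Continuous (nabla k f) := by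
  refine (PiLp.continuous_toLp 2 _).comp (continuous_pi fun i => ?_)
  exact (ContinuousMultilinearMap.apply ℝ (fun _ : Fin k => EuclideanSpace ℝ (Fin d)) ℝ
    (fun j => EuclideanSpace.single (i j) (1 : ℝ))).continuous.comp
    (hf.continuous_iteratedFDeriv le_rfl)

theorem norm_nabla_sub_taylor_le {n l : ℕ} (hn : n + l = p) (hf : ContDiff ℝ p f)
    (x y : EuclideanSpace ℝ (Fin d)) {ε : ℝ}
    (hε : ∀ θ ∈ Icc (0 : ℝ) 1,
      ‖iteratedFDeriv ℝ p f (x + θ • (y - x)) - iteratedFDeriv ℝ p f x‖ ≤ ε) :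
    ‖nabla l f y - ∑ m ∈ Finset.range (n + 1),
      contract ((m.factorial : ℝ)⁻¹ • tpow (y - x) m) (nabla (m + l) f x)‖ ≤
      d ^ l * (ε * ‖y - x‖ ^ n) := by
  subst hn
  have hε0 : 0 ≤ ε := (norm_nonneg _).trans (hε 0 ⟨le_rfl, zero_le_one⟩)
  refine (euclidean_norm_le_card_mul (m := ε * ‖y - x‖ ^ n) (by positivity) fun j => ?_).trans_eq
    (by simp)
  refine le_trans (le_of_eq ?_) (abs_nabla_sub_taylor_le hf x (y - x) j hε)
  rw [add_sub_cancel, PiLp.sub_apply, WithLp.ofLp_sum, Finset.sum_apply]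
  congr 2
  refine Finset.sum_congr rfl fun m _ => ?_
  simp only [contract, PiLp.smul_apply, smul_eq_mul, Finset.mul_sum, mul_assoc]

theorem abs_sub_sub_taylor_le (hf : ContDiff ℝ p f)
    (x y : EuclideanSpace ℝ (Fin d)) {ε : ℝ}
    (hε : ∀ θ ∈ Icc (0 : ℝ) 1,
      ‖iteratedFDeriv ℝ p f (x + θ • (y - x)) - iteratedFDeriv ℝ p f x‖ ≤ ε) :
    |f y - f x - ∑ k ∈ Finset.Icc 1 p,
      (k.factorial : ℝ)⁻¹ * inner ℝ (nabla k f x) (tpow (y - x) k)| ≤ ε * ‖y - x‖ ^ p := by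
  have h := abs_nabla_sub_taylor_le (n := p) (l := 0) hf x (y - x) Fin.elim0 hε
  have h0 : ∀ z, nabla 0 f z Fin.elim0 = f z := fun z => by simp [nabla]
  have h1 : ∀ k, contract (tpow (y - x) k) (nabla (k + 0) f x) Fin.elim0 =
      inner ℝ (nabla k f x) (tpow (y - x) k) := by
    intro k
    rw [contract_tpow_nabla, inner_nabla_tpow]
    have h2 : (Fin.append (fun _ : Fin k => y - x)
        fun a : Fin 0 => EuclideanSpace.single (Fin.elim0 a : Fin d) (1 : ℝ)) = fun _ => y - x := by
      funext b
      exact Fin.addCases (fun a => Fin.append_left _ _ a) (fun a => a.elim0) b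
    rw [h2]
    rfl
  simp only [h1] at h
  rw [add_sub_cancel, h0, Finset.sum_range_succ'] at h
  have h3 : (Nat.factorial 0 : ℝ)⁻¹ * inner ℝ (nabla 0 f x) (tpow (y - x) 0) = f x := by
    rw [inner_nabla_tpow]
    simp
  have h4 : ∑ k ∈ Finset.Icc 1 p, (k.factorial : ℝ)⁻¹ * inner ℝ (nabla k f x) (tpow (y - x) k) =
      ∑ k ∈ Finset.range p,
        ((k + 1).factorial : ℝ)⁻¹ * inner ℝ (nabla (k + 1) f x) (tpow (y - x) (k + 1)) := by
    rw [Finset.range_eq_Ico, Finset.sum_Ico_add' (fun k => (k.factorial : ℝ)⁻¹ *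
      inner ℝ (nabla k f x) (tpow (y - x) k)) 0 p 1]
    rfl
  rw [h3] at h
  rw [h4]
  convert h using 2
  ring

theorem segment_mem_closedBall {R : ℝ} {x y : EuclideanSpace ℝ (Fin d)}
    (hx : x ∈ Metric.closedBall 0 R) (hy : y ∈ Metric.closedBall 0 R) {θ : ℝ}
    (hθ : θ ∈ Icc (0 : ℝ) 1) :
    x + θ • (y - x) ∈ Metric.closedBall (0 : EuclideanSpace ℝ (Fin d)) R :=
  (convex_closedBall 0 R).add_smul_sub_mem hx hy hθ

theorem norm_segment_sub_le (x y : EuclideanSpace ℝ (Fin d)) {θ : ℝ} (hθ : θ ∈ Icc (0 : ℝ) 1) :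
    ‖x + θ • (y - x) - x‖ ≤ ‖y - x‖ := by
  rw [add_sub_cancel_left, norm_smul, Real.norm_of_nonneg hθ.1]
  exact mul_le_of_le_one_left (norm_nonneg _) hθ.2

theorem exists_mem_closedBall (hS : ContinuousOn S (Icc 0 T)) :
    ∃ R : ℝ, ∀ t ∈ Icc 0 T, S t ∈ Metric.closedBall 0 R := by
  obtain ⟨R, hR⟩ := isCompact_Icc.exists_bound_of_continuousOn hS
  exact ⟨R, fun t ht => by simpa using hR t ht⟩

/-- Taylor's formula with a remainder which is uniformly small along a continuous path. -/
theorem exists_abs_sub_sub_taylor_le (hS : ContinuousOn S (Icc 0 T)) (hf : ContDiff ℝ p f) {η : ℝ}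
    (hη : 0 < η) : ∃ ρ > 0, ∀ s ∈ Icc 0 T, ∀ t ∈ Icc 0 T, ‖S t - S s‖ < ρ →
      |f (S t) - f (S s) - ∑ k ∈ Finset.Icc 1 p,
        (k.factorial : ℝ)⁻¹ * inner ℝ (nabla k f (S s)) (tpow (S t - S s) k)| ≤
      η * ‖S t - S s‖ ^ p := by
  obtain ⟨R, hR⟩ := exists_mem_closedBall hS
  -- The ball is compact and convex: the top derivative is uniformly continuous on it, and segments
  -- between points of the path stay inside.
  obtain ⟨ρ, hρ, h⟩ := Metric.uniformContinuousOn_iff.1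
    ((isCompact_closedBall (0 : EuclideanSpace ℝ (Fin d)) R).uniformContinuousOn_of_continuous
      (hf.continuous_iteratedFDeriv le_rfl).continuousOn) η hη
  refine ⟨ρ, hρ, fun s hs t ht hst => abs_sub_sub_taylor_le hf _ _ fun θ hθ => ?_⟩
  rw [← dist_eq_norm]
  refine (h _ (segment_mem_closedBall (hR s hs) (hR t ht) hθ) _ (hR s hs) ?_).le
  rw [dist_eq_norm]
  exact (norm_segment_sub_le _ _ hθ).trans_lt hst

/-! ### The gradient path is controlled by the reduced lift -/

theorem gradientPath_of_ne {k : ℕ} (hk : k ≠ 0) (s : ℝ) :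
    gradientPath f S k s = nabla k f (S s) := if_neg hk

theorem continuousOn_gradientPath (hS : ContinuousOn S (Icc 0 T)) {k : ℕ} (hf : ContDiff ℝ k f) :
    ContinuousOn (gradientPath f S k) (Icc 0 T) := by
  by_cases hk : k = 0
  · subst hk
    exact continuousOn_const.congr fun s _ => if_pos rfl
  · exact ((continuous_nabla hf).comp_continuousOn hS).congr fun s _ => gradientPath_of_ne hk s

theorem isSymTens_gradientPath {k : ℕ} (hf : ContDiff ℝ k f) (s : ℝ) :
    IsSymTens (gradientPath f S k s) := by
  by_cases hk : k = 0
  · subst hk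
    intro σ i
    simp [gradientPath]
  · rw [gradientPath_of_ne hk]
    exact isSymTens_nabla hf _

/-- For `l ≥ 1` only levels `m < p` of the lift occur, and these are plain tensor powers. The
estimate is thus Taylor's formula, in which the Lipschitz bound raises the power from `p - l` to `p
- l + 1`. -/
theorem norm_gradientPath_sub_le {V : ℝ → Tens d p} (hf : ContDiff ℝ p f) {K R : ℝ}
    (hK0 : 0 ≤ K)
    (hK : ∀ x ∈ Metric.closedBall (0 : EuclideanSpace ℝ (Fin d)) R, ∀ y ∈ Metric.closedBall 0 R,
      ‖iteratedFDeriv ℝ p f x - iteratedFDeriv ℝ p f y‖ ≤ K * ‖x - y‖) {s t : ℝ}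
    (hs : S s ∈ Metric.closedBall 0 R) (ht : S t ∈ Metric.closedBall 0 R) {l : ℕ} (hl : 1 ≤ l)
    (hlp : l ≤ p) :
    ‖gradientPath f S l t - ∑ m ∈ Finset.range (p - l + 1),
      contract (reducedLift S V m s t) (gradientPath f S (m + l) s)‖ ≤
      d ^ l * K * ‖S t - S s‖ ^ (p - l + 1) := by
  have h := norm_nabla_sub_taylor_le (n := p - l) (l := l) (by omega) hf (S s) (S t)
    (ε := K * ‖S t - S s‖) fun θ hθ => (hK _ (segment_mem_closedBall hs ht hθ) _ hs).trans
      (mul_le_mul_of_nonneg_left (norm_segment_sub_le _ _ hθ) hK0)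
  rw [gradientPath_of_ne (by omega)]
  have h1 : ∀ m ∈ Finset.range (p - l + 1),
      contract (reducedLift S V m s t) (gradientPath f S (m + l) s) =
      contract ((m.factorial : ℝ)⁻¹ • tpow (S t - S s) m) (nabla (m + l) f (S s)) := by
    intro m hm
    rw [Finset.mem_range] at hm
    rw [gradientPath_of_ne (by omega), reducedLift_of_ne S V (by omega)]
  rw [Finset.sum_congr rfl h1]
  refine h.trans_eq ?_
  rw [pow_succ]
  ring

/-- The exponent `q / (p - l + 1)` turns the Taylor remainder into a multiple of `‖S t - S s‖ ^ q`,
so the control of the `q`-variation serves all levels. Compactness of the range of `S` makes the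
local Lipschitz constant uniform. -/
theorem isControlled_gradientPath {q : ℝ} (hpq : (p : ℝ) < q) (hq : ⌊q⌋₊ = p)
    (hS : ContinuousOn S (Icc 0 T)) (hf : ContDiff ℝ p f)
    (hL : LocallyLipschitz (iteratedFDeriv ℝ p f)) (V : ℝ → Tens d p) {H : ℝ → ℝ}
    (hHc : ContinuousOn H (Icc 0 T)) (hHm : MonotoneOn H (Icc 0 T))
    (hSH : ∀ s t, 0 ≤ s → s ≤ t → t ≤ T → ‖S t - S s‖ ^ q ≤ H t - H s) :
    IsControlled q T (reducedLift S V) (gradientPath f S) where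
  cont := fun k hk => continuousOn_gradientPath hS
    (hf.of_le (by exact_mod_cast (hq ▸ hk : k ≤ p)))
  symm := fun k hk t _ => isSymTens_gradientPath
    (hf.of_le (by exact_mod_cast (hq ▸ hk : k ≤ p))) t
  bound := by
    have hq0 : 0 < q := (Nat.cast_nonneg p).trans_lt hpq
    obtain ⟨R, hR⟩ := exists_mem_closedBall hS
    obtain ⟨K, hK⟩ := (hL.locallyLipschitzOn
      (s := Metric.closedBall (0 : EuclideanSpace ℝ (Fin d)) R)).exists_lipschitzOnWith_of_compact
      (isCompact_closedBall _ _)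
    have hK' : ∀ x ∈ Metric.closedBall (0 : EuclideanSpace ℝ (Fin d)) R,
        ∀ y ∈ Metric.closedBall 0 R,
        ‖iteratedFDeriv ℝ p f x - iteratedFDeriv ℝ p f y‖ ≤ K * ‖x - y‖ := by
      intro x hx y hy
      rw [← dist_eq_norm, ← dist_eq_norm]
      exact hK.dist_le_mul x hx y hy
    set C := ∑ l ∈ Finset.Icc 1 p, (d ^ l * K : ℝ) ^ (q / ((p : ℝ) - l + 1)) with hC
    have hC0 : 0 ≤ C := Finset.sum_nonneg fun l _ => by positivity
    refine ⟨fun s t => C * H t - C * H s, isControl_sub (continuousOn_const.mul hHc)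
      fun s hs t ht hst => mul_le_mul_of_nonneg_left (hHm hs ht hst) hC0, ?_⟩
    intro s t hs hst ht
    simp only [← mul_sub, hq]
    rw [hC, Finset.sum_mul]
    refine Finset.sum_le_sum fun l hl => ?_
    obtain ⟨hl1, hlp⟩ := Finset.mem_Icc.1 hl
    have hr : ((p - l + 1 : ℕ) : ℝ) = (p : ℝ) - l + 1 := by
      rw [Nat.cast_add, Nat.cast_sub hlp, Nat.cast_one]
    have hr0 : 0 < (p : ℝ) - l + 1 := by rw [← hr]; positivity
    have h := norm_gradientPath_sub_le (V := V) hf K.2 hK' (hR s ⟨hs, hst.trans ht⟩)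
      (hR t ⟨hs.trans hst, ht⟩) hl1 hlp
    refine (Real.rpow_le_rpow (norm_nonneg _) h (by positivity)).trans ?_
    have hK1 : (0 : ℝ) ≤ d ^ l * K := by positivity
    rw [Real.mul_rpow (by exact hK1) (by positivity), ← Real.rpow_natCast (‖S t - S s‖),
      ← Real.rpow_mul (norm_nonneg _), hr, mul_div_cancel₀ _ hr0.ne']
    exact mul_le_mul_of_nonneg_left (hSH s t hs hst ht) (by positivity)

end PathwiseRough

namespace PathwiseRough

variable {d p : ℕ} {T : ℝ} {f : EuclideanSpace ℝ (Fin d) → ℝ} {S : ℝ → EuclideanSpace ℝ (Fin d)}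
  {μ : VectorMeasure (Icc (0 : ℝ) T) (Tens d p)}

/-! ### Consequences of finite `p`-th variation -/

/-- With the constant test function `diagTens` the sums converge, hence are bounded. -/
theorem HasPthVariation.exists_sum_abs_pow_le (hp : Even p) {π : ℕ → IntervalPartition 0 T}
    (hμ : HasPthVariation p π S μ) :
    ∃ B : ℝ, ∀ n, ∑ e ∈ (π n).intervals, ∑ i, |S e.2 i - S e.1 i| ^ p ≤ B := by
  obtain ⟨B, hB⟩ := (hμ.tendsto (fun _ => diagTens d p) continuousOn_const).bddAbove_range
  refine ⟨B, fun n => le_trans (le_of_eq ?_) (hB ⟨n, rfl⟩)⟩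
  refine Finset.sum_congr rfl fun e _ => ?_
  rw [inner_diagTens]
  exact Finset.sum_congr rfl fun i _ => hp.pow_abs _

theorem norm_pthVariation_sub_le (μ : VectorMeasure (Icc (0 : ℝ) T) (Tens d p)) {s t : ℝ}
    (hst : s ≤ t) : ‖pthVariation μ t - pthVariation μ s‖ ≤
      μ.variation.real {x | (x : ℝ) ≤ t} - μ.variation.real {x | (x : ℝ) ≤ s} := by
  have := isFiniteMeasure_variation μ
  rw [pthVariation, pthVariation, vectorMeasure_le_sub_le μ hst, measureReal_le_sub_le _ hst]
  exact VectorMeasure.norm_measure_le_variation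

theorem monotone_measureReal_le (μ : VectorMeasure (Icc (0 : ℝ) T) (Tens d p)) :
    Monotone fun t : ℝ => μ.variation.real {x : Icc (0 : ℝ) T | (x : ℝ) ≤ t} := fun _ _ h =>
  sub_nonneg.1 ((norm_nonneg _).trans (norm_pthVariation_sub_le μ h))

/-- The sums stopped at time `0` vanish identically, and limits are unique. -/
theorem tensorIntegral_zero (hp : Even p) (hp0 : 0 < p) {π : ℕ → IntervalPartition 0 T}
    (hμ : HasPthVariation p π S μ) {δ : ℕ → ℝ} (hδ : Tendsto δ atTop (𝓝 0))
    (hosc : ∀ n, ∀ e ∈ (π n).intervals, ∀ r ∈ Icc e.1 e.2, ∀ s ∈ Icc e.1 e.2,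
      ‖S r - S s‖ ≤ δ n) {φ : ℝ → Tens d p} (hφ : ContinuousOn φ (Icc 0 T)) :
    tensorIntegral μ φ 0 = 0 := by
  refine tendsto_nhds_unique (tendsto_sum_inner_stopped hp hp0 hμ hδ hosc hφ 0)
    (tendsto_const_nhds.congr fun n => ?_)
  refine (Finset.sum_eq_zero fun e he => ?_).symm
  obtain ⟨h1, h2, _⟩ := (π n).intervals_mem_Icc he
  rw [min_eq_right h1, min_eq_right (h1.trans h2), sub_self, tpow_zero_left hp0.ne',
    inner_zero_right]

/-! ### The compensated increments -/

theorem sum_inner_gradientPath_reducedLift (hp0 : 0 < p) (V : ℝ → Tens d p) (s t : ℝ) :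
    ∑ k ∈ Finset.Icc 1 p, inner ℝ (gradientPath f S k s) (reducedLift S V k s t) =
      ∑ k ∈ Finset.Icc 1 p,
        (k.factorial : ℝ)⁻¹ * inner ℝ (nabla k f (S s)) (tpow (S t - S s) k) -
      (p.factorial : ℝ)⁻¹ * inner ℝ (nabla p f (S s)) (V t - V s) := by
  have h1 : ∀ k ∈ Finset.Icc 1 p, inner ℝ (gradientPath f S k s) (reducedLift S V k s t) =
      (k.factorial : ℝ)⁻¹ * inner ℝ (nabla k f (S s)) (tpow (S t - S s) k) -
      inner ℝ (nabla k f (S s)) (variationIncrement V k s t) := by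
    intro k hk
    rw [gradientPath_of_ne (Nat.one_le_iff_ne_zero.1 (Finset.mem_Icc.1 hk).1), reducedLift_eq,
      inner_sub_right, real_inner_smul_right]
  rw [Finset.sum_congr rfl h1, Finset.sum_sub_distrib,
    Finset.sum_eq_single_of_mem (f := fun k => inner ℝ (nabla k f (S s))
      (variationIncrement V k s t)) p (Finset.mem_Icc.2 ⟨hp0, le_rfl⟩) fun k _ hk => by
        rw [variationIncrement_of_ne V hk, inner_zero_right],
    variationIncrement_self, real_inner_smul_right]

/-- A local Itô formula: one error is the Taylor remainder, the other comes from freezing `∇^p f(S)`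
at time `s` in the integral against `μ`. The correction in the top level of the lift is exactly this
frozen integral. -/
theorem exists_abs_sub_compensated_le (hp0 : 0 < p) (hS : ContinuousOn S (Icc 0 T))
    (hf : ContDiff ℝ p f) (μ : VectorMeasure (Icc (0 : ℝ) T) (Tens d p)) {η : ℝ} (hη : 0 < η) :
    ∃ ρ > 0, ∀ s t, 0 ≤ s → s ≤ t → t ≤ T → (∀ r ∈ Icc s t, ‖S r - S s‖ < ρ) →
      |f (S t) - (p.factorial : ℝ)⁻¹ * tensorIntegral μ (fun r => nabla p f (S r)) t -
        (f (S s) - (p.factorial : ℝ)⁻¹ * tensorIntegral μ (fun r => nabla p f (S r)) s) -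
        ∑ k ∈ Finset.Icc 1 p,
          inner ℝ (gradientPath f S k s) (reducedLift S (pthVariation μ) k s t)| ≤
      η * (‖S t - S s‖ ^ p +
        (μ.variation.real {x | (x : ℝ) ≤ t} - μ.variation.real {x | (x : ℝ) ≤ s})) := by
  obtain ⟨ρ₁, hρ₁, h₁⟩ := exists_abs_sub_sub_taylor_le hS hf hη
  obtain ⟨R, hR⟩ := exists_mem_closedBall hS
  obtain ⟨ρ₂, hρ₂, h₂⟩ := Metric.uniformContinuousOn_iff.1
    ((isCompact_closedBall (0 : EuclideanSpace ℝ (Fin d)) R).uniformContinuousOn_of_continuous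
      (continuous_nabla hf).continuousOn) η hη
  refine ⟨min ρ₁ ρ₂, lt_min hρ₁ hρ₂, fun s t hs hst ht hosc => ?_⟩
  have hsm : s ∈ Icc 0 T := ⟨hs, hst.trans ht⟩
  have hT := h₁ s hsm t ⟨hs.trans hst, ht⟩ ((hosc t ⟨hst, le_rfl⟩).trans_le (min_le_left _ _))
  have hI := abs_tensorIntegral_sub_sub_le μ (φ := fun r => nabla p f (S r))
    ((continuous_nabla hf).comp_continuousOn hS) (η := η) hst fun r hr hrT => by
      rw [← dist_eq_norm]
      refine (h₂ _ (hR r hrT) _ (hR s hsm) ?_).le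
      rw [dist_eq_norm]
      exact (hosc r hr).trans_le (min_le_right _ _)
  rw [sum_inner_gradientPath_reducedLift hp0]
  have hfac : (p.factorial : ℝ)⁻¹ ≤ 1 :=
    inv_le_one_of_one_le₀ (by exact_mod_cast p.factorial_pos)
  have hfac0 : 0 ≤ (p.factorial : ℝ)⁻¹ := by positivity
  have hI' := (mul_le_of_le_one_left (abs_nonneg _) hfac).trans hI
  nth_rewrite 1 [← abs_of_nonneg hfac0] at hI'
  rw [← abs_mul] at hI'
  rw [mul_add]
  refine le_trans (le_of_eq_of_le ?_ (abs_sub _ _)) (add_le_add hT hI')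
  congr 1
  ring

/-! ### Partitions along which the compensated sums converge -/

/-- Keep the points of `P` in `[s, t]` and add the two ends; every new interval lies inside an old
one, so oscillation bounds are inherited. -/
theorem IntervalPartition.exists_restrict (P : IntervalPartition 0 T) {s t : ℝ} (hs : 0 ≤ s)
    (hst : s ≤ t) (ht : t ≤ T) :
    ∃ Q : IntervalPartition s t, Q.points.card ≤ P.points.card + 2 ∧
      ∀ e ∈ Q.intervals, ∃ e' ∈ P.intervals, e'.1 ≤ e.1 ∧ e.2 ≤ e'.2 := by
  classical
  let Q : IntervalPartition s t :=
    { points := insert s (insert t (P.points.filter fun x => x ∈ Icc s t))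
      left_mem := by simp
      right_mem := by simp
      subset_Icc := by
        intro x hx
        simp only [Finset.mem_insert, Finset.mem_filter] at hx
        rcases hx with rfl | rfl | hx
        · exact ⟨le_rfl, hst⟩
        · exact ⟨hst, le_rfl⟩
        · exact hx.2 }
  refine ⟨Q, ?_, fun e he => ?_⟩
  · refine (Finset.card_insert_le _ _).trans (Nat.succ_le_succ
      ((Finset.card_insert_le _ _).trans (Nat.succ_le_succ (Finset.card_filter_le _ _))))
  · obtain ⟨h1, h2, h3⟩ := Q.intervals_mem_Icc he
    obtain ⟨_, _, h4, h5⟩ := Q.mem_intervals.1 he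
    refine P.exists_intervals_of_forall_notMem (hs.trans h1) h4 (h3.trans ht) fun r hr hr' => ?_
    refine h5 r ?_ hr'
    simp only [Q, Finset.mem_insert, Finset.mem_filter]
    exact Or.inr (Or.inr ⟨hr, h1.trans hr'.1.le, hr'.2.le.trans h3⟩)

theorem exists_abs_sum_compensated_le (hp0 : 0 < p) (hS : ContinuousOn S (Icc 0 T))
    (hf : ContDiff ℝ p f) (μ : VectorMeasure (Icc (0 : ℝ) T) (Tens d p))
    {π : ℕ → IntervalPartition 0 T} {δ : ℕ → ℝ} (hδ : Tendsto δ atTop (𝓝 0))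
    (hδ0 : ∀ n, 0 ≤ δ n)
    (hosc : ∀ n, ∀ e ∈ (π n).intervals, ∀ r ∈ Icc e.1 e.2, ∀ s ∈ Icc e.1 e.2,
      ‖S r - S s‖ ≤ δ n) {M : ℝ} (hM : ∀ n, (π n).points.card * δ n ^ p ≤ M) {s t : ℝ}
    (hs : 0 ≤ s) (hst : s ≤ t) (ht : t ≤ T) {ε : ℝ} (hε : 0 < ε) :
    ∃ P : IntervalPartition s t, |∑ e ∈ P.intervals,
      (f (S e.2) - (p.factorial : ℝ)⁻¹ * tensorIntegral μ (fun r => nabla p f (S r)) e.2 -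
        (f (S e.1) - (p.factorial : ℝ)⁻¹ * tensorIntegral μ (fun r => nabla p f (S r)) e.1) -
        ∑ k ∈ Finset.Icc 1 p,
          inner ℝ (gradientPath f S k e.1) (reducedLift S (pthVariation μ) k e.1 e.2))| ≤ ε := by
  set G : ℝ → ℝ := fun t => μ.variation.real {x : Icc (0 : ℝ) T | (x : ℝ) ≤ t} with hG
  have hGm : Monotone G := monotone_measureReal_le μ
  have hM0 : 0 ≤ M := (mul_nonneg (Nat.cast_nonneg _) (pow_nonneg (hδ0 0) p)).trans (hM 0)
  have hGst : 0 ≤ G t - G s := sub_nonneg.2 (hGm hst)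
  -- `M` bounds the number of points times `δ n ^ p`, the `1` pays for the two added end points, and
  -- the increments of `G` telescope.
  set L := M + 1 + (G t - G s) with hL
  have hL0 : 0 < L := by positivity
  obtain ⟨ρ, hρ, h⟩ := exists_abs_sub_compensated_le hp0 hS hf μ (div_pos hε hL0)
  have hδp : ∀ᶠ n in atTop, 2 * δ n ^ p < 1 := by
    have h := (hδ.pow p).const_mul 2
    rw [zero_pow hp0.ne', mul_zero] at h
    exact (tendsto_order.1 h).2 _ one_pos
  obtain ⟨n, hn1, hn2⟩ := (hδp.and ((tendsto_order.1 hδ).2 ρ hρ)).exists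
  obtain ⟨Q, hcard, hQ⟩ := (π n).exists_restrict hs hst ht
  refine ⟨Q, ?_⟩
  have hterm : ∀ e ∈ Q.intervals, |f (S e.2) -
        (p.factorial : ℝ)⁻¹ * tensorIntegral μ (fun r => nabla p f (S r)) e.2 -
        (f (S e.1) - (p.factorial : ℝ)⁻¹ * tensorIntegral μ (fun r => nabla p f (S r)) e.1) -
        ∑ k ∈ Finset.Icc 1 p,
          inner ℝ (gradientPath f S k e.1) (reducedLift S (pthVariation μ) k e.1 e.2)| ≤
      ε / L * (δ n ^ p + (G e.2 - G e.1)) := by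
    intro e he
    obtain ⟨e', he', h1', h2'⟩ := hQ e he
    obtain ⟨h1, h2, h3⟩ := Q.intervals_mem_Icc he
    have ho : ∀ r ∈ Icc e.1 e.2, ‖S r - S e.1‖ ≤ δ n := fun r hr =>
      hosc n e' he' r ⟨h1'.trans hr.1, hr.2.trans h2'⟩ e.1 ⟨h1', h2.trans h2'⟩
    refine (h e.1 e.2 (hs.trans h1) h2 (h3.trans ht) fun r hr => (ho r hr).trans_lt hn2).trans ?_
    have h4 := pow_le_pow_left₀ (norm_nonneg _) (ho e.2 ⟨h2, le_rfl⟩) p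
    gcongr
  refine (Finset.abs_sum_le_sum_abs _ _).trans ((Finset.sum_le_sum hterm).trans ?_)
  rw [← Finset.mul_sum, Finset.sum_add_distrib, Q.sum_intervals_sub G, Finset.sum_const,
    nsmul_eq_mul]
  have hc : (Q.intervals.card : ℝ) ≤ (π n).points.card + 2 := by
    exact_mod_cast Q.card_intervals_le.trans hcard
  have h1 := mul_le_mul_of_nonneg_right hc (pow_nonneg (hδ0 n) p)
  have h2 : Q.intervals.card * δ n ^ p + (G t - G s) ≤ L := by
    rw [add_mul] at h1
    have := hM n
    rw [hL]
    linarith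
  calc ε / L * (Q.intervals.card * δ n ^ p + (G t - G s)) ≤ ε / L * L := by gcongr
    _ = ε := div_mul_cancel₀ _ hL0.ne'

/-! ### Existence and equality of the integrals -/

theorem isRoughIntegral_gradientPath {q : ℝ} (hp0 : 0 < p) (hpq : (p : ℝ) < q) (hq : ⌊q⌋₊ = p)
    (hS : ContinuousOn S (Icc 0 T)) (hf : ContDiff ℝ p f)
    {π : ℕ → IntervalPartition 0 T} {δ : ℕ → ℝ} (hδ : Tendsto δ atTop (𝓝 0))
    (hδ0 : ∀ n, 0 ≤ δ n)
    (hosc : ∀ n, ∀ e ∈ (π n).intervals, ∀ r ∈ Icc e.1 e.2, ∀ s ∈ Icc e.1 e.2,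
      ‖S r - S s‖ ≤ δ n) {M : ℝ} (hM : ∀ n, (π n).points.card * δ n ^ p ≤ M)
    (hX : IsReducedRoughPath q T (reducedLift S (pthVariation μ)))
    (hY : IsControlled q T (reducedLift S (pthVariation μ)) (gradientPath f S))
    (hA0 : tensorIntegral μ (fun r => nabla p f (S r)) 0 = 0) {t : ℝ} (ht : t ∈ Icc 0 T) :
    IsRoughIntegral p (reducedLift S (pthVariation μ)) (gradientPath f S) t
      (f (S t) - f (S 0) -
        (p.factorial : ℝ)⁻¹ * tensorIntegral μ (fun r => nabla p f (S r)) t) := by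
  have hq0 : 0 < q := (Nat.cast_nonneg p).trans_lt hpq
  obtain ⟨H, hHc, hHm, hH⟩ := exists_abs_sum_inner_sub_sub_le hq0 hX hY
  -- This is where `⌊q⌋ = p` matters: it gives `q < p + 1`.
  have hθ : 1 < ((p : ℝ) + 1) / q := by
    rw [one_lt_div hq0, ← hq]
    exact Nat.lt_floor_add_one q
  rw [hq] at hH
  set F : ℝ → ℝ → ℝ := fun s t => ∑ k ∈ Finset.Icc 1 p,
    inner ℝ (gradientPath f S k s) (reducedLift S (pthVariation μ) k s t) with hF
  set g : ℝ → ℝ := fun t =>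
    f (S t) - (p.factorial : ℝ)⁻¹ * tensorIntegral μ (fun r => nabla p f (S r)) t with hg
  have hE : ∀ s u t, 0 ≤ s → s ≤ u → u ≤ t → t ≤ T →
      |(g t - g s - F s t) - (g u - g s - F s u) - (g t - g u - F u t)| ≤
        p * (H t - H s) ^ (((p : ℝ) + 1) / q) := by
    intro s u t hs hsu hut ht
    refine le_of_eq_of_le ?_ (hH s u t hs hsu hut ht)
    rw [← abs_neg]
    congr 1
    simp only [hF]
    ring
  -- With all three times equal, almost additivity itself forces the diagonal value to vanish.
  have hE0 : ∀ t ∈ Icc 0 T, g t - g t - F t t = 0 := by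
    intro t ht
    have h := hE t t t ht.1 le_rfl le_rfl ht.2
    rw [sub_self (H t), Real.zero_rpow (by positivity), mul_zero, abs_nonpos_iff] at h
    linarith
  intro ε hε
  obtain ⟨ρ, hρ, h⟩ := tendsto_sum_intervals_zero (E := fun s t => g t - g s - F s t)
    (Nat.cast_nonneg p) hθ hHm hHc hE0 hE (fun s t hs hst ht ε hε =>
      exists_abs_sum_compensated_le hp0 hS hf μ hδ hδ0 hosc hM hs hst ht hε) ht ε hε
  refine ⟨ρ, hρ, fun P hP => ?_⟩
  have h1 := h P hP
  rw [Finset.sum_sub_distrib, P.sum_intervals_sub g, abs_sub_comm] at h1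
  refine lt_of_eq_of_lt ?_ h1
  congr 1
  simp only [hg, hF, hA0]
  ring

/-- The derivatives are taken at `a`, not at `min a t`. For `a ≤ t` these agree; for `a > t` all
stopped increments vanish. -/
theorem abs_stopped_sub_taylor_le {η ρ : ℝ} (hη : 0 ≤ η)
    (h : ∀ s ∈ Icc 0 T, ∀ t ∈ Icc 0 T, ‖S t - S s‖ < ρ →
      |f (S t) - f (S s) - ∑ k ∈ Finset.Icc 1 p,
        (k.factorial : ℝ)⁻¹ * inner ℝ (nabla k f (S s)) (tpow (S t - S s) k)| ≤
      η * ‖S t - S s‖ ^ p) {a b t δ : ℝ} (ha : 0 ≤ a) (hab : a ≤ b) (hb : b ≤ T) (hδρ : δ < ρ)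
    (hosc : ∀ r ∈ Icc a b, ∀ s ∈ Icc a b, ‖S r - S s‖ ≤ δ) :
    |f (S (min b t)) - f (S (min a t)) - ∑ k ∈ Finset.Icc 1 p, (k.factorial : ℝ)⁻¹ *
      inner ℝ (nabla k f (S a)) (tpow (S (min b t) - S (min a t)) k)| ≤ η * δ ^ p := by
  have hδ0 : 0 ≤ δ := (norm_nonneg _).trans (hosc a ⟨le_rfl, hab⟩ a ⟨le_rfl, hab⟩)
  rcases le_or_gt a t with hat | hat
  · rw [min_eq_left hat]
    have hm : a ≤ min b t := le_min hab hat
    have ho := hosc (min b t) ⟨hm, min_le_left _ _⟩ a ⟨le_rfl, hab⟩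
    refine (h a ⟨ha, hab.trans hb⟩ (min b t) ⟨ha.trans hm, (min_le_left _ _).trans hb⟩
      (ho.trans_lt hδρ)).trans ?_
    gcongr
  · rw [min_eq_right hat.le, min_eq_right (hat.le.trans hab), sub_self, sub_self, zero_sub,
      abs_neg, Finset.sum_eq_zero fun k hk => ?_, abs_zero]
    · positivity
    · rw [tpow_zero_left (Nat.one_le_iff_ne_zero.1 (Finset.mem_Icc.1 hk).1), inner_zero_right,
        mul_zero]

/-- Taylor's formula of order `p` is summed along the partition: increments of `f` telescope, the
remainder is arbitrarily small times a bounded quantity, and moving the convergent term of order `p`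
to the other side leaves the sums up to `p - 1`. -/
theorem isPathwiseIntegral_gradient (hp0 : 0 < p)
    (hS : ContinuousOn S (Icc 0 T)) (hf : ContDiff ℝ p f)
    {π : ℕ → IntervalPartition 0 T} {δ : ℕ → ℝ} (hδ : Tendsto δ atTop (𝓝 0))
    (hδ0 : ∀ n, 0 ≤ δ n)
    (hosc : ∀ n, ∀ e ∈ (π n).intervals, ∀ r ∈ Icc e.1 e.2, ∀ s ∈ Icc e.1 e.2,
      ‖S r - S s‖ ≤ δ n) {M : ℝ} (hM : ∀ n, (π n).points.card * δ n ^ p ≤ M) {t A : ℝ}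
    (ht : t ∈ Icc 0 T)
    (hA : Tendsto (fun n => ∑ e ∈ (π n).intervals,
      inner ℝ (nabla p f (S e.1)) (tpow (S (min e.2 t) - S (min e.1 t)) p)) atTop (𝓝 A)) :
    IsPathwiseIntegral p π S f t (f (S t) - f (S 0) - (p.factorial : ℝ)⁻¹ * A) := by
  have hM0 : 0 ≤ M := (mul_nonneg (Nat.cast_nonneg _) (pow_nonneg (hδ0 0) p)).trans (hM 0)
  have hR : Tendsto (fun n => ∑ e ∈ (π n).intervals,
      (f (S (min e.2 t)) - f (S (min e.1 t)) - ∑ k ∈ Finset.Icc 1 p, (k.factorial : ℝ)⁻¹ *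
        inner ℝ (nabla k f (S e.1)) (tpow (S (min e.2 t) - S (min e.1 t)) k))) atTop (𝓝 0) := by
    rw [Metric.tendsto_atTop]
    intro ε hε
    have hη : 0 < ε / (M + 1) := by positivity
    obtain ⟨ρ, hρ, h⟩ := exists_abs_sub_sub_taylor_le hS hf hη
    refine eventually_atTop.1 ?_
    filter_upwards [(tendsto_order.1 hδ).2 ρ hρ] with n hn
    rw [dist_zero_right, Real.norm_eq_abs]
    refine (Finset.abs_sum_le_sum_abs _ _).trans_lt ((Finset.sum_le_sum fun e he => by
      obtain ⟨h1, h2, h3⟩ := (π n).intervals_mem_Icc he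
      exact abs_stopped_sub_taylor_le hη.le h h1 h2 h3 hn (hosc n e he)).trans_lt ?_)
    rw [Finset.sum_const, nsmul_eq_mul]
    have hc : ((π n).intervals.card : ℝ) ≤ (π n).points.card := by
      exact_mod_cast (π n).card_intervals_le
    have h1 := (mul_le_mul_of_nonneg_right hc (pow_nonneg (hδ0 n) p)).trans (hM n)
    calc (π n).intervals.card * (ε / (M + 1) * δ n ^ p)
        = ε / (M + 1) * ((π n).intervals.card * δ n ^ p) := by ring
      _ ≤ ε / (M + 1) * M := by gcongr
      _ < ε / (M + 1) * (M + 1) := by gcongr; linarith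
      _ = ε := div_mul_cancel₀ _ (by positivity)
  have hlim := (tendsto_const_nhds (x := f (S t) - f (S 0))).sub
    ((hA.const_mul (p.factorial : ℝ)⁻¹).add hR)
  rw [add_zero] at hlim
  refine hlim.congr fun n => ?_
  have htel := (π n).sum_intervals_sub fun r => f (S (min r t))
  rw [min_eq_right ht.2, min_eq_left ht.1] at htel
  have hI : ∀ F : ℕ → ℝ, ∑ k ∈ Finset.Icc 1 p, F k = ∑ k ∈ Finset.Icc 1 (p - 1), F k + F p := by
    intro F
    obtain ⟨m, rfl⟩ : ∃ m, p = m + 1 := ⟨p - 1, by omega⟩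
    rw [Finset.sum_Icc_succ_top (by omega), Nat.add_sub_cancel]
  simp only [hI]
  rw [Finset.sum_sub_distrib, htel, Finset.sum_add_distrib, ← Finset.mul_sum]
  ring

theorem tendsto_mul_two_inv_pow (D : ℝ) : Tendsto (fun n : ℕ => D * (2⁻¹ : ℝ) ^ n) atTop (𝓝 0) := by
  simpa using (tendsto_pow_atTop_nhds_zero_of_lt_one (r := (2⁻¹ : ℝ)) (by norm_num)
    (by norm_num)).const_mul D

end PathwiseRough

/-! ### The main theorem -/

theorem mainTheorem7 {d p : ℕ} (hp : Even p) (hp0 : 0 < p) {q : ℝ} (hpq : (p : ℝ) < q)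
    (hq : ⌊q⌋₊ = p) {T : ℝ} (hT : 0 < T) (S : ℝ → EuclideanSpace ℝ (Fin d))
    (hS : ContinuousOn S (Set.Icc 0 T))
    (μ : MeasureTheory.VectorMeasure (Set.Icc (0 : ℝ) T) (PathwiseRough.Tens d p))
    (hμ : PathwiseRough.HasPthVariation p (PathwiseRough.dyadicLebesgue hT.le hS) S μ)
    (f : EuclideanSpace ℝ (Fin d) → ℝ) (hf : ContDiff ℝ ⌊q⌋₊ f) :
    PathwiseRough.IsReducedRoughPath q T
      (PathwiseRough.reducedLift S (PathwiseRough.pthVariation μ)) ∧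
    (LocallyLipschitz (iteratedFDeriv ℝ ⌊q⌋₊ f) →
      PathwiseRough.IsControlled q T
        (PathwiseRough.reducedLift S (PathwiseRough.pthVariation μ))
        (PathwiseRough.gradientPath f S)) ∧
    (PathwiseRough.IsControlled q T
        (PathwiseRough.reducedLift S (PathwiseRough.pthVariation μ))
        (PathwiseRough.gradientPath f S) →
      ∀ t ∈ Set.Icc 0 T, ∃ I : ℝ,
        PathwiseRough.IsRoughIntegral ⌊q⌋₊
          (PathwiseRough.reducedLift S (PathwiseRough.pthVariation μ))
          (PathwiseRough.gradientPath f S) t I ∧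
        PathwiseRough.IsPathwiseIntegral p (PathwiseRough.dyadicLebesgue hT.le hS) S f t I) := by
  rw [hq] at hf ⊢
  set D : ℝ := d * 2 with hD
  have hosc : ∀ n, ∀ e ∈ (PathwiseRough.dyadicLebesgue hT.le hS n).intervals, ∀ r ∈ Icc e.1 e.2,
      ∀ s ∈ Icc e.1 e.2, ‖S r - S s‖ ≤ D * (2⁻¹ : ℝ) ^ n := fun n e he r hr s hs =>
    (PathwiseRough.norm_sub_le_of_mem_dyadicLebesgue hT.le hS n he hr hs).trans_eq
      (by rw [hD]; ring)
  have hδ0 : ∀ n : ℕ, 0 ≤ D * (2⁻¹ : ℝ) ^ n := fun n => by positivity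
  obtain ⟨B, hB⟩ := hμ.exists_sum_abs_pow_le hp
  obtain ⟨C, hC, hcard⟩ := PathwiseRough.exists_card_dyadicLebesgue_le hT.le hS hp0 hB
  -- The bounds `O(2 ^ (n p))` on the number of points and `O(2 ^ (-n))` on the oscillation balance
  -- exactly at the power `p`.
  have hM : ∀ n, ((PathwiseRough.dyadicLebesgue hT.le hS n).points.card : ℝ) *
      (D * (2⁻¹ : ℝ) ^ n) ^ p ≤ C * D ^ p := by
    intro n
    refine (mul_le_mul_of_nonneg_right (hcard n) (pow_nonneg (hδ0 n) p)).trans_eq ?_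
    have h : ((2 : ℝ) ^ n) ^ p * ((2⁻¹ : ℝ) ^ n) ^ p = 1 := by
      rw [← mul_pow, ← mul_pow, mul_inv_cancel₀ two_ne_zero, one_pow, one_pow]
    rw [mul_pow]
    linear_combination C * D ^ p * h
  obtain ⟨H, hHc, hHm, hH⟩ := PathwiseRough.exists_monotone_norm_rpow_le hS
    (PathwiseRough.dyadicLebesgue hT.le hS) hpq (by positivity) hcard hosc
  have hfin := PathwiseRough.isFiniteMeasure_variation μ
  have hGc := PathwiseRough.continuousOn_measureReal_le μ.variation
    (PathwiseRough.variation_singleton_eq_zero hμ.no_atoms)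
  have hX : PathwiseRough.IsReducedRoughPath q T
      (PathwiseRough.reducedLift S (PathwiseRough.pthVariation μ)) := by
    refine PathwiseRough.isReducedRoughPath_reducedLift hp0 hpq hq (fun t => hμ.symm _)
      (hHc.continuousOn.add hGc) ((hHm.add (PathwiseRough.monotone_measureReal_le μ)).monotoneOn _)
      (fun s t hs hst ht => ?_) (fun s t hs hst ht => ?_)
    · have h1 := hH s t hs hst ht
      have h2 := PathwiseRough.monotone_measureReal_le μ hst
      simp only [Pi.add_apply] at h2 ⊢
      linarith
    · have h1 := PathwiseRough.norm_pthVariation_sub_le μ hst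
      have h2 := hHm hst
      simp only [Pi.add_apply]
      linarith
  -- The explicit Itô value is the common limit of the two kinds of sums, which gives existence and
  -- equality at once.
  refine ⟨hX, fun hL => PathwiseRough.isControlled_gradientPath hpq hq hS hf hL _ hHc.continuousOn
    (hHm.monotoneOn _) hH, fun hY t ht => ⟨f (S t) - f (S 0) - (p.factorial : ℝ)⁻¹ *
      PathwiseRough.tensorIntegral μ (fun r => PathwiseRough.nabla p f (S r)) t, ?_, ?_⟩⟩
  · exact PathwiseRough.isRoughIntegral_gradientPath hp0 hpq hq hS hf
      (PathwiseRough.tendsto_mul_two_inv_pow D) hδ0 hosc hM hX hY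
      (PathwiseRough.tensorIntegral_zero hp hp0 hμ (PathwiseRough.tendsto_mul_two_inv_pow D)
        hosc ((PathwiseRough.continuous_nabla hf).comp_continuousOn hS)) ht
  · exact PathwiseRough.isPathwiseIntegral_gradient hp0 hS hf
      (PathwiseRough.tendsto_mul_two_inv_pow D) hδ0 hosc hM ht
      (PathwiseRough.tendsto_sum_inner_stopped hp hp0 hμ
        (PathwiseRough.tendsto_mul_two_inv_pow D) hosc
        ((PathwiseRough.continuous_nabla hf).comp_continuousOn hS) t)
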